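/- Let $\mathcal H$ be a finite-dimensional complex Hilbert space and let $S$ be a group of unitary operators on $\mathcal H$ such that $ghg^{-1}h^{-1}\in\{1,-1\}$ for all $g,h\in S$. Assume that $S$ is unitarily equivalent, up to scalar prefactors, to the Pauli group on some number of spins. Let $V\subseteq S$ be a finite set of hermitian operators and let $H=\sum_{g\in V}w_g\,g$ with real weights $w_g$. The frustration graph $G$ has vertex set $V$, and two operators are adjacent iff they anticommute. **Collapses.** Let $A\subseteq V$. A set $M\subseteq A$ is a module of $G[A]$ if each vertex of $A\setminus M$ is adjacent to all or to none of $M$. The set $M$ is collapsible in $G[A]$ if it is a set of false siblings (all open neighbourhoods in $G[A]$ are equal), a set of true siblings (all closed neighbourhoods in $G[A]$ are equal), or a module such that $G[M]$ is the line graph of a simple graph. A collapse sequence $V=A_0,A_1,\dots,A_c=V'$ is given by collapsible sets $M_i$ of $G[A_i]$ and vertices $v_i\in M_i$ with $A_{i+1}=(A_i\setminus M_i)\cup\{v_i\}$ for $0\le i<c$. The collapse is complete if $G[V']$ has no collapsible set with more than one vertex. **Claim.** A complete collapse sequence exists. Moreover, for every collapse sequence, complete or not, there are $r$ rounds $k=0,\dots,r-1$,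 grouped consecutively into the steps $i=0,\dots,c-1$, numbers $m_k\ge 0$, commuting hermitian unitary symmetries $s_{k,j}$ ($1\le j\le m_k$), and unitaries $U_k(x)$ for $x=(x^0,\dots,x^{r-1})\in X=\prod_k\{-1,+1\}^{m_k}$, where $U_k(x)$ depends only on $x^0,\dots,x^k$, such that the following holds. Put $$P_k(x^k)=\prod_j\tfrac12\bigl(1+x^k_j s_{k,j}\bigr),\quad U_{<k}(x)=U_{k-1}(x)\cdots U_0(x),\quad P_{R,k}(x)=U_{<k}(x)^\dagger P_k(x^k)\,U_{<k}(x),$$ $$P(x)=\prod_{k}P_{R,k}(x),\qquad U(x)=U_{<r}(x).$$ 1. *(Locality.)* For a round $k$ of step $i$, each $s_{k,j}$ is, up to a scalar, a product of an even number of operators of $M_i$. Each $U_k(x)$ is a finite product of rotations $e^{\mathrm i\theta\rho/2}$ and their inverses, where $\theta\in\mathbb R$ and $\rho$ is hermitian, unitary and, up to a scalar, a product of an even number of operators of $M_i$. The $s_{k,j}$ and the $U_k(x)$ commute with all operators in $A_i\setminus M_i$, and the $s_{k,j}$ commute with all operators in $A_{i'}$ for $i'>i$. If $M_i$ is a set of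 false siblings then $U_k=1$ for the rounds of step $i$. If $M_i$ is a set of true siblings then $m_k=0$ for the rounds of step $i$. 2. *(Commutation.)* $U_k(x)$ commutes with $P_l(y)$ for all $l\le k$ and all $y\in\{-1,+1\}^{m_l}$. For each $k$ the $P_k(y)$ are mutually orthogonal projectors with sum $1$. For each $x$ the $P_{R,k}(x)$ are orthogonal projectors that commute with each other, and for each $k$ they sum to $1$ over $x^k$, the other components of $x$ being fixed. Each partial product $\prod_{l<k}P_{R,l}(x)$ commutes with $H$. 3. *(Stages.)* There are real weights $w^i_g(x)$, $g\in A_i$, $0\le i\le c$, depending only on the components of $x$ that belong to rounds of the steps before $i$, such that, with $U_{<}$ the product of the unitaries and $P_{<}$ the product of the $P_k(x^k)$ over these rounds, $$U_{<}(x)\,H\,U_{<}(x)^\dagger\,P_{<}(x)=\Bigl(\sum_{g\in A_i}w^i_g(x)\,g\Bigr)P_{<}(x).$$ 4. *(Block diagonalisation.)* $\{P(x)\}_{x\in X}$ is a complete set of mutually orthogonal (some possibly zero) projectors, which commute with $H$, and $H=\sum_{x\in X}P(x)HP(x)$. With $H_C(x)=\sum_{g\in V'}w^c_g(x)\,g$,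 the projector $P(x)$ commutes with $U(x)^\dagger H_C(x)U(x)$, and $$H\,P(x)=U(x)^\dagger H_C(x)\,U(x)\,P(x)\qquad\text{for all }x\in X.$$ All these operators act on $\mathcal H$ itself; no ancilla spins remain. -/

import Mathlib

noncomputable section

namespace TwinCollapse

/-! ### Graphs: modules, siblings, line graphs, collapse sequences -/

section Graph

variable {α : Type*}

/-- `M` is a module of the subgraph of `G` induced by `A`: every vertex of `A` outside `M` that is
adjacent to some vertex of `M` is adjacent to all of `M`. -/
def IsModule (G : SimpleGraph α) (A M : Finset α) : Prop :=
  M ⊆ A ∧ ∀ y ∈ A, y ∉ M → (∃ x ∈ M, G.Adj x y) → ∀ x ∈ M, G.Adj x y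

/-- `M` is a set of false siblings of the subgraph of `G` induced by `A`: all vertices of `M` have
the same open neighbourhood. -/
def FalseSiblings (G : SimpleGraph α) (A M : Finset α) : Prop :=
  M ⊆ A ∧ ∀ x ∈ M, ∀ y ∈ M, ∀ z ∈ A, G.Adj x z ↔ G.Adj y z

/-- `M` is a set of true siblings of the subgraph of `G` induced by `A`: all vertices of `M` have
the same closed neighbourhood. -/
def TrueSiblings (G : SimpleGraph α) (A M : Finset α) : Prop :=
  M ⊆ A ∧ ∀ x ∈ M, ∀ y ∈ M, ∀ z ∈ A, (z = x ∨ G.Adj x z) ↔ (z = y ∨ G.Adj y z)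

/-- `H` is the line graph of a finite simple root graph. -/
def IsLineGraph {β : Type*} (H : SimpleGraph β) : Prop :=
  ∃ (n : ℕ) (R : SimpleGraph (Fin n)), Nonempty (H ≃g R.lineGraph)

/-- `M` is a line-graph module of the subgraph of `G` induced by `A`. -/
def LineGraphModule (G : SimpleGraph α) (A M : Finset α) : Prop :=
  IsModule G A M ∧ IsLineGraph (G.induce (M : Set α))

/-- The vertex sets that may be collapsed: siblings and line-graph modules. -/
def Collapsible (G : SimpleGraph α) (A M : Finset α) : Prop :=
  FalseSiblings G A M ∨ TrueSiblings G A M ∨ LineGraphModule G A M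

open Classical in
/-- A recursive collapse of `V` in `c` steps. In step `i` a collapsible set `M i` of the current
graph, the one induced by `A i`, is replaced by one of its vertices, `v i`. -/
structure IsCollapseSequence (G : SimpleGraph α) (V : Finset α) (c : ℕ)
    (A M : ℕ → Finset α) (v : ℕ → α) : Prop where
  start : A 0 = V
  collapsible : ∀ i < c, Collapsible G (A i) (M i)
  mem : ∀ i < c, v i ∈ M i
  step : ∀ i < c, A (i + 1) = insert (v i) (A i \ M i)

/-- Nothing is left to collapse in the subgraph of `G` induced by `A`. -/
def FullyCollapsed (G : SimpleGraph α) (A : Finset α) : Prop :=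
  ∀ M : Finset α, Collapsible G A M → M.card ≤ 1

end Graph

/-! ### The Pauli group -/

/-- The single-spin operator `Z ^ z * X ^ x`. -/
def pauliMatrix (z x : Fin 2) : Matrix (Fin 2) (Fin 2) ℂ :=
  !![1, 0; 0, -1] ^ (z : ℕ) * !![0, 1; 1, 0] ^ (x : ℕ)

/-- The Pauli string `⨂ i, Z ^ z i * X ^ x i` on `n` spins, in the computational basis. -/
def pauliString {n : ℕ} (z x : Fin n → Fin 2) :
    Matrix (Fin n → Fin 2) (Fin n → Fin 2) ℂ :=
  Matrix.of fun a b => ∏ i, pauliMatrix (z i) (x i) (a i) (b i)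

/-! ### Operators -/

variable {E : Type*} [NormedAddCommGroup E] [InnerProductSpace ℂ E] [CompleteSpace E]

/-- The group `S` of unitaries is unitarily equivalent to the Pauli group on some number of spins.
The scalar prefactors that are admitted in either group are immaterial: conjugation by `W` sends
each element of `S` to a multiple of a Pauli string, and every Pauli string arises in this way. -/
def EquivPauliGroup (S : Subgroup (unitary (E →L[ℂ] E))) : Prop :=
  ∃ (n : ℕ) (W : E ≃ₗᵢ[ℂ] EuclideanSpace ℂ (Fin n → Fin 2)),
    (∀ s ∈ S, ∃ (z x : Fin n → Fin 2) (a : ℂ), ∀ ψ : E,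
      W ((s : E →L[ℂ] E) ψ) = a • Matrix.toEuclideanCLM (𝕜 := ℂ) (pauliString z x) (W ψ)) ∧
    (∀ z x : Fin n → Fin 2, ∃ s ∈ S, ∃ a : ℂ, ∀ ψ : E,
      W ((s : E →L[ℂ] E) ψ) = a • Matrix.toEuclideanCLM (𝕜 := ℂ) (pauliString z x) (W ψ))

variable (E) in
/-- The frustration graph: two operators are adjacent iff their group commutator is `-1`. (The
clause `g ≠ h` only matters for `E = 0`, where `1 = -1`.) -/
def frustrationGraph : SimpleGraph (unitary (E →L[ℂ] E)) where
  Adj g h := g ≠ h ∧ g * h * g⁻¹ * h⁻¹ = -1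
  symm := ⟨fun g h hgh => ⟨hgh.1.symm, by
    have key : h * g * h⁻¹ * g⁻¹ = (g * h * g⁻¹ * h⁻¹)⁻¹ := by group
    rw [key, hgh.2]
    exact inv_eq_of_mul_eq_one_left
      (Subtype.ext (show (-1 : E →L[ℂ] E) * (-1) = 1 by simp))⟩⟩
  loopless := ⟨fun _ h => h.1 rfl⟩

/-- The linear combination of the operators in `A` with real weights `w`. -/
def hamiltonian (A : Finset (unitary (E →L[ℂ] E))) (w : unitary (E →L[ℂ] E) → ℝ) : E →L[ℂ] E :=
  ∑ g ∈ A, (w g : ℂ) • (g : E →L[ℂ] E)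

/-- `s` is, up to a scalar factor, a product of an even number of operators from `M`. -/
def IsEvenProduct (M : Finset (unitary (E →L[ℂ] E))) (s : unitary (E →L[ℂ] E)) : Prop :=
  ∃ p ∈ Subgroup.closure {u | ∃ g ∈ M, ∃ h ∈ M, u = g * h}, ∃ a : ℂ,
    (s : E →L[ℂ] E) = a • (p : E →L[ℂ] E)

/-- The group generated by the rotations `exp (i θ ρ / 2)`, `θ` real, where `ρ` is hermitian and,
up to a scalar factor, a product of an even number of operators from `M`. -/
def rotationGroup (M : Finset (unitary (E →L[ℂ] E))) : Subgroup (unitary (E →L[ℂ] E)) :=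
  Subgroup.closure {u | ∃ (θ : ℝ) (ρ : unitary (E →L[ℂ] E)),
    IsSelfAdjoint (ρ : E →L[ℂ] E) ∧ IsEvenProduct M ρ ∧
    (u : E →L[ℂ] E) = NormedSpace.exp ((Complex.I * (θ / 2 : ℝ)) • (ρ : E →L[ℂ] E))}

/-! ### Alternating projections and rotations -/

variable (E) in
/-- The data of `r` rounds of projection and rotation. Round `k` has `m k` symmetries `sym k j`,
with signs `x k j = ± 1` to choose, and then a unitary `rot k x`. -/
structure Scheme (r : ℕ) where
  m : Fin r → ℕ
  sym : (k : Fin r) → Fin (m k) → unitary (E →L[ℂ] E)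
  rot : Fin r → ((k : Fin r) → Fin (m k) → ℤˣ) → unitary (E →L[ℂ] E)

namespace Scheme

variable {r : ℕ} (D : Scheme E r)

/-- The parameter space `∏ k, {-1, +1} ^ m k`. -/
abbrev Param : Type := (k : Fin r) → Fin (D.m k) → ℤˣ

/-- The projector of round `k`, that is `∏ j, (1 + y j • sym k j) / 2`. -/
def proj (k : Fin r) (y : Fin (D.m k) → ℤˣ) : E →L[ℂ] E :=
  (List.ofFn fun j => (2⁻¹ : ℂ) • (1 + (((y j : ℤˣ) : ℤ) : ℂ) • (D.sym k j : E →L[ℂ] E))).prod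

/-- The product `U_(k-1) ⋯ U_1 U_0` of the unitaries of the first `k` rounds. -/
def rotBefore (k : ℕ) (x : D.Param) : unitary (E →L[ℂ] E) :=
  ((List.ofFn fun l => D.rot l x).take k).reverse.prod

/-- The product `P_0 P_1 ⋯ P_(k-1)` of the projectors of the first `k` rounds. -/
def projBefore (k : ℕ) (x : D.Param) : E →L[ℂ] E :=
  ((List.ofFn fun l => D.proj l (x l)).take k).prod

/-- The rotated projector of round `k`: the projector of that round, conjugated back through the
unitaries of all earlier rounds. -/
def rotProj (k : Fin r) (x : D.Param) : E →L[ℂ] E :=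
  star (D.rotBefore k x : E →L[ℂ] E) * D.proj k (x k) * (D.rotBefore k x : E →L[ℂ] E)

/-- The product of the rotated projectors of the first `k` rounds. -/
def rotProjBefore (k : ℕ) (x : D.Param) : E →L[ℂ] E :=
  ((List.ofFn fun l => D.rotProj l x).take k).prod

/-- The projector `P(x)` onto the block of `x`: the product of all rotated projectors. -/
def blockProj (x : D.Param) : E →L[ℂ] E := D.rotProjBefore r x

/-- The unitary `U(x)` of the block of `x`: the product of the unitaries of all rounds. -/
def blockRot (x : D.Param) : unitary (E →L[ℂ] E) := D.rotBefore r x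

/-- `D` carries out the collapse sequence `A, M, v` of length `c` for the Hamiltonian `H`. The
rounds `k` with `t i ≤ k < t (i + 1)` belong to step `i`, and `w i x` are the weights, in the block
of `x`, of the Hamiltonian that is left before step `i`. -/
structure CarriesOut (D : Scheme E r) (H : E →L[ℂ] E) (c : ℕ)
    (A M : ℕ → Finset (unitary (E →L[ℂ] E)))
    (t : ℕ → ℕ) (w : ℕ → D.Param → unitary (E →L[ℂ] E) → ℝ) : Prop where
  t_mono : Monotone t
  t_zero : t 0 = 0
  t_last : t c = r
  /-- The symmetries are hermitian and built from the operators of the collapsed module. -/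
  sym_selfAdjoint : ∀ k j, IsSelfAdjoint (D.sym k j : E →L[ℂ] E)
  sym_mem : ∀ i < c, ∀ k : Fin r, t i ≤ k → (k : ℕ) < t (i + 1) →
    ∀ j, IsEvenProduct (M i) (D.sym k j)
  /-- All symmetries commute with each other. -/
  sym_comm : ∀ k j l j', Commute (D.sym k j) (D.sym l j')
  /-- The symmetries of earlier steps commute with all operators that are left. -/
  sym_comm_left : ∀ i ≤ c, ∀ k : Fin r, (k : ℕ) < t i → ∀ j, ∀ g ∈ A i, Commute (D.sym k j) g
  /-- The symmetries of a step commute with all operators outside the module. -/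
  sym_comm_outside : ∀ i < c, ∀ k : Fin r, t i ≤ k → (k : ℕ) < t (i + 1) →
    ∀ j, ∀ g ∈ A i, g ∉ M i → Commute (D.sym k j) g
  /-- A unitary depends only on the signs chosen so far. -/
  rot_congr : ∀ (k : Fin r) (x y : D.Param), (∀ l ≤ k, x l = y l) → D.rot k x = D.rot k y
  /-- The unitaries act locally: they are products of rotations whose exponents are built from the
  operators of the module, and they commute with all operators outside the module. -/
  rot_mem : ∀ i < c, ∀ k : Fin r, t i ≤ k → (k : ℕ) < t (i + 1) →
    ∀ x, D.rot k x ∈ rotationGroup (M i)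
  rot_comm_outside : ∀ i < c, ∀ k : Fin r, t i ≤ k → (k : ℕ) < t (i + 1) →
    ∀ x, ∀ g ∈ A i, g ∉ M i → Commute (D.rot k x) g
  /-- The unitaries commute with the projectors of their own and of all earlier rounds. -/
  rot_comm_proj : ∀ l k : Fin r, l ≤ k → ∀ x y,
    Commute (D.rot k x : E →L[ℂ] E) (D.proj l y)
  /-- False siblings are collapsed by projections alone. -/
  false_siblings : ∀ i < c, FalseSiblings (frustrationGraph E) (A i) (M i) →
    ∀ k : Fin r, t i ≤ k → (k : ℕ) < t (i + 1) → ∀ x, D.rot k x = 1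
  /-- True siblings are collapsed by rotations alone. -/
  true_siblings : ∀ i < c, TrueSiblings (frustrationGraph E) (A i) (M i) →
    ∀ k : Fin r, t i ≤ k → (k : ℕ) < t (i + 1) → D.m k = 0
  /-- In each round the projectors form a complete set of orthogonal projectors. -/
  proj_isStarProjection : ∀ k y, IsStarProjection (D.proj k y)
  proj_orthogonal : ∀ k y y', y ≠ y' → D.proj k y * D.proj k y' = 0
  proj_complete : ∀ k, ∑ y, D.proj k y = 1
  /-- The rotated projectors are orthogonal projectors, complete in each round, and commute. -/
  rotProj_isStarProjection : ∀ k x, IsStarProjection (D.rotProj k x)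
  rotProj_complete : ∀ k x, ∑ y, D.rotProj k (Function.update x k y) = 1
  rotProj_comm : ∀ k l x, Commute (D.rotProj k x) (D.rotProj l x)
  /-- At each stage the projectors are symmetries of the Hamiltonian. -/
  comm : ∀ k ≤ r, ∀ x, Commute H (D.rotProjBefore k x)
  /-- The weights of a stage depend only on the signs chosen before. -/
  weight_congr : ∀ i ≤ c, ∀ x y : D.Param, (∀ l : Fin r, (l : ℕ) < t i → x l = y l) →
    ∀ g ∈ A i, w i x g = w i y g
  /-- At each stage, in the rotated frame and within the block of `x`, the Hamiltonian is the
  collapsed Hamiltonian on the operators that are left. -/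
  stage : ∀ i ≤ c, ∀ x,
    (D.rotBefore (t i) x : E →L[ℂ] E) * H * star (D.rotBefore (t i) x : E →L[ℂ] E) *
        D.projBefore (t i) x =
      hamiltonian (A i) (w i x) * D.projBefore (t i) x

end Scheme

end TwinCollapse

end

/-!
A collapse sequence is realised step by step, by two rounds for each step. The symmetries of the
first round commute with all operators of the current module `M`; they are followed by a rotation;
the symmetries of the second round need to commute only with the operator `v` that survives, and no
further rotation follows. What one step has to provide is `CollapseData.IsValid`, and `exists_collapse`
provides it for each of the three kinds of collapsible sets.

* False siblings commute. The products `g * v` are the symmetries, and in a joint eigenspace each `g`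
  is `± v`. There is no rotation.
* True siblings anticommute. The products `I • (g * v)` generate the rotations of the planes of `g`
  and `v`, which turn any real linear combination into a multiple of `v`. There are no symmetries.
* A module whose graph is a line graph is solved by free fermions. The operators of `M` belong to the
  edges of a root graph, and products of them have a boundary in the vertices, modulo `2`; two
  products commute iff their boundaries have even intersection (`IsEdgeProd.comm`). Choosing a root in
  each class of vertices that are joined by even products gives operators that multiply and commute
  like bilinears `I γₐ γ_b` of Majorana operators (`exists_majoranaSystem`), although no Majorana
  operators act on the space. An operator of `M` and the bilinear of its edge have the same boundary,
  so their product commutes with all of `M`: these are the symmetries of the first round. In their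
  joint eigenspaces the part of the Hamiltonian in `M` is a quadratic form in the bilinears. Even
  products act on such forms by rotations of the planes of two vertices of one class
  (`exists_rotation_givens`). A singular value decomposition, made of these plane rotations only,
  brings an antisymmetric matrix to a normal form with entries at fixed disjoint pairs of vertices,
  one of them the edge of `v` (`exists_normalForm`). The bilinears of these pairs commute, and their
  products with `v` are the symmetries of the second round.

An operator outside a module commutes or anticommutes with all of the module. So it commutes with all
even products, hence with the symmetries and rotations of the step (`IsModule.commute_evenProduct`),
and it is not affected by the step. The symmetries commute with all operators that are left, so with
everything built from them later on. That is what `Scheme.IsCoherent` records, and it suffices for the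
projectors, conjugated back through the earlier rotations, to be commuting and complete. A complete
collapse exists since each collapse of more than one vertex makes the graph smaller.
-/

namespace TwinCollapse

/-! ### Joint spectral projectors of commuting symmetries -/

section SignProj

theorem eq_zero_of_eq_neg {B : Type*} [AddCommGroup B] [Module ℂ B] {z : B} (h : z = -z) :
    z = 0 := by
  have h2 : (2 : ℂ) • z = 0 := by
    rw [two_smul]
    nth_rw 1 [h]
    exact neg_add_cancel z
  exact (smul_eq_zero.1 h2).resolve_left two_ne_zero

variable {B : Type*} [Ring B] [Algebra ℂ B]

/-- The joint spectral projector `∏ j, (1 + y j • s j) / 2` of a family of commuting involutions. -/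
noncomputable def signProj {n : ℕ} (s : Fin n → B) (y : Fin n → ℤˣ) : B :=
  (List.ofFn fun j => (2⁻¹ : ℂ) • (1 + (((y j : ℤˣ) : ℤ) : ℂ) • s j)).prod

theorem signProj_zero (s : Fin 0 → B) (y : Fin 0 → ℤˣ) : signProj s y = 1 := by
  simp [signProj]

theorem signProj_succ {n : ℕ} (s : Fin (n + 1) → B) (y : Fin (n + 1) → ℤˣ) :
    signProj s y = (2⁻¹ : ℂ) • (1 + (((y 0 : ℤˣ) : ℤ) : ℂ) • s 0) *
      signProj (fun j => s j.succ) (fun j => y j.succ) := by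
  simp [signProj, List.ofFn_succ]

theorem commute_signProj {n : ℕ} {s : Fin n → B} {b : B} (h : ∀ j, Commute b (s j))
    (y : Fin n → ℤˣ) : Commute b (signProj s y) := by
  refine Commute.list_prod_right _ _ fun z hz => ?_
  obtain ⟨j, rfl⟩ := (List.mem_ofFn' _ _).1 hz
  exact ((Commute.one_right b).add_right ((h j).smul_right _)).smul_right _

theorem intCast_units_sq (a : ℤˣ) : (((a : ℤ) : ℂ)) * ((a : ℤ) : ℂ) = 1 := by
  rcases Int.units_eq_one_or a with rfl | rfl <;> simp

theorem mul_signProj {n : ℕ} {s : Fin n → B} (hs : ∀ j, s j * s j = 1)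
    (hc : ∀ i j, Commute (s i) (s j)) (y : Fin n → ℤˣ) (j : Fin n) :
    s j * signProj s y = (((y j : ℤˣ) : ℤ) : ℂ) • signProj s y := by
  induction n with
  | zero => exact j.elim0
  | succ n ih =>
    rw [signProj_succ]
    refine Fin.cases ?_ (fun j => ?_) j
    · have h : s 0 * ((2⁻¹ : ℂ) • (1 + (((y 0 : ℤˣ) : ℤ) : ℂ) • s 0)) =
          (((y 0 : ℤˣ) : ℤ) : ℂ) • ((2⁻¹ : ℂ) • (1 + (((y 0 : ℤˣ) : ℤ) : ℂ) • s 0)) := by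
        rw [smul_comm, mul_smul_comm, smul_add, smul_smul, intCast_units_sq, mul_add, mul_one,
          mul_smul_comm, hs, one_smul, add_comm]
      rw [← mul_assoc, h, smul_mul_assoc]
    · have h : Commute (s j.succ) ((2⁻¹ : ℂ) • (1 + (((y 0 : ℤˣ) : ℤ) : ℂ) • s 0)) :=
        ((Commute.one_right _).add_right ((hc _ _).smul_right _)).smul_right _
      rw [← mul_assoc, h.eq, mul_assoc,
        ih (fun j => hs j.succ) (fun i j => hc i.succ j.succ) (fun j => y j.succ) j, mul_smul_comm]

theorem signProj_mul_signProj_of_ne {n : ℕ} {s : Fin n → B} (hs : ∀ j, s j * s j = 1)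
    (hc : ∀ i j, Commute (s i) (s j)) {y y' : Fin n → ℤˣ} (h : y ≠ y') :
    signProj s y * signProj s y' = 0 := by
  obtain ⟨j, hj⟩ := Function.ne_iff.1 h
  have h1 := congrArg (· * signProj s y') (mul_signProj hs hc y j)
  have h2 := congrArg (signProj s y * ·) (mul_signProj hs hc y' j)
  simp only [smul_mul_assoc, mul_smul_comm] at h1 h2
  rw [(commute_signProj (hc j) y).eq, mul_assoc, h2] at h1
  have h3 : y' j = -y j := Int.units_ne_iff_eq_neg.1 hj.symm
  have h4 : ((y j : ℤ) : ℂ) • (signProj s y * signProj s y') = 0 := by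
    rw [h3, Units.val_neg, Int.cast_neg, neg_smul] at h1
    exact eq_zero_of_eq_neg h1.symm
  rw [← one_smul ℂ (signProj s y * signProj s y'), ← intCast_units_sq (y j), mul_smul, h4,
    smul_zero]

theorem sum_signProj {n : ℕ} (s : Fin n → B) : ∑ y, signProj s y = 1 := by
  induction n with
  | zero => simp [signProj_zero]
  | succ n ih =>
    rw [← (Fin.consEquiv fun _ : Fin (n + 1) => ℤˣ).sum_comp, Fintype.sum_prod_type]
    simp only [signProj_succ, Fin.consEquiv_apply, Fin.cons_zero, Fin.cons_succ]
    simp only [← Finset.mul_sum, ih, mul_one]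
    have : (Finset.univ : Finset ℤˣ) = {1, -1} := rfl
    rw [this, Finset.sum_pair (by decide), ← smul_add]
    simp only [Units.val_one, Int.cast_one, one_smul, Units.val_neg, Int.cast_neg, neg_smul]
    rw [show (1 + s 0 + (1 + -s 0) : B) = (2 : ℂ) • (1 : B) by rw [two_smul]; abel, smul_smul]
    simp

variable [StarRing B] [StarModule ℂ B]

theorem isStarProjection_signProj {n : ℕ} {s : Fin n → B} (hs : ∀ j, s j * s j = 1)
    (hc : ∀ i j, Commute (s i) (s j)) (hsa : ∀ j, IsSelfAdjoint (s j)) (y : Fin n → ℤˣ) :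
    IsStarProjection (signProj s y) := by
  constructor
  · have h1 := Finset.mul_sum Finset.univ (fun y' => signProj s y') (signProj s y)
    rw [sum_signProj, mul_one, Finset.sum_eq_single y
      (fun y' _ h => signProj_mul_signProj_of_ne hs hc h.symm) (by simp)] at h1
    exact h1.symm
  · induction n with
    | zero => rw [signProj_zero]; exact IsSelfAdjoint.one B
    | succ n ih =>
      rw [signProj_succ]
      have h : IsSelfAdjoint ((2⁻¹ : ℂ) • (1 + (((y 0 : ℤˣ) : ℤ) : ℂ) • s 0)) := by
        have h1 : IsSelfAdjoint (((y 0 : ℤˣ) : ℤ) : ℂ) := by simp [isSelfAdjoint_iff]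
        have h2 : IsSelfAdjoint (2⁻¹ : ℂ) := by simp [isSelfAdjoint_iff]
        exact h2.smul ((IsSelfAdjoint.one B).add (h1.smul (hsa 0)))
      refine (h.commute_iff (ih (fun j => hs j.succ) (fun i j => hc i.succ j.succ)
        (fun j => hsa j.succ) _)).1 (commute_signProj (fun j => ?_) _)
      exact (((Commute.one_right _).add_right ((hc _ _).smul_right _)).smul_right _).symm

end SignProj

/-! ### Schemes of commuting symmetries -/

section Involution

variable {B : Type*} [Monoid B] [StarMul B]

theorem mul_self_of_isSelfAdjoint {u : unitary B} (h : IsSelfAdjoint (u : B)) :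
    (u : B) * (u : B) = 1 := by
  have h1 := Unitary.coe_star_mul_self u
  rwa [h.star_eq] at h1

end Involution

variable {E : Type*} [NormedAddCommGroup E] [InnerProductSpace ℂ E] [CompleteSpace E]

theorem coe_commute {u v : unitary (E →L[ℂ] E)} (h : Commute u v) :
    Commute (u : E →L[ℂ] E) (v : E →L[ℂ] E) :=
  congrArg Subtype.val h.eq

theorem commute_of_coe {u v : unitary (E →L[ℂ] E)}
    (h : Commute (u : E →L[ℂ] E) (v : E →L[ℂ] E)) : Commute u v :=
  Subtype.ext h.eq

namespace Scheme

variable {r : ℕ} {D : Scheme E r}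

theorem rotBefore_zero (x : D.Param) : D.rotBefore 0 x = 1 := by simp [rotBefore]

theorem projBefore_zero (x : D.Param) : D.projBefore 0 x = 1 := by simp [projBefore]

theorem rotProjBefore_zero (x : D.Param) : D.rotProjBefore 0 x = 1 := by simp [rotProjBefore]

theorem take_ofFn_succ {β : Type*} {n : ℕ} (f : Fin n → β) (k : Fin n) :
    (List.ofFn f).take (k + 1) = (List.ofFn f).take k ++ [f k] := by
  rw [List.take_add_one, List.getElem?_ofFn]
  simp

theorem rotBefore_succ (k : Fin r) (x : D.Param) :
    D.rotBefore (k + 1) x = D.rot k x * D.rotBefore k x := by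
  simp [rotBefore, take_ofFn_succ]

theorem projBefore_succ (k : Fin r) (x : D.Param) :
    D.projBefore (k + 1) x = D.projBefore k x * D.proj k (x k) := by
  simp [projBefore, take_ofFn_succ]

theorem rotProjBefore_succ (k : Fin r) (x : D.Param) :
    D.rotProjBefore (k + 1) x = D.rotProjBefore k x * D.rotProj k x := by
  simp [rotProjBefore, take_ofFn_succ]

variable (D) in
/-- The structural part of a scheme: hermitian commuting symmetries, and unitaries that commute
with the symmetries of all rounds up to their own and look at the signs of these rounds only. -/
structure IsCoherent : Prop where
  sym_selfAdjoint : ∀ k j, IsSelfAdjoint (D.sym k j : E →L[ℂ] E)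
  sym_comm : ∀ k j l j', Commute (D.sym k j) (D.sym l j')
  rot_congr : ∀ (k : Fin r) (x y : D.Param), (∀ l ≤ k, x l = y l) → D.rot k x = D.rot k y
  rot_comm_sym : ∀ l k : Fin r, l ≤ k → ∀ x j, Commute (D.rot k x) (D.sym l j)

namespace IsCoherent

variable (hD : D.IsCoherent)
include hD

theorem proj_isStarProjection (k : Fin r) (y : Fin (D.m k) → ℤˣ) :
    IsStarProjection (D.proj k y) :=
  isStarProjection_signProj (fun j => mul_self_of_isSelfAdjoint (hD.sym_selfAdjoint k j))
    (fun i j => coe_commute (hD.sym_comm k i k j)) (hD.sym_selfAdjoint k) y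

theorem proj_orthogonal (k : Fin r) (y y' : Fin (D.m k) → ℤˣ) (h : y ≠ y') :
    D.proj k y * D.proj k y' = 0 :=
  signProj_mul_signProj_of_ne (fun j => mul_self_of_isSelfAdjoint (hD.sym_selfAdjoint k j))
    (fun i j => coe_commute (hD.sym_comm k i k j)) h

omit hD in
theorem proj_complete (k : Fin r) : ∑ y, D.proj k y = 1 := sum_signProj _

theorem sym_mul_proj (k : Fin r) (y : Fin (D.m k) → ℤˣ) (j : Fin (D.m k)) :
    (D.sym k j : E →L[ℂ] E) * D.proj k y = (((y j : ℤˣ) : ℤ) : ℂ) • D.proj k y :=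
  mul_signProj (s := fun j => (D.sym k j : E →L[ℂ] E))
    (fun j => mul_self_of_isSelfAdjoint (hD.sym_selfAdjoint k j))
    (fun i j => coe_commute (hD.sym_comm k i k j)) y j

omit hD in
theorem commute_proj {b : E →L[ℂ] E} {k : Fin r}
    (h : ∀ j, Commute b (D.sym k j : E →L[ℂ] E)) (y : Fin (D.m k) → ℤˣ) :
    Commute b (D.proj k y) := commute_signProj h y

theorem proj_comm (k l : Fin r) (y : Fin (D.m k) → ℤˣ) (y' : Fin (D.m l) → ℤˣ) :
    Commute (D.proj k y) (D.proj l y') :=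
  commute_proj (fun j => (commute_proj (fun j' => coe_commute (hD.sym_comm l j k j')) y).symm) y'

theorem rot_comm_proj (l k : Fin r) (h : l ≤ k) (x : D.Param) (y : Fin (D.m l) → ℤˣ) :
    Commute (D.rot k x : E →L[ℂ] E) (D.proj l y) :=
  commute_proj (fun j => coe_commute (hD.rot_comm_sym l k h x j)) y

omit hD in
theorem commute_projBefore {b : E →L[ℂ] E} {k : ℕ} (hk : k ≤ r)
    (h : ∀ l : Fin r, (l : ℕ) < k → ∀ j, Commute b (D.sym l j : E →L[ℂ] E)) (x : D.Param) :
    Commute b (D.projBefore k x) := by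
  induction k with
  | zero => rw [projBefore_zero]; exact Commute.one_right b
  | succ k ih =>
    rw [projBefore_succ (⟨k, hk⟩ : Fin r)]
    exact (ih (by omega) fun l hl => h l (by omega)).mul_right
      (commute_proj (h ⟨k, hk⟩ (Nat.lt_succ_self k)) _)

theorem projBefore_comm_proj {k : ℕ} (hk : k ≤ r) (x : D.Param) (l : Fin r)
    (y : Fin (D.m l) → ℤˣ) : Commute (D.projBefore k x) (D.proj l y) :=
  (commute_projBefore hk (fun _ _ _ =>
    (commute_proj (fun _ => coe_commute (hD.sym_comm _ _ _ _)) y).symm) x).symm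

theorem projBefore_isStarProjection {k : ℕ} (hk : k ≤ r) (x : D.Param) :
    IsStarProjection (D.projBefore k x) := by
  induction k with
  | zero => rw [projBefore_zero]; exact IsStarProjection.one _
  | succ k ih =>
    rw [projBefore_succ (⟨k, hk⟩ : Fin r)]
    exact (ih (by omega)).mul (hD.proj_isStarProjection _ _)
      (hD.projBefore_comm_proj (by omega) x _ _)

/-- The range of a product of projectors lies in the eigenspaces of all symmetries involved. -/
theorem sym_mul_projBefore {k : ℕ} (hk : k ≤ r) (x : D.Param) (l : Fin r) (hl : (l : ℕ) < k)
    (j : Fin (D.m l)) : (D.sym l j : E →L[ℂ] E) * D.projBefore k x =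
      (((x l j : ℤˣ) : ℤ) : ℂ) • D.projBefore k x := by
  induction k with
  | zero => omega
  | succ k ih =>
    rw [projBefore_succ (⟨k, hk⟩ : Fin r)]
    rcases Nat.lt_succ_iff_lt_or_eq.1 hl with h | h
    · rw [← mul_assoc, ih (by omega) h, smul_mul_assoc]
    · obtain rfl : l = ⟨k, hk⟩ := Fin.ext h
      rw [(hD.projBefore_comm_proj (by omega) x _ _).eq, ← mul_assoc, hD.sym_mul_proj,
        smul_mul_assoc]

theorem projBefore_mul_proj {k : ℕ} (hk : k ≤ r) (x : D.Param) (l : Fin r) (hl : (l : ℕ) < k) :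
    D.projBefore k x * D.proj l (x l) = D.projBefore k x := by
  induction k with
  | zero => omega
  | succ k ih =>
    rw [projBefore_succ (⟨k, hk⟩ : Fin r)]
    rcases Nat.lt_succ_iff_lt_or_eq.1 hl with h | h
    · rw [mul_assoc, (hD.proj_comm _ _ _ _).eq, ← mul_assoc, ih (by omega) h]
    · obtain rfl : l = ⟨k, hk⟩ := Fin.ext h
      rw [mul_assoc, (hD.proj_isStarProjection _ _).isIdempotentElem.eq]

theorem rotBefore_congr {k : ℕ} (hk : k ≤ r) {x y : D.Param}
    (h : ∀ l : Fin r, (l : ℕ) < k → x l = y l) : D.rotBefore k x = D.rotBefore k y := by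
  induction k with
  | zero => rw [rotBefore_zero, rotBefore_zero]
  | succ k ih =>
    rw [rotBefore_succ (⟨k, hk⟩ : Fin r), rotBefore_succ (⟨k, hk⟩ : Fin r),
      ih (by omega) fun l hl => h l (by omega),
      hD.rot_congr _ x y fun l hl => h l (Nat.lt_succ_of_le hl)]

omit hD in
theorem conj_eq_of_commute {u w : unitary (E →L[ℂ] E)} {b : E →L[ℂ] E}
    (h : Commute (u : E →L[ℂ] E) b) :
    star ((u * w : unitary (E →L[ℂ] E)) : E →L[ℂ] E) * b * ((u * w : unitary (E →L[ℂ] E)) : E →L[ℂ] E)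
      = star (w : E →L[ℂ] E) * b * (w : E →L[ℂ] E) := by
  have h1 : star (u : E →L[ℂ] E) * (u : E →L[ℂ] E) = 1 := by simp
  calc _ = star (w : E →L[ℂ] E) * (star (u : E →L[ℂ] E) * (b * u)) * w := by
        simp only [Submonoid.coe_mul, star_mul, mul_assoc]
    _ = _ := by rw [← h.eq, ← mul_assoc (star (u : E →L[ℂ] E)), h1, one_mul]

/-- Later unitaries commute with earlier projectors, so a rotated projector may be computed with
the unitaries of any number of further rounds. -/
theorem rotProj_eq (l : Fin r) {k : ℕ} (hlk : (l : ℕ) ≤ k) (hk : k ≤ r) (x : D.Param) :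
    D.rotProj l x =
      star (D.rotBefore k x : E →L[ℂ] E) * D.proj l (x l) * (D.rotBefore k x : E →L[ℂ] E) := by
  induction k, hlk using Nat.le_induction with
  | base => rfl
  | succ k hlk ih =>
    rw [ih (by omega), rotBefore_succ (⟨k, hk⟩ : Fin r),
      conj_eq_of_commute (hD.rot_comm_proj l ⟨k, hk⟩ hlk x _)]

theorem rotProjBefore_eq {k : ℕ} (hk : k ≤ r) (x : D.Param) :
    D.rotProjBefore k x =
      star (D.rotBefore k x : E →L[ℂ] E) * D.projBefore k x * (D.rotBefore k x : E →L[ℂ] E) := by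
  induction k with
  | zero => simp [rotProjBefore_zero, rotBefore_zero, projBefore_zero]
  | succ k ih =>
    have h1 : (D.rotBefore k x : E →L[ℂ] E) * star (D.rotBefore k x : E →L[ℂ] E) = 1 := by simp
    have h2 : Commute (D.rot ⟨k, hk⟩ x : E →L[ℂ] E) (D.projBefore (k + 1) x) :=
      commute_projBefore hk (fun l hl j =>
        coe_commute (hD.rot_comm_sym l ⟨k, hk⟩ (Nat.lt_succ_iff.1 hl) x j)) x
    rw [rotProjBefore_succ (⟨k, hk⟩ : Fin r), ih (by omega), rotBefore_succ (⟨k, hk⟩ : Fin r),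
      conj_eq_of_commute h2, projBefore_succ (⟨k, hk⟩ : Fin r), rotProj]
    simp only [mul_assoc]
    rw [← mul_assoc (D.rotBefore k x : E →L[ℂ] E) (star (D.rotBefore k x : E →L[ℂ] E)), h1, one_mul]

omit hD in
theorem isStarProjection_conj {u : unitary (E →L[ℂ] E)} {p : E →L[ℂ] E} (h : IsStarProjection p) :
    IsStarProjection (star (u : E →L[ℂ] E) * p * (u : E →L[ℂ] E)) := by
  have h1 : (u : E →L[ℂ] E) * star (u : E →L[ℂ] E) = 1 := by simp
  constructor
  · rw [IsIdempotentElem]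
    simp only [mul_assoc]
    rw [← mul_assoc (u : E →L[ℂ] E) (star (u : E →L[ℂ] E)), h1, one_mul, ← mul_assoc p p,
      h.isIdempotentElem.eq]
  · rw [isSelfAdjoint_iff]
    simp [mul_assoc, h.isSelfAdjoint.star_eq]

omit hD in
theorem commute_conj {u : unitary (E →L[ℂ] E)} {p q : E →L[ℂ] E} (h : Commute p q) :
    Commute (star (u : E →L[ℂ] E) * p * (u : E →L[ℂ] E))
      (star (u : E →L[ℂ] E) * q * (u : E →L[ℂ] E)) := by
  have h1 : (u : E →L[ℂ] E) * star (u : E →L[ℂ] E) = 1 := by simp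
  rw [Commute, SemiconjBy]
  simp only [mul_assoc]
  rw [← mul_assoc (u : E →L[ℂ] E) (star (u : E →L[ℂ] E)), h1, one_mul,
    ← mul_assoc (u : E →L[ℂ] E) (star (u : E →L[ℂ] E)), h1, one_mul, ← mul_assoc p q, h.eq,
    mul_assoc]

theorem rotProj_isStarProjection (k : Fin r) (x : D.Param) : IsStarProjection (D.rotProj k x) :=
  isStarProjection_conj (hD.proj_isStarProjection _ _)

theorem rotProjBefore_isStarProjection {k : ℕ} (hk : k ≤ r) (x : D.Param) :
    IsStarProjection (D.rotProjBefore k x) := by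
  rw [hD.rotProjBefore_eq hk]
  exact isStarProjection_conj (hD.projBefore_isStarProjection hk x)

theorem rotProj_comm (k l : Fin r) (x : D.Param) : Commute (D.rotProj k x) (D.rotProj l x) := by
  rw [hD.rotProj_eq k k.2.le le_rfl, hD.rotProj_eq l l.2.le le_rfl]
  exact commute_conj (hD.proj_comm _ _ _ _)

theorem rotProj_update (k : Fin r) (x : D.Param) (y : Fin (D.m k) → ℤˣ) :
    D.rotProj k (Function.update x k y) =
      star (D.rotBefore k x : E →L[ℂ] E) * D.proj k y * (D.rotBefore k x : E →L[ℂ] E) := by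
  rw [rotProj, Function.update_self, hD.rotBefore_congr (k := k) k.2.le (y := x)]
  intro l hl
  exact Function.update_of_ne (Fin.ne_of_lt hl) _ _

theorem rotProj_complete (k : Fin r) (x : D.Param) :
    ∑ y, D.rotProj k (Function.update x k y) = 1 := by
  simp only [hD.rotProj_update]
  rw [← Finset.sum_mul, ← Finset.mul_sum, proj_complete]
  simp

theorem rotProj_congr (k : Fin r) {x y : D.Param} (h : ∀ l ≤ k, x l = y l) :
    D.rotProj k x = D.rotProj k y := by
  rw [rotProj, rotProj, h k le_rfl, hD.rotBefore_congr k.2.le fun l hl => h l (le_of_lt hl)]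

theorem rotProjBefore_congr {k : ℕ} (hk : k ≤ r) {x y : D.Param}
    (h : ∀ l : Fin r, (l : ℕ) < k → x l = y l) : D.rotProjBefore k x = D.rotProjBefore k y := by
  induction k with
  | zero => rw [rotProjBefore_zero, rotProjBefore_zero]
  | succ k ih =>
    rw [rotProjBefore_succ (⟨k, hk⟩ : Fin r), rotProjBefore_succ (⟨k, hk⟩ : Fin r),
      ih (by omega) fun l hl => h l (by omega),
      hD.rotProj_congr _ fun l hl => h l (Nat.lt_succ_of_le hl)]

theorem blockProj_mul_rotProj (k : Fin r) (x : D.Param) :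
    D.blockProj x * D.rotProj k x = D.blockProj x := by
  have h1 : (D.rotBefore r x : E →L[ℂ] E) * star (D.rotBefore r x : E →L[ℂ] E) = 1 := by simp
  rw [blockProj, hD.rotProjBefore_eq le_rfl, hD.rotProj_eq k k.2.le le_rfl]
  simp only [mul_assoc]
  rw [← mul_assoc (D.rotBefore r x : E →L[ℂ] E) (star (D.rotBefore r x : E →L[ℂ] E)), h1, one_mul,
    ← mul_assoc (D.projBefore r x), hD.projBefore_mul_proj le_rfl x k k.2]

theorem blockProj_orthogonal {x y : D.Param} (h : x ≠ y) :
    D.blockProj x * D.blockProj y = 0 := by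
  -- the first round in which the signs differ already separates the two blocks
  obtain ⟨k, hk, hmin⟩ : ∃ k : Fin r, x k ≠ y k ∧ ∀ l < k, x l = y l := by
    obtain ⟨k, hk⟩ := Function.ne_iff.1 h
    obtain ⟨k, hk, hmin⟩ := WellFounded.has_min (wellFounded_lt (α := Fin r)) {k | x k ≠ y k} ⟨k, hk⟩
    exact ⟨k, hk, fun l hl => not_not.1 fun h => hmin l h hl⟩
  have h1 : (D.rotBefore k y : E →L[ℂ] E) * star (D.rotBefore k y : E →L[ℂ] E) = 1 := by simp
  have h2 : D.rotProj k x * D.rotProj k y = 0 := by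
    rw [rotProj, rotProj, hD.rotBefore_congr k.2.le fun l hl => hmin l hl]
    simp only [mul_assoc]
    rw [← mul_assoc (D.rotBefore k y : E →L[ℂ] E) (star (D.rotBefore k y : E →L[ℂ] E)), h1, one_mul,
      ← mul_assoc (D.proj k (x k)), hD.proj_orthogonal k _ _ hk]
    simp
  have h3 : D.rotProj k y * D.blockProj y = D.blockProj y := by
    have := congrArg star (hD.blockProj_mul_rotProj k y)
    have h4 : star (D.blockProj y) = D.blockProj y :=
      (hD.rotProjBefore_isStarProjection le_rfl y).isSelfAdjoint.star_eq
    rwa [star_mul, h4, (hD.rotProj_isStarProjection k y).isSelfAdjoint.star_eq] at this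
  rw [← hD.blockProj_mul_rotProj k x, ← h3, mul_assoc, ← mul_assoc (D.rotProj k x), h2]
  simp

omit hD in
theorem sum_sum_update (k : Fin r) (F : D.Param → E →L[ℂ] E) :
    ∑ x, ∑ y, F (Function.update x k y) = Fintype.card (Fin (D.m k) → ℤˣ) • ∑ x, F x := by
  rw [← Fintype.sum_prod_type']
  -- exchanging the entry of round `k` with the extra one is a bijection
  let e : D.Param × (Fin (D.m k) → ℤˣ) ≃ D.Param × (Fin (D.m k) → ℤˣ) :=
    { toFun := fun p => (Function.update p.1 k p.2, p.1 k)
      invFun := fun p => (Function.update p.1 k p.2, p.1 k)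
      left_inv := fun p => by simp
      right_inv := fun p => by simp }
  rw [show ∑ p : D.Param × (Fin (D.m k) → ℤˣ), F (Function.update p.1 k p.2) =
      ∑ p : D.Param × (Fin (D.m k) → ℤˣ), F p.1 from
    e.sum_comp (fun p => F p.1), Fintype.sum_prod_type]
  simp [Finset.smul_sum]

/-- Summing over the signs of one round after the other removes the rotated projectors from the
last to the first. -/
theorem sum_blockProj : ∑ x, D.blockProj x = 1 := by
  have key : ∀ k ≤ r, ∃ a : ℂ, ∑ x, D.rotProjBefore k x = a • (1 : E →L[ℂ] E) ∧
      a * ∏ l : Fin r, (if (l : ℕ) < k then (Fintype.card (Fin (D.m l) → ℤˣ) : ℂ) else 1) =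
        ∏ l : Fin r, (Fintype.card (Fin (D.m l) → ℤˣ) : ℂ) := by
    intro k hk
    induction k with
    | zero =>
      refine ⟨Fintype.card D.Param, ?_, ?_⟩
      · simp only [rotProjBefore_zero]
        rw [Finset.sum_const, Nat.cast_smul_eq_nsmul, Finset.card_univ]
      · simp only [Nat.not_lt_zero, if_false, Finset.prod_const_one, mul_one]
        rw [Fintype.card_pi]
        push_cast
        rfl
    | succ k ih =>
      obtain ⟨a, ha, ha'⟩ := ih (by omega)
      let n : Fin r := ⟨k, hk⟩
      have hn : (Fintype.card (Fin (D.m n) → ℤˣ) : ℂ) ≠ 0 :=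
        Nat.cast_ne_zero.2 Fintype.card_ne_zero
      refine ⟨a / Fintype.card (Fin (D.m n) → ℤˣ), ?_, ?_⟩
      · have h := sum_sum_update n fun x => D.rotProjBefore (k + 1) x
        have h' : ∀ x, ∑ y, D.rotProjBefore (k + 1) (Function.update x n y) =
            D.rotProjBefore k x := by
          intro x
          have : ∀ y, D.rotProjBefore (k + 1) (Function.update x n y) =
              D.rotProjBefore k x * D.rotProj n (Function.update x n y) := fun y => by
            rw [rotProjBefore_succ n, hD.rotProjBefore_congr n.2.le (y := x)]
            intro l hl
            exact Function.update_of_ne (Fin.ne_of_lt hl) _ _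
          simp only [this]
          rw [← Finset.mul_sum, hD.rotProj_complete, mul_one]
        rw [Finset.sum_congr rfl fun x _ => h' x, ha, ← Nat.cast_smul_eq_nsmul ℂ] at h
        rw [div_eq_inv_mul, mul_smul, h, smul_smul, inv_mul_cancel₀ hn, one_smul]
      · rw [← ha']
        have h1 : ∀ l : Fin r, (if (l : ℕ) < k + 1 then (Fintype.card (Fin (D.m l) → ℤˣ) : ℂ) else 1)
            = (if (l : ℕ) < k then (Fintype.card (Fin (D.m l) → ℤˣ) : ℂ) else 1) *
              (if l = n then (Fintype.card (Fin (D.m l) → ℤˣ) : ℂ) else 1) := by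
          intro l
          rcases lt_trichotomy (l : ℕ) k with h | h | h
          · rw [if_pos (by omega), if_pos h, if_neg (fun h' => by simp [h', n] at h), mul_one]
          · rw [if_pos (by omega), if_neg (by omega), if_pos (Fin.ext h), one_mul]
          · rw [if_neg (by omega), if_neg (by omega), if_neg (fun h' => by simp [h', n] at h),
              mul_one]
        simp only [h1]
        rw [Finset.prod_mul_distrib, Finset.prod_ite_eq' Finset.univ n]
        simp only [Finset.mem_univ, if_true]
        field_simp
  obtain ⟨a, ha, ha'⟩ := key r le_rfl
  simp only [Fin.is_lt, if_true] at ha'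
  have hne : ∏ l : Fin r, (Fintype.card (Fin (D.m l) → ℤˣ) : ℂ) ≠ 0 :=
    Finset.prod_ne_zero_iff.2 fun l _ => Nat.cast_ne_zero.2 Fintype.card_ne_zero
  have : a = 1 := mul_right_cancel₀ hne (by rw [ha', one_mul])
  rw [this, one_smul] at ha
  exact ha

/-- If in the rotated frame and on the range of the projectors the hermitian `H` agrees with a
hermitian operator that commutes with the projectors, then `H` commutes with the rotated ones. -/
theorem commute_rotProjBefore {k : ℕ} (hk : k ≤ r) {x : D.Param} {H K : E →L[ℂ] E}
    (hH : IsSelfAdjoint H) (hK : IsSelfAdjoint K) (hKP : Commute K (D.projBefore k x))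
    (h : (D.rotBefore k x : E →L[ℂ] E) * H * star (D.rotBefore k x : E →L[ℂ] E) *
      D.projBefore k x = K * D.projBefore k x) : Commute H (D.rotProjBefore k x) := by
  rw [hD.rotProjBefore_eq hk]
  have hP := (hD.projBefore_isStarProjection hk x).isSelfAdjoint.star_eq
  set u := D.rotBefore k x
  set p := D.projBefore k x
  have h1 : star (u : E →L[ℂ] E) * (u : E →L[ℂ] E) = 1 := by simp
  have h2 : p * ((u : E →L[ℂ] E) * H * star (u : E →L[ℂ] E)) = K * p := by
    have := congrArg star h
    simp only [star_mul, hP, star_star, hH.star_eq, hK.star_eq] at this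
    rw [hKP.eq, ← this]
    simp only [mul_assoc]
  have h3 := congrArg (fun z => star (u : E →L[ℂ] E) * z * (u : E →L[ℂ] E)) (h.trans h2.symm)
  simp only [mul_assoc, h1, mul_one] at h3
  simp only [← mul_assoc, h1, one_mul] at h3
  rw [Commute, SemiconjBy]
  simpa only [mul_assoc] using h3

end IsCoherent

end Scheme

/-! ### Rotations -/

section ExpRotation

variable {B : Type*} [NormedRing B] [NormedAlgebra ℂ B]

/-- Euler's formula for an involution: `ρ ^ 2 = 1` makes `I • ρ` an imaginary unit. -/
theorem exp_smul_involution {ρ : B} (h : ρ * ρ = 1) (t : ℝ) :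
    NormedSpace.exp ((Complex.I * t) • ρ) =
      ((Real.cos t : ℝ) : ℂ) • (1 : B) + (((Real.sin t : ℝ) : ℂ) * Complex.I) • ρ := by
  let _ : NormedAlgebra ℝ B := NormedAlgebra.restrictScalars ℝ ℂ B
  let _ : Algebra ℚ B := Algebra.compHom B (algebraMap ℚ ℂ)
  have hI : (Complex.I • ρ) * (Complex.I • ρ) = -1 := by
    rw [smul_mul_smul_comm, Complex.I_mul_I, h, neg_smul, one_smul]
  let f : ℂ →ₐ[ℝ] B := Complex.liftAux (Complex.I • ρ) hI
  have hf : ∀ z : ℂ, f z = ((z.re : ℝ) : ℂ) • (1 : B) + ((z.im : ℂ) * Complex.I) • ρ := fun z => by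
    rw [Complex.liftAux_apply, mul_smul, Algebra.algebraMap_eq_smul_one]
    rfl
  have hc : Continuous f := f.toLinearMap.continuous_of_finiteDimensional
  have h1 : f (NormedSpace.exp ((t : ℂ) * Complex.I)) = NormedSpace.exp (f ((t : ℂ) * Complex.I)) :=
    NormedSpace.map_exp f hc _
  rw [hf, hf, ← Complex.exp_eq_exp_ℂ, Complex.exp_ofReal_mul_I_re, Complex.exp_ofReal_mul_I_im] at h1
  rw [h1]
  simp [mul_comm]

end ExpRotation

variable {E : Type*} [NormedAddCommGroup E] [InnerProductSpace ℂ E] [CompleteSpace E]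

theorem commute_evenProduct {M : Finset (unitary (E →L[ℂ] E))} {b : E →L[ℂ] E}
    (h : ∀ g ∈ M, ∀ g' ∈ M, Commute b ((g : E →L[ℂ] E) * g')) {s : unitary (E →L[ℂ] E)}
    (hs : IsEvenProduct M s) : Commute b (s : E →L[ℂ] E) := by
  obtain ⟨p, hp, a, ha⟩ := hs
  rw [ha]
  refine Commute.smul_right ?_ a
  clear ha
  induction hp using Subgroup.closure_induction with
  | mem u hu =>
    obtain ⟨g, hg, g', hg', rfl⟩ := hu
    exact h g hg g' hg'
  | one => exact Commute.one_right b
  | mul u v _ _ hu hv => exact hu.mul_right hv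
  | inv u _ hu =>
    have h1 : (u : E →L[ℂ] E) * ((u⁻¹ : unitary (E →L[ℂ] E)) : E →L[ℂ] E) = 1 :=
      congrArg Subtype.val (mul_inv_cancel u)
    have h2 : ((u⁻¹ : unitary (E →L[ℂ] E)) : E →L[ℂ] E) * (u : E →L[ℂ] E) = 1 :=
      congrArg Subtype.val (inv_mul_cancel u)
    let v : (E →L[ℂ] E)ˣ := ⟨u, (u⁻¹ : unitary (E →L[ℂ] E)), h1, h2⟩
    exact Commute.units_inv_right (u := v) hu

theorem commute_of_mem_rotationGroup {M : Finset (unitary (E →L[ℂ] E))} {b : unitary (E →L[ℂ] E)}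
    (h : ∀ s, IsEvenProduct M s → Commute b s) {u : unitary (E →L[ℂ] E)}
    (hu : u ∈ rotationGroup M) : Commute u b := by
  induction hu using Subgroup.closure_induction with
  | mem u hu =>
    obtain ⟨θ, ρ, h1, h2, h3⟩ := hu
    refine commute_of_coe ?_
    have h4 := h ρ h2
    rw [h3, exp_smul_involution (mul_self_of_isSelfAdjoint h1)]
    exact ((Commute.one_left _).smul_left _).add_left ((coe_commute h4).symm.smul_left _)
  | one => exact Commute.one_left b
  | mul u v _ _ hu hv => exact hu.mul_left hv
  | inv u _ hu => exact hu.inv_left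

theorem IsEvenProduct.mul_mem {M : Finset (unitary (E →L[ℂ] E))} {g h : unitary (E →L[ℂ] E)}
    (hg : g ∈ M) (hh : h ∈ M) : IsEvenProduct M (g * h) :=
  ⟨g * h, Subgroup.subset_closure ⟨g, hg, h, hh, rfl⟩, 1, by simp⟩

/-- Conjugation by the rotation about `ρ` fixes what commutes with `ρ`, and rotates `x` towards
`I • ρ * x` if `x` anticommutes with `ρ`. -/
theorem exists_rotation {M : Finset (unitary (E →L[ℂ] E))} {ρ : unitary (E →L[ℂ] E)}
    (hρ : IsSelfAdjoint (ρ : E →L[ℂ] E)) (hM : IsEvenProduct M ρ) {c s : ℝ} (hcs : c ^ 2 + s ^ 2 = 1) :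
    ∃ u ∈ rotationGroup M,
      (∀ x : E →L[ℂ] E, Commute (ρ : E →L[ℂ] E) x →
        (u : E →L[ℂ] E) * x * star (u : E →L[ℂ] E) = x) ∧
      (∀ x : E →L[ℂ] E, x * ρ = -((ρ : E →L[ℂ] E) * x) →
        (u : E →L[ℂ] E) * x * star (u : E →L[ℂ] E) =
          (c : ℂ) • x + (s * Complex.I : ℂ) • ((ρ : E →L[ℂ] E) * x)) := by
  obtain ⟨θ, rfl, rfl⟩ : ∃ θ : ℝ, Real.cos θ = c ∧ Real.sin θ = s := by
    have hz : ‖(⟨c, s⟩ : ℂ)‖ = 1 := by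
      rw [Complex.norm_def, Complex.normSq_mk, ← sq, ← sq, hcs, Real.sqrt_one]
    refine ⟨Complex.arg ⟨c, s⟩, ?_, ?_⟩
    · rw [Complex.cos_arg (by rintro h; simp [h] at hz), hz, div_one]
    · rw [Complex.sin_arg, hz, div_one]
  have hρ2 := mul_self_of_isSelfAdjoint hρ
  set a := Real.cos (θ / 2)
  set b := Real.sin (θ / 2)
  have hab : (a : ℂ) * a + b * b = 1 := by
    have := Real.cos_sq_add_sin_sq (θ / 2)
    rw [sq, sq] at this
    exact_mod_cast this
  have hc : (a : ℂ) * a - b * b = Real.cos θ := by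
    have := Real.cos_two_mul' (θ / 2)
    rw [mul_div_cancel₀ _ two_ne_zero, sq, sq] at this
    exact_mod_cast this.symm
  have hs : (2 : ℂ) * b * a = Real.sin θ := by
    have := Real.sin_two_mul (θ / 2)
    rw [mul_div_cancel₀ _ two_ne_zero] at this
    exact_mod_cast this.symm
  have hY : (Complex.I • (ρ : E →L[ℂ] E)) * (Complex.I • (ρ : E →L[ℂ] E)) = -1 := by
    rw [smul_mul_smul_comm, Complex.I_mul_I, hρ2, neg_smul, one_smul]
  have hYs : star (Complex.I • (ρ : E →L[ℂ] E)) = -(Complex.I • (ρ : E →L[ℂ] E)) := by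
    rw [star_smul, hρ.star_eq]
    simp
  have hYc : ∀ x : E →L[ℂ] E, Commute (ρ : E →L[ℂ] E) x → Commute (Complex.I • (ρ : E →L[ℂ] E)) x :=
    fun x hx => hx.smul_left _
  have hYa : ∀ x : E →L[ℂ] E, x * ρ = -((ρ : E →L[ℂ] E) * x) →
      x * (Complex.I • (ρ : E →L[ℂ] E)) = -((Complex.I • (ρ : E →L[ℂ] E)) * x) := fun x hx => by
    rw [mul_smul_comm, hx, smul_neg, smul_mul_assoc]
  have hexp : NormedSpace.exp ((Complex.I * (θ / 2 : ℝ)) • (ρ : E →L[ℂ] E)) =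
      (a : ℂ) • (1 : E →L[ℂ] E) + (b : ℂ) • (Complex.I • (ρ : E →L[ℂ] E)) := by
    rw [exp_smul_involution hρ2, mul_smul]
  have hYx : ∀ x : E →L[ℂ] E, (Real.sin θ * Complex.I : ℂ) • ((ρ : E →L[ℂ] E) * x) =
      (Real.sin θ : ℂ) • ((Complex.I • (ρ : E →L[ℂ] E)) * x) := fun x => by
    rw [mul_smul, smul_mul_assoc]
  simp only [hYx]
  clear hYx
  generalize Complex.I • (ρ : E →L[ℂ] E) = Y at *
  let U : E →L[ℂ] E := (a : ℂ) • 1 + (b : ℂ) • Y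
  have hUs : star U = (a : ℂ) • 1 - (b : ℂ) • Y := by
    simp [U, hYs, sub_eq_add_neg]
  have h1 : U * star U = 1 := by
    rw [hUs]
    simp only [U, add_mul, mul_sub, smul_mul_smul_comm, hY, one_mul, mul_one]
    exact Eq.trans (b := ((a : ℂ) * a + b * b) • (1 : E →L[ℂ] E)) (by module) (by rw [hab, one_smul])
  have h2 : star U * U = 1 := by
    rw [hUs]
    simp only [U, mul_add, sub_mul, smul_mul_smul_comm, hY, one_mul, mul_one]
    exact Eq.trans (b := ((a : ℂ) * a + b * b) • (1 : E →L[ℂ] E)) (by module) (by rw [hab, one_smul])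
  refine ⟨⟨U, Unitary.mem_iff.2 ⟨h2, h1⟩⟩, Subgroup.subset_closure ⟨θ, ρ, hρ, hM, ?_⟩,
    fun x hx => ?_, fun x hx => ?_⟩
  · exact hexp.symm
  · have h3 : Commute U x := ((Commute.one_left _).smul_left _).add_left ((hYc x hx).smul_left _)
    show U * x * star U = x
    rw [h3.eq, mul_assoc, h1, mul_one]
  · have h3 : x * star U = U * x := by
      rw [hUs]
      simp only [U, mul_sub, add_mul, mul_smul_comm, hYa x hx, smul_mul_assoc, mul_one, one_mul]
      module
    have h4 : U * U = (Real.cos θ : ℂ) • 1 + (Real.sin θ : ℂ) • Y := by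
      rw [← hc, ← hs]
      simp only [U, mul_add, add_mul, smul_mul_smul_comm, hY, one_mul, mul_one]
      module
    show U * x * star U = _
    rw [mul_assoc, h3, ← mul_assoc, h4, add_mul, smul_mul_assoc, smul_mul_assoc, one_mul]

/-! ### A normal form of antisymmetric matrices -/

section NormalForm

open Matrix

variable {V : Type*} [Fintype V] [DecidableEq V]

/-- The rotation with cosine `c` and sine `s` in the plane of the coordinates `a` and `b`. -/
def givens (a b : V) (c s : ℝ) : Matrix V V ℝ :=
  of fun i j => if i = a then (if j = a then c else if j = b then s else 0)
    else if i = b then (if j = a then -s else if j = b then c else 0)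
    else if j = i then 1 else 0

theorem givens_mulVec {a b : V} (hab : a ≠ b) (c s : ℝ) (u : V → ℝ) (i : V) :
    (givens a b c s *ᵥ u) i = if i = a then c * u a + s * u b
      else if i = b then -s * u a + c * u b else u i := by
  have h2 : ∀ p q : ℝ, ∑ j, (if j = a then p else if j = b then q else 0) * u j =
      p * u a + q * u b := fun p q => by
    rw [Finset.sum_eq_add a b hab]
    · simp [hab.symm]
    · rintro j - ⟨h, h'⟩
      simp [h, h']
    · simp
    · simp
  simp only [mulVec, dotProduct, givens, of_apply]
  split_ifs with h h'
  · exact h2 _ _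
  · exact h2 _ _
  · simp

omit [Fintype V] in
theorem givens_transpose {a b : V} (hab : a ≠ b) (c s : ℝ) :
    (givens a b c s)ᵀ = givens a b c (-s) := by
  ext i j
  simp only [givens, transpose_apply, of_apply]
  by_cases hia : i = a
  · subst hia
    by_cases hja : j = i
    · simp [hja]
    · by_cases hjb : j = b <;> simp [hja, hjb, hab.symm, Ne.symm hja]
  · by_cases hib : i = b
    · subst hib
      by_cases hja : j = a
      · simp [hja, hab.symm]
      · by_cases hji : j = i
        · simp [hji, hab.symm]
        · simp [hja, hji, hab.symm, Ne.symm hji]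
    · by_cases hja : j = a
      · simp [hja, hia, hib, Ne.symm hia]
      · by_cases hjb : j = b
        · simp [hjb, hia, hib, Ne.symm hib, hab.symm]
        · simp [hia, hib, hja, hjb, eq_comm]

theorem givens_mul_transpose {a b : V} (hab : a ≠ b) {c s : ℝ} (h : c ^ 2 + s ^ 2 = 1) :
    givens a b c s * (givens a b c s)ᵀ = 1 := by
  rw [givens_transpose hab]
  refine Matrix.ext_of_mulVec_single fun i => ?_
  rw [← mulVec_mulVec, one_mulVec]
  ext j
  simp only [givens_mulVec hab, if_true, hab.symm, if_false]
  split_ifs with h1 h2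
  · subst h1; linear_combination (Pi.single i (1 : ℝ) : V → ℝ) j * h
  · subst h2; linear_combination (Pi.single i (1 : ℝ) : V → ℝ) j * h
  · rfl

/-- The products of rotations in the planes of two equivalent coordinates in `F`. -/
def givensGroup (r : Setoid V) (F : Finset V) : Submonoid (Matrix V V ℝ) :=
  Submonoid.closure {G | ∃ a ∈ F, ∃ b ∈ F, a ≠ b ∧ r a b ∧ ∃ c s : ℝ, c ^ 2 + s ^ 2 = 1 ∧
    G = givens a b c s}

variable {r : Setoid V} {F : Finset V}

theorem givensGroup_mono {F F' : Finset V} (h : F ⊆ F') : givensGroup r F ≤ givensGroup r F' :=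
  Submonoid.closure_mono fun _ ⟨a, ha, b, hb, h'⟩ => ⟨a, h ha, b, h hb, h'⟩

theorem mul_transpose_of_mem_givensGroup {O : Matrix V V ℝ} (hO : O ∈ givensGroup r F) :
    O * Oᵀ = 1 := by
  induction hO using Submonoid.closure_induction with
  | mem G hG =>
    obtain ⟨a, _, b, _, hab, _, c, s, hcs, rfl⟩ := hG
    exact givens_mul_transpose hab hcs
  | one => simp
  | mul O O' _ _ h h' =>
    rw [transpose_mul, Matrix.mul_assoc, ← Matrix.mul_assoc O', h', Matrix.one_mul, h]

theorem mulVec_eq_of_mem_givensGroup {O : Matrix V V ℝ} (hO : O ∈ givensGroup r F) {u : V → ℝ}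
    (hu : ∀ c ∈ F, u c = 0) : O *ᵥ u = u := by
  induction hO using Submonoid.closure_induction with
  | mem G hG =>
    obtain ⟨a, ha, b, hb, hab, _, c, s, hcs, rfl⟩ := hG
    ext i
    rw [givens_mulVec hab, hu a ha, hu b hb]
    split_ifs with h h'
    · rw [h, hu a ha]; ring
    · rw [h', hu b hb]; ring
    · rfl
  | one => simp
  | mul O O' _ _ h h' => rw [← mulVec_mulVec, h', h]

theorem apply_ne_zero_of_mem_givensGroup {O : Matrix V V ℝ} (hO : O ∈ givensGroup r F) {i j : V}
    (h : O i j ≠ 0) : i = j ∨ (i ∈ F ∧ j ∈ F ∧ r i j) := by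
  induction hO using Submonoid.closure_induction generalizing i j with
  | mem G hG =>
    obtain ⟨a, ha, b, hb, hab, hr, c, s, hcs, rfl⟩ := hG
    simp only [givens, of_apply] at h
    have hr' := r.symm' hr
    split_ifs at h <;> simp_all
  | one => exact Or.inl (not_not.1 fun h' => h (one_apply_ne h'))
  | mul O O' _ _ ih ih' =>
    rw [mul_apply] at h
    obtain ⟨k, -, hk⟩ := Finset.exists_ne_zero_of_sum_ne_zero h
    rcases ih (left_ne_zero_of_mul hk) with rfl | ⟨h1, h2, h3⟩
    · exact ih' (right_ne_zero_of_mul hk)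
    · rcases ih' (right_ne_zero_of_mul hk) with rfl | ⟨h4, h5, h6⟩
      · exact Or.inr ⟨h1, h2, h3⟩
      · exact Or.inr ⟨h1, h5, r.trans' h3 h6⟩

theorem mulVec_support_of_mem_givensGroup {O : Matrix V V ℝ} (hO : O ∈ givensGroup r F)
    {S : Finset V} (hS : ∀ a ∈ F, ∀ b ∈ F, r a b → b ∈ S → a ∈ S) {u : V → ℝ}
    (hu : ∀ i ∉ S, u i = 0) : ∀ i ∉ S, (O *ᵥ u) i = 0 := by
  intro i hi
  by_contra h
  obtain ⟨k, -, hk⟩ := Finset.exists_ne_zero_of_sum_ne_zero h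
  have hk' : k ∈ S := not_not.1 fun h' => right_ne_zero_of_mul hk (hu k h')
  rcases apply_ne_zero_of_mem_givensGroup hO (left_ne_zero_of_mul hk) with rfl | ⟨h1, h2, h3⟩
  · exact hi hk'
  · exact hi (hS _ h1 _ h2 h3 hk')

/-- The components of a vector with support in one class can be rotated into a single coordinate. -/
theorem exists_mulVec_eq_single {b : V} {T : Finset V} (hT : ∀ a ∈ T, r b a) {u : V → ℝ}
    (hu : ∀ i ∉ insert b T, u i = 0) :
    ∃ O ∈ givensGroup r (insert b T), ∃ t : ℝ, O *ᵥ u = Pi.single b t := by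
  induction T using Finset.induction_on generalizing u with
  | empty =>
    refine ⟨1, one_mem _, u b, ?_⟩
    rw [one_mulVec]
    ext i
    by_cases h : i = b
    · subst h; simp
    · rw [hu i (by simpa using h), Pi.single_eq_of_ne h]
  | insert h T hhT ih =>
    by_cases hb : h = b
    · subst hb
      rw [Finset.insert_idem] at hu ⊢
      exact ih (fun a ha => hT a (Finset.mem_insert_of_mem ha)) hu
    -- the rotation in the plane of `b` and `h` that annihilates the component `u h`
    have key : ∃ c s : ℝ, c ^ 2 + s ^ 2 = 1 ∧ -s * u b + c * u h = 0 := by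
      by_cases h0 : u b ^ 2 + u h ^ 2 = 0
      · have h1 : u h = 0 := by nlinarith [sq_nonneg (u b), sq_nonneg (u h)]
        exact ⟨1, 0, by norm_num, by rw [h1]; ring⟩
      · have h2 : 0 ≤ u b ^ 2 + u h ^ 2 := by positivity
        have h3 := Real.sq_sqrt h2
        have h4 : Real.sqrt (u b ^ 2 + u h ^ 2) ≠ 0 := fun h' => h0 (by rw [← h3, h']; ring)
        refine ⟨u b / Real.sqrt (u b ^ 2 + u h ^ 2), u h / Real.sqrt (u b ^ 2 + u h ^ 2), ?_, ?_⟩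
        · rw [div_pow, div_pow, ← add_div, h3, div_self h0]
        · field_simp
          ring
    obtain ⟨c, s, hcs, hs⟩ := key
    have hG : givens b h c s ∈ givensGroup r (insert b (insert h T)) :=
      Submonoid.subset_closure ⟨b, by simp, h, by simp, fun h' => hb h'.symm,
        hT h (by simp), c, s, hcs, rfl⟩
    obtain ⟨O, hO, t, ht⟩ := ih (u := givens b h c s *ᵥ u)
      (fun a ha => hT a (Finset.mem_insert_of_mem ha)) (by
        intro i hi
        rw [givens_mulVec (Ne.symm hb)]
        split_ifs with h1 h2
        · exact absurd (h1 ▸ Finset.mem_insert_self _ _) hi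
        · exact hs
        · refine hu i fun h3 => hi ?_
          simp only [Finset.mem_insert] at h3 ⊢
          tauto)
    refine ⟨O * givens b h c s, mul_mem (givensGroup_mono (Finset.insert_subset_insert _
      (Finset.subset_insert _ _)) hO) hG, t, ?_⟩
    rw [← mulVec_mulVec, ht]

/-- The unit vectors with support in `C`. -/
def unitVectors (C : Finset V) : Set (V → ℝ) := {u | u ⬝ᵥ u = 1 ∧ ∀ i ∉ C, u i = 0}

omit [DecidableEq V] in
theorem sq_le_one_of_mem_unitVectors {C : Finset V} {u : V → ℝ} (hu : u ∈ unitVectors C) (i : V) :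
    u i ^ 2 ≤ 1 := by
  rw [← hu.1, sq]
  exact Finset.single_le_sum (f := fun j => u j * u j) (fun j _ => mul_self_nonneg _)
    (Finset.mem_univ i)

omit [DecidableEq V] in
theorem isCompact_unitVectors (C : Finset V) : IsCompact (unitVectors C) := by
  refine (isCompact_univ_pi fun _ : V => isCompact_Icc (a := (-1 : ℝ)) (b := 1)).of_isClosed_subset
    ?_ ?_
  · have h : unitVectors C = {u | u ⬝ᵥ u = 1} ∩ ⋂ i : V, ⋂ _ : i ∉ C, {u | u i = 0} := by
      ext u; simp [unitVectors]
    rw [h]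
    refine (isClosed_eq (by unfold dotProduct; fun_prop) continuous_const).inter
      (isClosed_iInter fun i => isClosed_iInter fun _ =>
        isClosed_eq (continuous_apply i) continuous_const)
  · intro u hu i _
    rw [Set.mem_Icc, ← abs_le]
    exact (sq_le_one_iff_abs_le_one _).1 (sq_le_one_of_mem_unitVectors hu i)

theorem single_mem_unitVectors {C : Finset V} {a : V} (ha : a ∈ C) :
    Pi.single a (1 : ℝ) ∈ unitVectors C :=
  ⟨by simp, fun i hi => Pi.single_eq_of_ne (by rintro rfl; exact hi ha) _⟩

omit [DecidableEq V] in
/-- Equality in the Cauchy–Schwarz inequality. -/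
theorem eq_smul_of_isMax {C : Finset V} {z u : V → ℝ} (hz : ∀ i ∉ C, z i = 0)
    (hu : u ∈ unitVectors C) (hmax : ∀ u' ∈ unitVectors C, u' ⬝ᵥ z ≤ u ⬝ᵥ z) :
    z = (u ⬝ᵥ z) • u := by
  have h0 : 0 ≤ z ⬝ᵥ z := by
    simpa using dotProduct_star_self_nonneg z
  set σ := u ⬝ᵥ z
  have hσ : 0 ≤ σ := by
    have := hmax (-u) ⟨by simp [hu.1], fun i hi => by simp [hu.2 i hi]⟩
    rw [neg_dotProduct] at this
    linarith
  have h1 : z ⬝ᵥ z ≤ σ ^ 2 := by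
    rcases h0.eq_or_lt with h | h
    · rw [← h]; positivity
    · have hs := Real.sq_sqrt h0
      have hs' : 0 < Real.sqrt (z ⬝ᵥ z) := Real.sqrt_pos.2 h
      have := hmax ((Real.sqrt (z ⬝ᵥ z))⁻¹ • z) ⟨by
        rw [smul_dotProduct, dotProduct_smul, smul_eq_mul, smul_eq_mul]
        field_simp
        exact hs.symm, fun i hi => by simp [hz i hi]⟩
      rw [smul_dotProduct, smul_eq_mul] at this
      have h2 : (Real.sqrt (z ⬝ᵥ z))⁻¹ * (z ⬝ᵥ z) = Real.sqrt (z ⬝ᵥ z) := by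
        field_simp
        exact hs.symm
      rw [h2] at this
      rw [← hs]
      gcongr
  have h2 : (z - σ • u) ⬝ᵥ (z - σ • u) = z ⬝ᵥ z - σ ^ 2 := by
    simp only [sub_dotProduct, dotProduct_sub, smul_dotProduct, dotProduct_smul, hu.1, smul_eq_mul,
      dotProduct_comm z u]
    ring
  have h3 : (z - σ • u) ⬝ᵥ (z - σ • u) = 0 :=
    le_antisymm (by rw [h2]; linarith) (by simpa using dotProduct_star_self_nonneg (z - σ • u))
  exact sub_eq_zero.1 (dotProduct_self_eq_zero.1 h3)

/-- A pair of singular vectors for the largest singular value of the block `C × D` of `A`. -/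
theorem exists_singular_pair (A : Matrix V V ℝ) {C D : Finset V} (hC : C.Nonempty)
    (hD : D.Nonempty) (h1 : ∀ v : V → ℝ, (∀ i ∉ D, v i = 0) → ∀ i ∉ C, (A *ᵥ v) i = 0)
    (h2 : ∀ u : V → ℝ, (∀ i ∉ C, u i = 0) → ∀ i ∉ D, (Aᵀ *ᵥ u) i = 0) :
    ∃ (σ : ℝ), ∃ u ∈ unitVectors C, ∃ v ∈ unitVectors D, A *ᵥ v = σ • u ∧ Aᵀ *ᵥ u = σ • v ∧
      ∀ c ∈ C, ∀ d ∈ D, |A c d| ≤ σ := by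
  obtain ⟨c₀, hc₀⟩ := hC
  obtain ⟨d₀, hd₀⟩ := hD
  obtain ⟨⟨u, v⟩, ⟨hu, hv⟩, hmax⟩ := ((isCompact_unitVectors C).prod
    (isCompact_unitVectors D)).exists_isMaxOn
    ⟨(Pi.single c₀ 1, Pi.single d₀ 1), single_mem_unitVectors hc₀, single_mem_unitVectors hd₀⟩
    (f := fun p => p.1 ⬝ᵥ A *ᵥ p.2) (by
      refine Continuous.continuousOn ?_
      unfold dotProduct mulVec dotProduct
      fun_prop)
  have hm : ∀ u' ∈ unitVectors C, ∀ v' ∈ unitVectors D, u' ⬝ᵥ A *ᵥ v' ≤ u ⬝ᵥ A *ᵥ v :=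
    fun u' hu' v' hv' => hmax (Set.mk_mem_prod hu' hv')
  have ht : ∀ u' v' : V → ℝ, u' ⬝ᵥ A *ᵥ v' = v' ⬝ᵥ Aᵀ *ᵥ u' := fun u' v' => by
    rw [mulVec_transpose, dotProduct_mulVec, dotProduct_comm]
  refine ⟨u ⬝ᵥ A *ᵥ v, u, hu, v, hv, ?_, ?_, fun c hc d hd => ?_⟩
  · exact eq_smul_of_isMax (h1 v hv.2) hu fun u' hu' => hm u' hu' v hv
  · have := eq_smul_of_isMax (h2 u hu.2) hv fun v' hv' => by
      rw [← ht, ← ht]; exact hm u hu v' hv'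
    rwa [← ht] at this
  · have hc1 := single_mem_unitVectors hc
    have h3 := hm _ hc1 _ (single_mem_unitVectors hd)
    have h4 := hm (-Pi.single c 1) ⟨by simp, fun i hi => by simp [hc1.2 i hi]⟩ _
      (single_mem_unitVectors hd)
    rw [neg_dotProduct] at h4
    rw [abs_le]
    constructor
    · simp at h4; linarith
    · simpa using h3

/-- `odd` relates equivalence classes to each other: each class to at most one. -/
structure IsOddRelation (r : Setoid V) (odd : V → V → Prop) : Prop where
  symm : ∀ {a b}, odd a b → odd b a
  trans_left : ∀ {a b c}, r a b → odd b c → odd a c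
  comp : ∀ {a b c}, odd a b → odd b c → r a c

/-- Antisymmetric matrices on `F` whose entries sit at the pairs related by `odd`. -/
structure IsOddMatrix (odd : V → V → Prop) (F : Finset V) (A : Matrix V V ℝ) : Prop where
  antisymm : Aᵀ = -A
  support : ∀ c d, A c d ≠ 0 → odd c d ∧ c ∈ F ∧ d ∈ F

variable {odd : V → V → Prop}

theorem IsOddMatrix.conj (hodd : IsOddRelation r odd) {A O : Matrix V V ℝ}
    (hA : IsOddMatrix odd F A) (hO : O ∈ givensGroup r F) : IsOddMatrix odd F (O * A * Oᵀ) := by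
  refine ⟨?_, fun c d h => ?_⟩
  · rw [transpose_mul, transpose_mul, transpose_transpose, hA.antisymm, Matrix.neg_mul,
      Matrix.mul_neg, Matrix.mul_assoc]
  · rw [mul_apply] at h
    obtain ⟨j, -, hj⟩ := Finset.exists_ne_zero_of_sum_ne_zero h
    have hj1 := left_ne_zero_of_mul hj
    rw [mul_apply] at hj1
    obtain ⟨i, -, hi⟩ := Finset.exists_ne_zero_of_sum_ne_zero hj1
    obtain ⟨h1, h2, h3⟩ := hA.support _ _ (right_ne_zero_of_mul hi)
    have hc : c ∈ F ∧ r c i := by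
      rcases apply_ne_zero_of_mem_givensGroup hO (left_ne_zero_of_mul hi) with rfl | h
      · exact ⟨h2, r.refl' _⟩
      · exact ⟨h.1, h.2.2⟩
    have hd : d ∈ F ∧ r d j := by
      rcases apply_ne_zero_of_mem_givensGroup hO (right_ne_zero_of_mul hj) with rfl | h
      · exact ⟨h3, r.refl' _⟩
      · exact ⟨h.1, h.2.2⟩
    exact ⟨hodd.symm (hodd.trans_left hd.2 (hodd.symm (hodd.trans_left hc.2 h1))), hc.1, hd.1⟩

/-- The antisymmetric matrix with entry `1` at `(a, b)` and `-1` at `(b, a)`. -/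
def pairMatrix (p : V × V) : Matrix V V ℝ :=
  vecMulVec (Pi.single p.1 1) (Pi.single p.2 1) - vecMulVec (Pi.single p.2 1) (Pi.single p.1 1)

theorem isOddMatrix_sum (hodd : IsOddRelation r odd) {κ : Type*} (P : Finset κ) (τ : κ → ℝ)
    {f : κ → V × V} (hf : ∀ k ∈ P, odd (f k).1 (f k).2) :
    IsOddMatrix odd Finset.univ (∑ k ∈ P, τ k • pairMatrix (f k)) := by
  refine ⟨?_, fun c d h => ?_⟩
  · rw [transpose_sum, ← Finset.sum_neg_distrib]
    refine Finset.sum_congr rfl fun k _ => ?_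
    rw [transpose_smul, pairMatrix, transpose_sub, transpose_vecMulVec, transpose_vecMulVec,
      ← smul_neg, neg_sub]
  · rw [Matrix.sum_apply] at h
    obtain ⟨k, hk, h⟩ := Finset.exists_ne_zero_of_sum_ne_zero h
    refine ⟨?_, Finset.mem_univ _, Finset.mem_univ _⟩
    by_contra hcd
    have h1 : ¬ (c = (f k).1 ∧ d = (f k).2) := fun ⟨h1, h2⟩ => hcd (h1 ▸ h2 ▸ hf k hk)
    have h2 : ¬ (c = (f k).2 ∧ d = (f k).1) := fun ⟨h1, h2⟩ =>
      hcd (h1 ▸ h2 ▸ hodd.symm (hf k hk))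
    refine h ?_
    rw [Matrix.smul_apply, pairMatrix, Matrix.sub_apply, vecMulVec_apply, vecMulVec_apply]
    simp only [Pi.single_apply]
    split_ifs <;> simp_all

theorem conj_pairMatrix {O : Matrix V V ℝ} {p : V × V} (h1 : O *ᵥ Pi.single p.1 1 = Pi.single p.1 1)
    (h2 : O *ᵥ Pi.single p.2 1 = Pi.single p.2 1) : O * pairMatrix p * Oᵀ = pairMatrix p := by
  simp only [pairMatrix, Matrix.mul_sub, Matrix.sub_mul, mul_vecMulVec, vecMulVec_mul,
    vecMul_transpose, h1, h2]

/-- The normal form at one pair: a rotation takes a pair of singular vectors for the largest singular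
value of the block of the classes of `a` and `b` to the coordinate vectors of `a` and `b`. Then row
`a` and column `b` have no entry outside `(a, b)`. The two classes may coincide; the singular vectors
are still orthogonal to each other, by antisymmetry. -/
theorem exists_rotate_pair (hodd : IsOddRelation r odd) {A : Matrix V V ℝ}
    (hA : IsOddMatrix odd F A) {a b : V} (ha : a ∈ F) (hb : b ∈ F) (hne : a ≠ b) (hab : odd a b) :
    ∃ O ∈ givensGroup r F, ∃ τ : ℝ, (∀ c, (O * A * Oᵀ) c b = if c = a then τ else 0) ∧
      ∀ d, (O * A * Oᵀ) a d = if d = b then τ else 0 := by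
  classical
  let C := F.filter (fun c => r c a)
  let D := F.filter (fun d => r d b)
  have haC : a ∈ C := Finset.mem_filter.2 ⟨ha, r.refl' a⟩
  have hbD : b ∈ D := Finset.mem_filter.2 ⟨hb, r.refl' b⟩
  have hCD : ∀ c d, A c d ≠ 0 → d ∈ D → c ∈ C := fun c d h hd => by
    obtain ⟨h1, h2, h3⟩ := hA.support c d h
    have h4 := (Finset.mem_filter.1 hd).2
    exact Finset.mem_filter.2 ⟨h2, hodd.comp h1 (hodd.trans_left h4 (hodd.symm hab))⟩
  have hDC : ∀ c d, A c d ≠ 0 → c ∈ C → d ∈ D := fun c d h hc => by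
    obtain ⟨h1, h2, h3⟩ := hA.support c d h
    have h4 := (Finset.mem_filter.1 hc).2
    exact Finset.mem_filter.2 ⟨h3, hodd.comp (hodd.symm h1) (hodd.trans_left h4 hab)⟩
  obtain ⟨σ, u, hu, v, hv, hAv, hAu, hmax⟩ := exists_singular_pair A (C := C) (D := D) ⟨a, haC⟩
    ⟨b, hbD⟩
    (fun v hv i hi => by
      by_contra h
      obtain ⟨k, -, hk⟩ := Finset.exists_ne_zero_of_sum_ne_zero h
      exact hi (hCD i k (left_ne_zero_of_mul hk)
        (not_not.1 fun h' => right_ne_zero_of_mul hk (hv k h'))))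
    (fun u hu i hi => by
      by_contra h
      obtain ⟨k, -, hk⟩ := Finset.exists_ne_zero_of_sum_ne_zero h
      exact hi (hDC k i (left_ne_zero_of_mul hk)
        (not_not.1 fun h' => right_ne_zero_of_mul hk (hu k h'))))
  have hanti : ∀ c d, A d c = -A c d := fun c d => congrFun (congrFun hA.antisymm c) d
  by_cases hσ : σ = 0
  · -- the block vanishes
    have hz : ∀ c ∈ C, ∀ d ∈ D, A c d = 0 := fun c hc d hd =>
      abs_nonpos_iff.1 (hσ ▸ hmax c hc d hd)
    refine ⟨1, one_mem _, 0, fun c => ?_, fun d => ?_⟩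
    · simp only [Matrix.one_mul, transpose_one, Matrix.mul_one, ite_self]
      by_contra h
      exact h (hz c (hCD c b h hbD) b hbD)
    · simp only [Matrix.one_mul, transpose_one, Matrix.mul_one, ite_self]
      by_contra h
      exact h (hz a haC d (hDC a d h haC))
  · have hAT : ∀ w : V → ℝ, Aᵀ *ᵥ w = -(A *ᵥ w) := fun w => by rw [hA.antisymm, neg_mulVec]
    -- antisymmetry makes the singular vectors orthogonal, which matters if `C = D`
    have huv : u ⬝ᵥ v = 0 := by
      have h1 : u ⬝ᵥ A *ᵥ u = 0 := by
        have h2 : u ⬝ᵥ A *ᵥ u = u ⬝ᵥ Aᵀ *ᵥ u := by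
          rw [mulVec_transpose, dotProduct_mulVec, dotProduct_comm]
        rw [hAT, dotProduct_neg] at h2
        linarith
      have h3 : u ⬝ᵥ Aᵀ *ᵥ u = 0 := by rw [hAT, dotProduct_neg, h1, neg_zero]
      rw [hAu, dotProduct_smul, smul_eq_mul] at h3
      exact (mul_eq_zero.1 h3).resolve_left hσ
    have hCF : C ⊆ F := Finset.filter_subset _ _
    have hDF : D ⊆ F := Finset.filter_subset _ _
    have hdot : ∀ O : Matrix V V ℝ, O ∈ givensGroup r F → ∀ w w' : V → ℝ,
        (O *ᵥ w) ⬝ᵥ (O *ᵥ w') = w ⬝ᵥ w' := fun O hO w w' => by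
      rw [dotProduct_mulVec, vecMul_mulVec, mul_eq_one_comm.1 (mul_transpose_of_mem_givensGroup hO),
        vecMul_one]
    -- `u` is rotated first; the rotation of `v` then leaves the coordinate `a` alone
    obtain ⟨O₁, hO₁, t, ht⟩ := exists_mulVec_eq_single (r := r) (b := a) (T := C) (u := u)
      (fun c hc => r.symm' (Finset.mem_filter.1 hc).2) (by rw [Finset.insert_eq_of_mem haC]; exact hu.2)
    rw [Finset.insert_eq_of_mem haC] at hO₁
    have hO₁F := givensGroup_mono hCF hO₁
    have ht0 : t ≠ 0 := fun h => by
      have := hdot O₁ hO₁F u u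
      rw [ht, hu.1, h] at this
      simp at this
    have hv1 : ∀ i ∉ D, (O₁ *ᵥ v) i = 0 := mulVec_support_of_mem_givensGroup hO₁F
      (fun i hi j _ hij hj => Finset.mem_filter.2 ⟨hi, r.trans' hij (Finset.mem_filter.1 hj).2⟩) hv.2
    have hva : (O₁ *ᵥ v) a = 0 := by
      have := hdot O₁ hO₁F u v
      rw [ht, huv, single_dotProduct] at this
      exact (mul_eq_zero.1 this).resolve_left ht0
    have hbD' : b ∈ D.erase a := Finset.mem_erase.2 ⟨hne.symm, hbD⟩
    obtain ⟨O₂, hO₂, t', ht'⟩ := exists_mulVec_eq_single (r := r) (b := b) (T := D.erase a)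
      (u := O₁ *ᵥ v)
      (fun c hc => r.symm' (Finset.mem_filter.1 (Finset.mem_of_mem_erase hc)).2) (by
        rw [Finset.insert_eq_of_mem hbD']
        intro i hi
        by_cases hia : i = a
        · rw [hia, hva]
        · exact hv1 i fun h => hi (Finset.mem_erase.2 ⟨hia, h⟩))
    rw [Finset.insert_eq_of_mem hbD'] at hO₂
    have hO₂F := givensGroup_mono ((Finset.erase_subset _ _).trans hDF) hO₂
    have hO : O₂ * O₁ ∈ givensGroup r F := mul_mem hO₂F hO₁F
    have hOO := mul_eq_one_comm.1 (mul_transpose_of_mem_givensGroup hO)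
    have hOu : (O₂ * O₁) *ᵥ u = Pi.single a t := by
      rw [← mulVec_mulVec, ht]
      refine mulVec_eq_of_mem_givensGroup hO₂ fun c hc => Pi.single_eq_of_ne ?_ _
      exact Finset.ne_of_mem_erase hc
    have hOv : (O₂ * O₁) *ᵥ v = Pi.single b t' := by rw [← mulVec_mulVec, ht']
    have ht0' : t' ≠ 0 := fun h => by
      have := hdot _ hO v v
      rw [hOv, hv.1, h] at this
      simp at this
    set O := O₂ * O₁
    have hc : ∀ c, (O * A * Oᵀ) c b = if c = a then σ * t / t' else 0 := fun c => by
      have h1 : (O * A * Oᵀ) *ᵥ Pi.single b t' = σ • Pi.single a t := by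
        rw [← hOv, mulVec_mulVec, Matrix.mul_assoc, hOO, Matrix.mul_one, ← mulVec_mulVec, hAv,
          mulVec_smul, hOu]
      have h2 := congrFun h1 c
      rw [mulVec_single] at h2
      simp only [Pi.smul_apply, col_apply, MulOpposite.smul_eq_mul_unop, MulOpposite.unop_op,
        Pi.single_apply, smul_eq_mul] at h2
      split_ifs at h2 ⊢ with h
      · rw [eq_div_iff ht0', h2]
      · simpa [ht0'] using h2
    refine ⟨O, hO, σ * t / t', hc, fun d => ?_⟩
    have h1 : (O * A * Oᵀ)ᵀ *ᵥ Pi.single a t = σ • Pi.single b t' := by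
      rw [transpose_mul (O * A), transpose_mul O A, transpose_transpose, ← hOu, mulVec_mulVec,
        Matrix.mul_assoc O, Matrix.mul_assoc Aᵀ, hOO, Matrix.mul_one, ← mulVec_mulVec, hAu, mulVec_smul,
        hOv]
    have h2 := congrFun h1 d
    rw [mulVec_single] at h2
    simp only [Pi.smul_apply, col_apply, MulOpposite.smul_eq_mul_unop, MulOpposite.unop_op,
      Pi.single_apply, smul_eq_mul, transpose_apply] at h2
    split_ifs at h2 ⊢ with h
    · subst h
      simpa using hc a
    · simpa [ht0] using h2

/-- Rotations of the planes of equivalent coordinates bring all antisymmetric matrices that are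
supported on odd pairs to a normal form with entries at fixed disjoint pairs. One of these pairs
may be prescribed. -/
theorem exists_normalForm (hodd : IsOddRelation r odd) {a b : V} (ha : a ∈ F) (hb : b ∈ F)
    (hne : a ≠ b) (hab : odd a b) :
    ∃ P : Finset (V × V), (a, b) ∈ P ∧
      (∀ p ∈ P, p.1 ∈ F ∧ p.2 ∈ F ∧ p.1 ≠ p.2 ∧ odd p.1 p.2) ∧
      (∀ p ∈ P, ∀ q ∈ P, p ≠ q → p.1 ≠ q.1 ∧ p.1 ≠ q.2 ∧ p.2 ≠ q.1 ∧ p.2 ≠ q.2) ∧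
      ∀ A, IsOddMatrix odd F A → ∃ O ∈ givensGroup r F, ∃ τ : V × V → ℝ,
        O * A * Oᵀ = ∑ p ∈ P, τ p • pairMatrix p := by
  induction F using Finset.strongInduction generalizing a b with
  | H F ih =>
    let F' := (F.erase a).erase b
    have hF' : F' ⊂ F := (Finset.erase_subset _ _).trans_ssubset (Finset.erase_ssubset ha)
    have hmem : ∀ c, c ∈ F' ↔ c ≠ b ∧ c ≠ a ∧ c ∈ F := fun c => by simp [F']
    -- fixed pairs for the remaining coordinates
    obtain ⟨P, hP1, hP2, hP3⟩ : ∃ P : Finset (V × V),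
        (∀ p ∈ P, p.1 ∈ F' ∧ p.2 ∈ F' ∧ p.1 ≠ p.2 ∧ odd p.1 p.2) ∧
        (∀ p ∈ P, ∀ q ∈ P, p ≠ q → p.1 ≠ q.1 ∧ p.1 ≠ q.2 ∧ p.2 ≠ q.1 ∧ p.2 ≠ q.2) ∧
        ∀ A, IsOddMatrix odd F' A → ∃ O ∈ givensGroup r F', ∃ τ : V × V → ℝ,
          O * A * Oᵀ = ∑ p ∈ P, τ p • pairMatrix p := by
      by_cases h : ∃ c ∈ F', ∃ d ∈ F', c ≠ d ∧ odd c d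
      · obtain ⟨c, hc, d, hd, hcd, hcd'⟩ := h
        obtain ⟨P, -, h⟩ := ih F' hF' hc hd hcd hcd'
        exact ⟨P, h⟩
      · refine ⟨∅, by simp, by simp, fun A hA => ⟨1, one_mem _, 0, ?_⟩⟩
        rw [Finset.sum_empty, Matrix.one_mul, transpose_one, Matrix.mul_one]
        ext c d
        by_contra h0
        obtain ⟨h1, h2, h3⟩ := hA.support c d h0
        refine h ⟨c, h2, d, h3, fun hcd => h0 ?_, h1⟩
        subst hcd
        have := congrFun (congrFun hA.antisymm c) c
        rw [transpose_apply, Matrix.neg_apply] at this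
        rw [Matrix.zero_apply]
        linarith
    have hnew : (a, b) ∉ P := fun h => ((hmem a).1 (hP1 _ h).1).2.1 rfl
    refine ⟨insert (a, b) P, Finset.mem_insert_self _ _, ?_, ?_, fun A hA => ?_⟩
    · intro p hp
      rcases Finset.mem_insert.1 hp with rfl | hp
      · exact ⟨ha, hb, hne, hab⟩
      · obtain ⟨h1, h2, h3⟩ := hP1 p hp
        exact ⟨hF'.1 h1, hF'.1 h2, h3⟩
    · intro p hp q hq hpq
      rcases Finset.mem_insert.1 hp with rfl | hp <;> rcases Finset.mem_insert.1 hq with rfl | hq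
      · exact absurd rfl hpq
      · obtain ⟨h1, h2, -⟩ := hP1 q hq
        rw [hmem] at h1 h2
        exact ⟨h1.2.1.symm, h2.2.1.symm, h1.1.symm, h2.1.symm⟩
      · obtain ⟨h1, h2, -⟩ := hP1 p hp
        rw [hmem] at h1 h2
        exact ⟨h1.2.1, h1.1, h2.2.1, h2.1⟩
      · exact hP2 p hp q hq hpq
    · obtain ⟨O, hO, τ, hcol, hrow⟩ := exists_rotate_pair hodd hA ha hb hne hab
      have hB := hA.conj hodd hO
      set B := O * A * Oᵀ
      have hanti : ∀ c d, B d c = -B c d := fun c d => congrFun (congrFun hB.antisymm c) d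
      have hp : ∀ c d, pairMatrix (a, b) c d =
          (if c = a then if d = b then 1 else 0 else 0) -
            (if c = b then if d = a then 1 else 0 else 0) := fun c d => by
        simp only [pairMatrix, Matrix.sub_apply, vecMulVec_apply, Pi.single_apply]
        split_ifs <;> simp
      -- the rest has no entries in the rows and columns of `a` and `b`
      have hB' : IsOddMatrix odd F' (B - τ • pairMatrix (a, b)) := by
        refine ⟨?_, fun c d h => ?_⟩
        · ext c d
          simp only [transpose_apply, Matrix.sub_apply, Matrix.smul_apply, Matrix.neg_apply, hp, hanti c d]
          split_ifs <;> simp only [smul_eq_mul] <;> ring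
        · rw [Matrix.sub_apply, Matrix.smul_apply, hp] at h
          have hca : c ≠ a := by
            rintro rfl
            rw [hrow] at h
            by_cases hd : d = b <;> simp [hd, hne] at h
          have hdb : d ≠ b := by
            rintro rfl
            rw [hcol] at h
            by_cases hc : c = a <;> simp [hc, hne.symm] at h
          have hcb : c ≠ b := by
            rintro rfl
            rw [hanti, hcol] at h
            by_cases hd : d = a <;> simp [hd, hne.symm] at h
          have hda : d ≠ a := by
            rintro rfl
            rw [hanti, hrow] at h
            by_cases hc : c = b <;> simp [hc, hne] at h
          simp only [hca, hcb, if_false, sub_zero, smul_zero] at h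
          obtain ⟨h1, h2, h3⟩ := hB.support c d h
          exact ⟨h1, (hmem c).2 ⟨hcb, hca, h2⟩, (hmem d).2 ⟨hdb, hda, h3⟩⟩
      obtain ⟨O', hO', τ', h'⟩ := hP3 _ hB'
      refine ⟨O' * O, mul_mem (givensGroup_mono hF'.1 hO') hO, Function.update τ' (a, b) τ, ?_⟩
      have h1 : O' * O * A * (O' * O)ᵀ = O' * B * O'ᵀ := by
        simp only [B, transpose_mul, Matrix.mul_assoc]
      have h2 : O' * pairMatrix (a, b) * O'ᵀ = pairMatrix (a, b) := by
        refine conj_pairMatrix ?_ ?_ <;>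
        · refine mulVec_eq_of_mem_givensGroup hO' fun c hc => Pi.single_eq_of_ne ?_ _
          have := (hmem c).1 hc
          simp [this.1, this.2.1]
      have h3 : ∑ p ∈ P, Function.update τ' (a, b) τ p • pairMatrix p =
          ∑ p ∈ P, τ' p • pairMatrix p := Finset.sum_congr rfl fun p hp => by
        rw [Function.update_of_ne (by rintro rfl; exact hnew hp)]
      rw [h1, Finset.sum_insert hnew, Function.update_self, h3, ← h', Matrix.mul_sub, Matrix.sub_mul,
        Matrix.mul_smul, Matrix.smul_mul, h2]
      abel

end NormalForm

/-! ### Edge operators of a root graph and their products -/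

section EdgeSystem

open Matrix

variable {V : Type*} [Fintype V] [DecidableEq V]

/-- The sign `(-1) ^ t`. -/
def paritySign (t : ZMod 2) : ℂ := if t = 0 then 1 else -1

theorem paritySign_zero : paritySign 0 = 1 := if_pos rfl

theorem paritySign_one : paritySign 1 = -1 := if_neg (by decide)

theorem paritySign_add (s t : ZMod 2) : paritySign (s + t) = paritySign s * paritySign t := by
  have h : ∀ x : ZMod 2, x = 0 ∨ x = 1 := by decide
  rcases h s with rfl | rfl <;> rcases h t with rfl | rfl <;>
    simp [paritySign_zero, paritySign_one, show (1 + 1 : ZMod 2) = 0 from rfl]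

theorem paritySign_eq_or (t : ZMod 2) : paritySign t = 1 ∨ paritySign t = -1 := by
  unfold paritySign
  split_ifs <;> simp

/-- The boundary of the edge, or path, with the ends `a` and `b`, modulo `2`. -/
def pairBoundary (a b : V) : V → ZMod 2 := Pi.single a 1 + Pi.single b 1

omit [Fintype V] in
theorem pairBoundary_self (a : V) : pairBoundary a a = 0 := by
  ext i
  exact CharTwo.add_self_eq_zero _

omit [Fintype V] in
theorem pairBoundary_comm (a b : V) : pairBoundary a b = pairBoundary b a := add_comm _ _

omit [Fintype V] in
theorem pairBoundary_add (a b c : V) :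
    pairBoundary a b + pairBoundary b c = pairBoundary a c := by
  have : (Pi.single b 1 + Pi.single b 1 : V → ZMod 2) = 0 := pairBoundary_self b
  calc pairBoundary a b + pairBoundary b c = pairBoundary a c + (Pi.single b 1 + Pi.single b 1) := by
        unfold pairBoundary; abel
    _ = pairBoundary a c := by rw [this, add_zero]

theorem pairBoundary_dotProduct (a b c d : V) : pairBoundary a b ⬝ᵥ pairBoundary c d =
    (if a = c then 1 else 0) + (if a = d then 1 else 0) +
      ((if b = c then 1 else 0) + (if b = d then 1 else 0)) := by
  simp only [pairBoundary, add_dotProduct, dotProduct_add, single_dotProduct, Pi.single_apply,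
    one_mul]
  ring

omit [Fintype V] in
theorem pairBoundary_add_self (a b : V) : pairBoundary a b + pairBoundary a b = 0 := by
  nth_rw 2 [pairBoundary_comm]
  rw [pairBoundary_add, pairBoundary_self]

theorem pairBoundary_dotProduct_self {a b : V} (h : a ≠ b) :
    pairBoundary a b ⬝ᵥ pairBoundary a b = 0 := by
  rw [pairBoundary_dotProduct]
  simp only [if_true, if_neg h, if_neg h.symm, add_zero, zero_add]
  rfl

/-- Two distinct edges meet iff their boundaries have odd intersection. -/
theorem pairBoundary_dotProduct_of_ne {a b c d : V} (hab : a ≠ b) (hcd : c ≠ d)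
    (h : s(a, b) ≠ s(c, d)) : pairBoundary a b ⬝ᵥ pairBoundary c d =
      if ∃ z, z ∈ s(a, b) ∧ z ∈ s(c, d) then 1 else 0 := by
  rw [Ne, Sym2.eq_iff] at h
  simp only [Sym2.mem_iff]
  rw [pairBoundary_dotProduct]
  by_cases h1 : a = c
  · subst h1
    rw [if_pos rfl, if_neg hcd, if_neg hab.symm, if_neg fun h' => h (Or.inl ⟨rfl, h'⟩),
      if_pos ⟨a, Or.inl rfl, Or.inl rfl⟩]
    simp
  by_cases h2 : a = d
  · subst h2
    rw [if_neg h1, if_pos rfl, if_neg hab.symm, if_neg fun h' => h (Or.inr ⟨rfl, h'⟩),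
      if_pos ⟨a, Or.inl rfl, Or.inr rfl⟩]
    simp
  by_cases h3 : b = c
  · subst h3
    rw [if_neg h1, if_neg h2, if_pos rfl, if_neg hcd, if_pos ⟨b, Or.inr rfl, Or.inl rfl⟩]
    simp
  by_cases h4 : b = d
  · subst h4
    rw [if_neg h1, if_neg h2, if_neg h3, if_pos rfl, if_pos ⟨b, Or.inr rfl, Or.inr rfl⟩]
    simp
  · rw [if_neg h1, if_neg h2, if_neg h3, if_neg h4, if_neg]
    · simp
    · rintro ⟨z, rfl | rfl, h5 | h5⟩ <;> simp_all

variable {B : Type*} [Ring B] [StarRing B] [Algebra ℂ B] [StarModule ℂ B] {ι : Type*}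

/-- Hermitian involutions `g i` attached to the edges `e i` of a graph without loops. Two of them
anticommute iff their edges share exactly one end. -/
structure IsEdgeSystem (g : ι → B) (e : ι → V × V) : Prop where
  selfAdjoint : ∀ i, star (g i) = g i
  mul_self : ∀ i, g i * g i = 1
  ne : ∀ i, (e i).1 ≠ (e i).2
  comm : ∀ i j, g i * g j = paritySign (pairBoundary (e i).1 (e i).2 ⬝ᵥ
    pairBoundary (e j).1 (e j).2) • (g j * g i)

/-- `IsEdgeProd g e p δ ε`: up to a power of `I`, `p` is a product of edge operators; `δ` is the
sum of the boundaries of their edges and `ε` the number of factors, both modulo `2`. -/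
inductive IsEdgeProd (g : ι → B) (e : ι → V × V) : B → (V → ZMod 2) → ZMod 2 → Prop
  | one : IsEdgeProd g e 1 0 0
  | mul_edge {p δ ε} (i : ι) : IsEdgeProd g e p δ ε →
      IsEdgeProd g e (p * g i) (δ + pairBoundary (e i).1 (e i).2) (ε + 1)
  | smul_I {p δ ε} : IsEdgeProd g e p δ ε → IsEdgeProd g e (Complex.I • p) δ ε

variable {g : ι → B} {e : ι → V × V}

omit [Fintype V] [StarRing B] [StarModule ℂ B] in
theorem IsEdgeProd.edge (i : ι) :
    IsEdgeProd g e (g i) (pairBoundary (e i).1 (e i).2) 1 := by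
  simpa using IsEdgeProd.mul_edge (g := g) (e := e) i .one

omit [Fintype V] [StarRing B] [StarModule ℂ B] in
theorem IsEdgeProd.neg {p δ ε} (h : IsEdgeProd g e p δ ε) : IsEdgeProd g e (-p) δ ε := by
  have := h.smul_I.smul_I
  rwa [smul_smul, Complex.I_mul_I, neg_smul, one_smul] at this

omit [Fintype V] [StarRing B] [StarModule ℂ B] in
theorem IsEdgeProd.mul {p δ ε p' δ' ε'} (h : IsEdgeProd g e p δ ε) (h' : IsEdgeProd g e p' δ' ε') :
    IsEdgeProd g e (p * p') (δ + δ') (ε + ε') := by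
  induction h' with
  | one => simpa using h
  | mul_edge i _ ih =>
    rw [← mul_assoc, ← add_assoc, ← add_assoc]
    exact ih.mul_edge i
  | smul_I _ ih =>
    rw [mul_smul_comm]
    exact ih.smul_I

section Comm

variable (hg : IsEdgeSystem g e)
include hg

omit [StarModule ℂ B] in
theorem IsEdgeProd.comm_edge {p δ ε} (h : IsEdgeProd g e p δ ε) (i : ι) :
    p * g i = paritySign (δ ⬝ᵥ pairBoundary (e i).1 (e i).2) • (g i * p) := by
  induction h with
  | one => simp [paritySign_zero]
  | mul_edge j _ ih =>
    rw [mul_assoc, hg.comm, mul_smul_comm, ← mul_assoc, ih, smul_mul_assoc, smul_smul, mul_assoc,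
      add_dotProduct, paritySign_add, mul_comm]
  | smul_I _ ih => rw [smul_mul_assoc, ih, mul_smul_comm, smul_comm]

omit [StarModule ℂ B] in
theorem IsEdgeProd.comm {p δ ε p' δ' ε'} (h : IsEdgeProd g e p δ ε)
    (h' : IsEdgeProd g e p' δ' ε') : p * p' = paritySign (δ ⬝ᵥ δ') • (p' * p) := by
  induction h' with
  | one => simp [paritySign_zero]
  | mul_edge j _ ih =>
    rw [← mul_assoc, ih, smul_mul_assoc, mul_assoc, h.comm_edge hg, mul_smul_comm, smul_smul,
      mul_assoc, dotProduct_add, paritySign_add]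
  | smul_I _ ih => rw [smul_mul_assoc, mul_smul_comm, ih, smul_comm]

theorem IsEdgeProd.star_eq_or {p δ ε} (h : IsEdgeProd g e p δ ε) : star p = p ∨ star p = -p := by
  induction h with
  | one => simp
  | @mul_edge p δ ε i h ih =>
    have h1 := h.comm_edge hg i
    rw [star_mul, hg.selfAdjoint]
    rcases ih with ih | ih <;> rcases paritySign_eq_or (δ ⬝ᵥ pairBoundary (e i).1 (e i).2) with h2 | h2
      <;> rw [h2] at h1 <;> simp [ih, h1]
  | smul_I _ ih =>
    rw [star_smul]
    rcases ih with ih | ih <;> simp [ih]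

theorem IsEdgeProd.star_mem {p δ ε} (h : IsEdgeProd g e p δ ε) : IsEdgeProd g e (star p) δ ε := by
  rcases h.star_eq_or hg with h1 | h1 <;> rw [h1]
  · exact h
  · exact h.neg

theorem IsEdgeProd.mem_unitary {p δ ε} (h : IsEdgeProd g e p δ ε) : p ∈ unitary B := by
  induction h with
  | one => exact one_mem _
  | mul_edge i _ ih =>
    refine mul_mem ih (Unitary.mem_iff.2 ?_)
    rw [hg.selfAdjoint, hg.mul_self]
    simp
  | smul_I _ ih =>
    rw [Unitary.mem_iff] at ih ⊢
    simp only [star_smul, smul_mul_smul_comm, ih.1, ih.2]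
    simp

theorem IsEdgeProd.exists_selfAdjoint {p δ ε} (h : IsEdgeProd g e p δ ε) :
    ∃ p', IsEdgeProd g e p' δ ε ∧ star p' = p' := by
  rcases h.star_eq_or hg with h1 | h1
  · exact ⟨p, h, h1⟩
  · exact ⟨_, h.smul_I, by simp [h1]⟩

theorem IsEdgeProd.exists_skewAdjoint {p δ ε} (h : IsEdgeProd g e p δ ε) :
    ∃ p', IsEdgeProd g e p' δ ε ∧ star p' = -p' := by
  rcases h.star_eq_or hg with h1 | h1
  · exact ⟨_, h.smul_I, by simp [h1]⟩
  · exact ⟨p, h, h1⟩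

end Comm

variable (g e) in
/-- Two vertices are evenly linked if a product of an even number of edge operators has them as its
boundary. -/
def evenLink : Setoid V where
  r a b := ∃ p, IsEdgeProd g e p (pairBoundary a b) 0
  iseqv :=
    { refl := fun a => ⟨1, by rw [pairBoundary_self]; exact .one⟩
      symm := fun {a b} ⟨p, hp⟩ => ⟨p, by rwa [pairBoundary_comm]⟩
      trans := fun {a b c} ⟨p, hp⟩ ⟨q, hq⟩ =>
        ⟨p * q, by simpa [pairBoundary_add] using hp.mul hq⟩ }

variable (g e) in
/-- Two vertices are oddly linked if a product of an odd number of edge operators has them as its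
boundary. -/
def OddLink (a b : V) : Prop := ∃ p, IsEdgeProd g e p (pairBoundary a b) 1

omit [Fintype V] [StarRing B] [StarModule ℂ B] in
theorem isOddRelation_oddLink : IsOddRelation (evenLink g e) (OddLink g e) where
  symm := fun {a b} ⟨p, hp⟩ => ⟨p, by rwa [pairBoundary_comm]⟩
  trans_left := fun {a b c} ⟨p, hp⟩ ⟨q, hq⟩ =>
    ⟨p * q, by simpa [pairBoundary_add] using hp.mul hq⟩
  comp := fun {a b c} ⟨p, hp⟩ ⟨q, hq⟩ =>
    ⟨p * q, by simpa [pairBoundary_add, show (1 + 1 : ZMod 2) = 0 from rfl] using hp.mul hq⟩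

end EdgeSystem

/-! ### Bilinears of virtual Majorana operators -/

section Gauge

open Matrix

variable {V : Type*} [Fintype V] [LinearOrder V]
variable {B : Type*} [Ring B] [StarRing B] [Algebra ℂ B] [StarModule ℂ B] {ι : Type*}
variable {g : ι → B} {e : ι → V × V}

variable (g e) in
/-- A representative of the class of evenly linked vertices. -/
noncomputable def root (a : V) : V := (Quotient.mk (evenLink g e) a).out

omit [Fintype V] [StarRing B] [StarModule ℂ B] in
theorem evenLink_root (a : V) : evenLink g e a (root g e a) :=
  (evenLink g e).symm' (Quotient.mk_out (s := evenLink g e) a)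

omit [Fintype V] [StarRing B] [StarModule ℂ B] in
theorem root_eq {a b : V} (h : evenLink g e a b) : root g e a = root g e b :=
  congrArg Quotient.out (Quotient.sound (s := evenLink g e) h)

omit [Fintype V] [StarRing B] [StarModule ℂ B] in
theorem root_root (a : V) : root g e (root g e a) = root g e a := (root_eq (evenLink_root a)).symm

/-- Operators `k a` that stand for the product of the Majorana operators of `a` and of its root. -/
theorem exists_evenProd (hg : IsEdgeSystem g e) (a : V) :
    ∃ k, IsEdgeProd g e k (pairBoundary a (root g e a)) 0 ∧ (a = root g e a → k = 1) ∧
      (a ≠ root g e a → star k = -k) := by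
  obtain ⟨p, hp⟩ := evenLink_root (g := g) (e := e) a
  obtain ⟨k, hk, hk'⟩ := hp.exists_skewAdjoint hg
  by_cases h : a = root g e a
  · refine ⟨1, ?_, fun _ => rfl, fun h' => absurd h h'⟩
    rw [← h, pairBoundary_self]
    exact .one
  · exact ⟨k, hk, fun h' => absurd h' h, fun _ => hk'⟩

/-- Operators `q a b` that stand for `I` times the product of the Majorana operators of two oddly
linked vertices. -/
theorem exists_oddProd (hg : IsEdgeSystem g e) : ∃ q : V → V → B, ∀ a b, OddLink g e a b →
    IsEdgeProd g e (q a b) (pairBoundary a b) 1 ∧ q b a = -star (q a b) ∧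
      (a ≠ b → star (q a b) = q a b) := by
  have h1 : ∀ a b, ∃ p, OddLink g e a b → IsEdgeProd g e p (pairBoundary a b) 1 ∧ star p = p := by
    intro a b
    by_cases h : OddLink g e a b
    · obtain ⟨p, hp⟩ := h
      obtain ⟨p', hp'⟩ := hp.exists_selfAdjoint hg
      exact ⟨p', fun _ => hp'⟩
    · exact ⟨0, fun h' => absurd h' h⟩
  choose p hp using h1
  refine ⟨fun a b => if a < b then p a b else if b < a then -p b a else Complex.I • p a b,
    fun a b h => ?_⟩
  have h' : OddLink g e b a := isOddRelation_oddLink.symm h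
  obtain ⟨h2, h3⟩ := hp a b h
  obtain ⟨h4, h5⟩ := hp b a h'
  rw [pairBoundary_comm] at h4
  rcases lt_trichotomy a b with hab | rfl | hab
  · simp [hab, hab.not_gt, h2, h3]
  · simpa [h3] using h2.smul_I
  · simp only [hab, hab.not_gt, if_true, if_false, star_neg, h5]
    exact ⟨h4.neg, by simp, fun _ => trivial⟩

/-- Hermitian operators `X a b` for the oddly linked pairs that behave like
`I` times products of two Majorana operators; `Y a b` is a product of two Majorana operators. -/
structure IsMajoranaSystem (g : ι → B) (e : ι → V × V) (X Y : V → V → B) : Prop where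
  isEdgeProd : ∀ a b, OddLink g e a b → a ≠ b → IsEdgeProd g e (X a b) (pairBoundary a b) 1
  selfAdjoint : ∀ a b, star (X a b) = X a b
  antisymm : ∀ a b, X b a = -X a b
  eq_zero : ∀ a b, ¬ OddLink g e a b → X a b = 0
  isEdgeProd_even : ∀ a b, evenLink g e a b → IsEdgeProd g e (Y a b) (pairBoundary a b) 0
  star_even : ∀ a b, evenLink g e a b → a ≠ b → star (Y a b) = -Y a b
  mul : ∀ a b d, evenLink g e a b → d ≠ a → d ≠ b → Y a b * X b d = X a d

/-- The operators are built by connecting all vertices of a class to its root, which fixes the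
signs consistently. -/
theorem exists_majoranaSystem (hg : IsEdgeSystem g e) :
    ∃ X Y : V → V → B, IsMajoranaSystem g e X Y := by
  classical
  choose k hk hk1 hkstar using exists_evenProd (g := g) (e := e) hg
  obtain ⟨q, hq⟩ := exists_oddProd (g := g) (e := e) hg
  have hodd : ∀ {a b}, OddLink g e a b → OddLink g e (root g e a) (root g e b) := fun {a b} h =>
    isOddRelation_oddLink.symm (isOddRelation_oddLink.trans_left
      ((evenLink g e).symm' (evenLink_root b)) (isOddRelation_oddLink.symm
      (isOddRelation_oddLink.trans_left ((evenLink g e).symm' (evenLink_root a)) h)))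
  have hkk : ∀ a, star (k a) * k a = 1 := fun a => Unitary.star_mul_self_of_mem ((hk a).mem_unitary hg)
  -- the path from `a` to `b` through the roots of their classes
  let Z : V → V → B := fun a b => k a * q (root g e a) (root g e b) * star (k b)
  have hZ : ∀ {a b}, OddLink g e a b → IsEdgeProd g e (Z a b) (pairBoundary a b) 1 := by
    intro a b h
    have h1 := ((hk a).mul (hq _ _ (hodd h)).1).mul ((hk b).star_mem hg)
    rwa [pairBoundary_add, pairBoundary_comm b, pairBoundary_add, zero_add, add_zero] at h1
  have hneg : ∀ {a b}, OddLink g e a b → Z b a = -star (Z a b) := by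
    intro a b h
    simp only [Z, star_mul, star_star, (hq _ _ (hodd h)).2.1, mul_assoc, mul_neg, neg_mul]
  -- anticommutation of two products whose boundaries share one vertex
  have hanti : ∀ {p p' : B} {a b c : V} {ε ε' : ZMod 2}, IsEdgeProd g e p (pairBoundary a b) ε →
      IsEdgeProd g e p' (pairBoundary b c) ε' → a ≠ b → a ≠ c → b ≠ c → p * p' = -(p' * p) := by
    intro p p' a b c ε ε' h h' h1 h2 h3
    rw [h.comm hg h', pairBoundary_dotProduct]
    simp [h1, h2, h3, paritySign_one]
  have hcomm : ∀ {p p' : B} {a : V} {δ : V → ZMod 2} {ε ε' : ZMod 2},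
      IsEdgeProd g e p (pairBoundary a a) ε → IsEdgeProd g e p' δ ε' → p * p' = p' * p := by
    intro p p' a δ ε ε' h h'
    rw [h.comm hg h', pairBoundary_self, zero_dotProduct, paritySign_zero, one_smul]
  have hrootne : ∀ {a b}, b ≠ root g e b → root g e a ≠ b := fun {a b} h h' =>
    h (by rw [← h', root_root])
  -- hermiticity if the first vertex is a root
  have hsa1 : ∀ {a b}, OddLink g e a b → a ≠ b → a = root g e a → star (Z a b) = Z a b := by
    intro a b h hab ha
    obtain ⟨hq1, hq2, hq3⟩ := hq _ _ (hodd h)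
    simp only [Z, hk1 a ha, one_mul]
    by_cases hb : b = root g e b
    · rw [hk1 b hb, star_one, mul_one]
      exact hq3 (by rwa [← ha, ← hb])
    · rw [hkstar b hb, star_mul, star_neg, hkstar b hb, neg_neg]
      by_cases hr : root g e a = root g e b
      · have h1 : star (q (root g e a) (root g e b)) = -q (root g e a) (root g e b) := by
          rw [← hr] at hq2 ⊢
          rw [eq_neg_iff_add_eq_zero, add_comm, ← eq_neg_iff_add_eq_zero]
          exact hq2
        have h2 : q (root g e a) (root g e b) * k b = k b * q (root g e a) (root g e b) := by
          rw [hr] at hq1 ⊢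
          exact hcomm hq1 (hk b)
        rw [h1, mul_neg, mul_neg, h2]
      · rw [hq3 hr, mul_neg]
        rw [pairBoundary_comm] at hq1
        exact hanti (hk b) hq1 hb (hrootne hb).symm (Ne.symm hr)
  have hsa : ∀ {a b}, OddLink g e a b → a ≠ b → star (Z a b) = Z a b := by
    intro a b h hab
    by_cases ha : a = root g e a
    · exact hsa1 h hab ha
    have hra : OddLink g e (root g e a) b :=
      isOddRelation_oddLink.trans_left ((evenLink g e).symm' (evenLink_root a)) h
    have hZ1 : Z a b = k a * Z (root g e a) b := by
      simp only [Z, root_root, hk1 (root g e a) (root_root a).symm, one_mul, mul_assoc]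
    rw [hZ1, star_mul, hkstar a ha]
    by_cases hb : root g e a = b
    · obtain ⟨hq1, hq2, hq3⟩ := hq _ _ hra
      have h1 : Z (root g e a) b = q (root g e a) (root g e a) := by
        rw [← hb]
        simp only [Z, root_root, hk1 (root g e a) (root_root a).symm, star_one, mul_one, one_mul]
      rw [← hb] at hq1 hq2
      have h2 : star (q (root g e a) (root g e a)) = -q (root g e a) (root g e a) := by
        rw [eq_neg_iff_add_eq_zero, add_comm, ← eq_neg_iff_add_eq_zero]
        exact hq2
      rw [h1, h2, neg_mul_neg, hcomm hq1 (hk a)]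
    · rw [hsa1 hra hb (root_root a).symm, mul_neg, eq_comm]
      exact hanti (hk a) (hZ hra) ha hab hb
  refine ⟨fun a b => if OddLink g e a b ∧ a ≠ b then Z a b else 0, fun a b => k a * star (k b),
    ?_, ?_, ?_, ?_, ?_, ?_, ?_⟩
  · intro a b h hab
    simp only [h, hab, ne_eq, not_false_eq_true, and_self, if_true]
    exact hZ h
  · intro a b
    split_ifs with h
    · exact hsa h.1 h.2
    · exact star_zero _
  · intro a b
    by_cases h : OddLink g e a b ∧ a ≠ b
    · rw [if_pos h, if_pos ⟨isOddRelation_oddLink.symm h.1, h.2.symm⟩, hneg h.1, hsa h.1 h.2]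
    · rw [if_neg h, if_neg fun h' => h ⟨isOddRelation_oddLink.symm h'.1, h'.2.symm⟩, neg_zero]
  · intro a b h
    exact if_neg fun h' => h h'.1
  · intro a b h
    have h1 := (hk a).mul ((hk b).star_mem hg)
    rwa [root_eq h, pairBoundary_comm b, pairBoundary_add, add_zero] at h1
  · intro a b h hab
    have hr := root_eq h
    simp only [star_mul, star_star]
    by_cases ha : a = root g e a
    · have hb : b ≠ root g e b := fun hb => hab (by rw [ha, hb, hr])
      rw [hk1 a ha, hkstar b hb]
      simp
    · rw [hkstar a ha]
      by_cases hb : b = root g e b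
      · rw [hk1 b hb]
        simp
      · rw [hkstar b hb]
        have h1 := hk b
        rw [← hr, pairBoundary_comm] at h1
        rw [mul_neg, mul_neg, neg_neg, hanti (hk a) h1 ha hab (hrootne hb)]
  · intro a b d h hda hdb
    have h1 : OddLink g e b d ↔ OddLink g e a d :=
      ⟨isOddRelation_oddLink.trans_left h, isOddRelation_oddLink.trans_left ((evenLink g e).symm' h)⟩
    by_cases h2 : OddLink g e a d
    · rw [if_pos ⟨h1.2 h2, hdb.symm⟩, if_pos ⟨h2, hda.symm⟩]
      simp only [Z, root_eq h]
      rw [mul_assoc (k a), ← mul_assoc (star (k b)), ← mul_assoc (star (k b)), hkk, one_mul,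
        mul_assoc]
    · rw [if_neg fun h' => h2 (h1.1 h'.1), if_neg fun h' => h2 h'.1, mul_zero]

end Gauge

/-! ### Free-fermion solution of line-graph modules -/

section MatrixOperator

open Matrix

variable {V : Type*} [Fintype V] {B : Type*} [AddCommGroup B] [Module ℂ B]

/-- The quadratic form `∑ a b, A a b • X a b` in the Majorana bilinears `X a b`. -/
noncomputable def quadraticForm (X : V → V → B) (A : Matrix V V ℝ) : B :=
  ∑ a, ∑ b, (A a b : ℂ) • X a b

theorem quadraticForm_sum {κ : Type*} (X : V → V → B) (P : Finset κ) (τ : κ → ℝ)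
    (A : κ → Matrix V V ℝ) :
    quadraticForm X (∑ p ∈ P, τ p • A p) = ∑ p ∈ P, (τ p : ℂ) • quadraticForm X (A p) := by
  classical
  induction P using Finset.induction_on with
  | empty => simp [quadraticForm]
  | insert p P hp ih =>
    rw [Finset.sum_insert hp, Finset.sum_insert hp, ← ih]
    simp only [quadraticForm, Matrix.add_apply, Matrix.smul_apply, smul_eq_mul, Complex.ofReal_add,
      Complex.ofReal_mul, add_smul, mul_smul, Finset.sum_add_distrib, Finset.smul_sum]

theorem quadraticForm_pairMatrix [DecidableEq V] {X : V → V → B} (hX : ∀ a b, X b a = -X a b)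
    (p : V × V) : quadraticForm X (pairMatrix p) = (2 : ℂ) • X p.1 p.2 := by
  have h : ∀ a b : V, ∑ c, ∑ d, ((vecMulVec (Pi.single a (1 : ℝ)) (Pi.single b (1 : ℝ)) c d : ℝ) : ℂ)
      • X c d = X a b := fun a b => by
    rw [Finset.sum_eq_single a, Finset.sum_eq_single b]
    · simp [vecMulVec_apply]
    · intro d _ hd
      simp [vecMulVec_apply, hd]
    · simp
    · intro c _ hc
      simp [vecMulVec_apply, hc]
    · simp
  simp only [quadraticForm, pairMatrix, Matrix.sub_apply, Complex.ofReal_sub, sub_smul,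
    Finset.sum_sub_distrib, h]
  rw [hX p.1 p.2, two_smul, sub_neg_eq_add]

theorem sum_givens_smul [DecidableEq V] {a b : V} (hab : a ≠ b) (c s : ℝ) (j : V) (f : V → B) :
    ∑ i, (givens a b c s i j : ℂ) • f i =
      if j = a then (c : ℂ) • f a - (s : ℂ) • f b
      else if j = b then (s : ℂ) • f a + (c : ℂ) • f b else f j := by
  by_cases hja : j = a
  · subst hja
    rw [Finset.sum_eq_add j b hab]
    · simp [givens, hab.symm, sub_eq_add_neg]
    · rintro i - ⟨h1, h2⟩
      simp [givens, h1, h2, Ne.symm h1]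
    · simp
    · simp
  · by_cases hjb : j = b
    · subst hjb
      rw [Finset.sum_eq_add a j hab]
      · simp [givens, hab.symm]
      · rintro i - ⟨h1, h2⟩
        simp [givens, h1, h2, Ne.symm h2]
      · simp
      · simp
    · rw [Finset.sum_eq_single j]
      · simp [givens, hja, hjb]
      · intro i _ hi
        by_cases h1 : i = a
        · simp [givens, h1, hja, hjb]
        · by_cases h2 : i = b
          · simp [givens, h2, hab.symm, hja, hjb]
          · simp [givens, h1, h2, Ne.symm hi]
      · simp

theorem quadraticForm_conj (X : V → V → B) (G A : Matrix V V ℝ) :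
    quadraticForm X (G * A * Gᵀ) =
      ∑ c, ∑ d, (A c d : ℂ) • ∑ i, (G i c : ℂ) • ∑ j, (G j d : ℂ) • X i j := by
  simp only [quadraticForm, mul_apply, transpose_apply, Complex.ofReal_sum, Complex.ofReal_mul,
    Finset.sum_mul, Finset.sum_smul, Finset.smul_sum, smul_smul]
  -- both sides are sums over all four indices
  have h1 : ∀ F : V → V → V → V → B, ∑ i, ∑ j, ∑ d, ∑ c, F i j d c =
      ∑ c, ∑ d, ∑ i, ∑ j, F i j d c := fun F => by
    calc _ = ∑ i, ∑ d, ∑ j, ∑ c, F i j d c := Finset.sum_congr rfl fun i _ => Finset.sum_comm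
      _ = ∑ i, ∑ d, ∑ c, ∑ j, F i j d c := Finset.sum_congr rfl fun i _ =>
          Finset.sum_congr rfl fun d _ => Finset.sum_comm
      _ = ∑ i, ∑ c, ∑ d, ∑ j, F i j d c := Finset.sum_congr rfl fun i _ => Finset.sum_comm
      _ = ∑ c, ∑ i, ∑ d, ∑ j, F i j d c := Finset.sum_comm
      _ = _ := Finset.sum_congr rfl fun c _ => Finset.sum_comm
  rw [h1]
  refine Finset.sum_congr rfl fun c _ => Finset.sum_congr rfl fun d _ =>
    Finset.sum_congr rfl fun i _ => Finset.sum_congr rfl fun j _ => ?_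
  congr 1
  ring

end MatrixOperator

section LineGraph

open Matrix

variable {E : Type*} [NormedAddCommGroup E] [InnerProductSpace ℂ E] [CompleteSpace E]
variable {V : Type*} [Fintype V]

/-- The operators of `M` as a family indexed by `M`. -/
abbrev edgeOp (M : Finset (unitary (E →L[ℂ] E))) (i : M) : E →L[ℂ] E := (i : unitary (E →L[ℂ] E))

section Even

variable [DecidableEq V] {M : Finset (unitary (E →L[ℂ] E))} {e : M → V × V}

omit [Fintype V] in
theorem IsEdgeProd.evenProduct_or {p : E →L[ℂ] E} {δ : V → ZMod 2} {ε : ZMod 2}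
    (h : IsEdgeProd (edgeOp M) e p δ ε) :
    (ε = 0 ∧ ∃ q ∈ Subgroup.closure {u | ∃ g ∈ M, ∃ h ∈ M, u = g * h}, ∃ a : ℂ,
        p = a • (q : E →L[ℂ] E)) ∨
      (ε = 1 ∧ ∃ q ∈ Subgroup.closure {u | ∃ g ∈ M, ∃ h ∈ M, u = g * h}, ∃ h ∈ M, ∃ a : ℂ,
        p = a • ((q : E →L[ℂ] E) * (h : E →L[ℂ] E))) := by
  induction h with
  | one => exact Or.inl ⟨rfl, 1, one_mem _, 1, by simp⟩
  | mul_edge i _ ih =>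
    rcases ih with ⟨rfl, q, hq, a, rfl⟩ | ⟨rfl, q, hq, h, hh, a, rfl⟩
    · exact Or.inr ⟨rfl, q, hq, i, i.2, a, by rw [smul_mul_assoc]⟩
    · refine Or.inl ⟨rfl, q * (h * i), mul_mem hq (Subgroup.subset_closure ⟨h, hh, i, i.2, rfl⟩), a, ?_⟩
      rw [smul_mul_assoc, mul_assoc]
      rfl
  | smul_I _ ih =>
    rcases ih with ⟨rfl, q, hq, a, rfl⟩ | ⟨rfl, q, hq, h, hh, a, rfl⟩
    · exact Or.inl ⟨rfl, q, hq, Complex.I * a, by rw [smul_smul]⟩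
    · exact Or.inr ⟨rfl, q, hq, h, hh, Complex.I * a, by rw [smul_smul]⟩

omit [Fintype V] in
theorem IsEdgeProd.isEvenProduct {u : unitary (E →L[ℂ] E)} {δ : V → ZMod 2}
    (h : IsEdgeProd (edgeOp M) e u δ 0) :
    IsEvenProduct M u := by
  rcases h.evenProduct_or with ⟨-, h⟩ | ⟨h, -⟩
  · exact h
  · exact absurd h (by decide)

end Even

variable [LinearOrder V] {M : Finset (unitary (E →L[ℂ] E))} {e : M → V × V}

/-- A rotation generated by a product of two Majorana operators acts on the quadratic forms as a
rotation of the plane of these two. -/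
theorem exists_rotation_givens
    (hg : IsEdgeSystem (edgeOp M) e)
    {X Y : V → V → E →L[ℂ] E} (hX : IsMajoranaSystem (edgeOp M) e X Y)
    {a b : V} (hab : a ≠ b) (hr : evenLink (edgeOp M) e a b)
    {c s : ℝ} (hcs : c ^ 2 + s ^ 2 = 1) :
    ∃ u ∈ rotationGroup M, ∀ A : Matrix V V ℝ,
      (u : E →L[ℂ] E) * quadraticForm X A * star (u : E →L[ℂ] E) =
        quadraticForm X (givens a b c s * A * (givens a b c s)ᵀ) := by
  have hYs := hX.star_even a b hr hab
  have hYp := hX.isEdgeProd_even a b hr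
  -- the hermitian generator is `-I • Y`
  have hρp := hYp.smul_I.neg
  let ρ : unitary (E →L[ℂ] E) := ⟨-(Complex.I • Y a b), hρp.mem_unitary hg⟩
  have hρ : IsSelfAdjoint (ρ : E →L[ℂ] E) := by
    show star (-(Complex.I • Y a b)) = -(Complex.I • Y a b)
    simp [hYs]
  have hYY : Y a b * Y a b = -1 := by
    have := Unitary.star_mul_self_of_mem (hYp.mem_unitary hg)
    rw [hYs, neg_mul] at this
    rw [← this, neg_neg]
  obtain ⟨u, hu, hfix, hrot⟩ := exists_rotation hρ (IsEdgeProd.isEvenProduct (u := ρ) hρp) hcs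
  refine ⟨u, hu, ?_⟩
  have hρY : ∀ x : E →L[ℂ] E, (s * Complex.I : ℂ) • ((ρ : E →L[ℂ] E) * x) = (s : ℂ) • (Y a b * x) := by
    intro x
    show (s * Complex.I : ℂ) • (-(Complex.I • Y a b) * x) = _
    rw [neg_mul, smul_mul_assoc, smul_neg, smul_smul, mul_assoc, Complex.I_mul_I]
    simp
  have hfix' : ∀ x y, (x = a ∧ y = b) ∨ (x = b ∧ y = a) ∨ (x ≠ a ∧ x ≠ b ∧ y ≠ a ∧ y ≠ b) →
      (u : E →L[ℂ] E) * X x y * star (u : E →L[ℂ] E) = X x y := by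
    intro x y hxy
    by_cases hxy' : x = y
    · subst hxy'
      simp [eq_zero_of_eq_neg (hX.antisymm x x)]
    by_cases ho : OddLink (edgeOp M) e x y
    · refine hfix _ ?_
      have h1 := hρp.comm hg (hX.isEdgeProd x y ho hxy')
      rw [pairBoundary_dotProduct] at h1
      have h2 : ((if a = x then 1 else 0) + (if a = y then 1 else 0) +
          ((if b = x then 1 else 0) + (if b = y then 1 else 0)) : ZMod 2) = 0 := by
        rcases hxy with ⟨rfl, rfl⟩ | ⟨rfl, rfl⟩ | ⟨h3, h4, h5, h6⟩
        · simp [hab, hab.symm]; rfl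
        · simp [hab, hab.symm]; rfl
        · simp [h3.symm, h4.symm, h5.symm, h6.symm]
      rw [h2, paritySign_zero, one_smul] at h1
      exact h1
    · rw [hX.eq_zero x y ho]
      simp
  have hrot' : ∀ d, d ≠ a → d ≠ b →
      (u : E →L[ℂ] E) * X a d * star (u : E →L[ℂ] E) = (c : ℂ) • X a d - (s : ℂ) • X b d ∧
      (u : E →L[ℂ] E) * X b d * star (u : E →L[ℂ] E) = (s : ℂ) • X a d + (c : ℂ) • X b d := by
    intro d hda hdb
    have h1 := hX.mul a b d hr hda hdb
    have h2 : Y a b * X a d = -X b d := by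
      rw [← h1, ← mul_assoc, hYY, neg_mul, one_mul]
    have hanti : ∀ x, (x = a ∨ x = b) → X x d * ρ = -((ρ : E →L[ℂ] E) * X x d) := by
      intro x hx
      by_cases ho : OddLink (edgeOp M) e x d
      · have hxd : x ≠ d := by
          rcases hx with rfl | rfl
          · exact hda.symm
          · exact hdb.symm
        have h3 := (hX.isEdgeProd x d ho hxd).comm hg hρp
        rw [pairBoundary_dotProduct] at h3
        have h4 : ((if x = a then 1 else 0) + (if x = b then 1 else 0) +
            ((if d = a then 1 else 0) + (if d = b then 1 else 0)) : ZMod 2) = 1 := by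
          rcases hx with rfl | rfl
          · simp [hda, hdb, hab]
          · simp [hda, hdb, hab.symm]
        rw [h4, paritySign_one, neg_smul, one_smul] at h3
        exact h3
      · rw [hX.eq_zero x d ho]
        simp
    constructor
    · rw [hrot _ (hanti a (Or.inl rfl)), hρY, h2, smul_neg, sub_eq_add_neg]
    · rw [hrot _ (hanti b (Or.inr rfl)), hρY, h1, add_comm]
  have hcs' : (c : ℂ) * c + s * s = 1 := by
    have := hcs
    rw [sq, sq] at this
    exact_mod_cast this
  have hXd : ∀ d, X d d = 0 := fun d => eq_zero_of_eq_neg (hX.antisymm d d)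
  intro A
  rw [quadraticForm_conj, quadraticForm, Finset.mul_sum, Finset.sum_mul]
  refine Finset.sum_congr rfl fun x _ => ?_
  rw [Finset.mul_sum, Finset.sum_mul]
  refine Finset.sum_congr rfl fun y _ => ?_
  rw [mul_smul_comm, smul_mul_assoc]
  congr 1
  simp only [sum_givens_smul hab]
  have hneg : ∀ x y, (u : E →L[ℂ] E) * X x y * star (u : E →L[ℂ] E) =
      -((u : E →L[ℂ] E) * X y x * star (u : E →L[ℂ] E)) := fun x y => by
    rw [hX.antisymm y x, mul_neg, neg_mul]
  have hone : X a b = ((c : ℂ) * c + s * s) • X a b := by rw [hcs', one_smul]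
  by_cases hxa : x = a
  · subst hxa
    by_cases hya : y = x
    · subst hya
      simp only [if_true, hXd, hX.antisymm y b]
      simp only [mul_zero, zero_mul]
      module
    · by_cases hyb : y = b
      · subst hyb
        rw [hfix' x y (Or.inl ⟨rfl, rfl⟩)]
        simp only [if_true, hXd, hX.antisymm x y, if_neg hab.symm]
        nth_rw 1 [hone]
        module
      · simp only [if_true, if_neg hya, if_neg hyb]
        exact (hrot' y hya hyb).1
  · by_cases hxb : x = b
    · subst hxb
      by_cases hya : y = a
      · subst hya
        rw [hfix' x y (Or.inr (Or.inl ⟨rfl, rfl⟩))]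
        simp only [if_true, hXd, hX.antisymm y x, if_neg hab.symm]
        nth_rw 1 [hone]
        module
      · by_cases hyb : y = x
        · subst hyb
          simp only [if_true, hXd, hX.antisymm a y, if_neg hxa]
          simp only [mul_zero, zero_mul]
          module
        · simp only [if_true, if_neg hya, if_neg hyb, if_neg hxa]
          exact (hrot' y hya hyb).2
    · simp only [if_neg hxa, if_neg hxb]
      by_cases hya : y = a
      · subst hya
        rw [hneg, (hrot' x hxa hxb).1, if_pos rfl, hX.antisymm y x, hX.antisymm b x]
        module
      · by_cases hyb : y = b
        · subst hyb
          rw [hneg, (hrot' x hxa hxb).2, if_neg hya, if_pos rfl, hX.antisymm a x, hX.antisymm y x]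
          module
        · rw [if_neg hya, if_neg hyb]
          exact hfix' x y (Or.inr (Or.inr ⟨hxa, hxb, hya, hyb⟩))

theorem exists_rotation_of_mem_givensGroup
    (hg : IsEdgeSystem (edgeOp M) e)
    {X Y : V → V → E →L[ℂ] E} (hX : IsMajoranaSystem (edgeOp M) e X Y)
    {F : Finset V} {O : Matrix V V ℝ}
    (hO : O ∈ givensGroup (evenLink (edgeOp M) e) F) :
    ∃ u ∈ rotationGroup M, ∀ A : Matrix V V ℝ,
      (u : E →L[ℂ] E) * quadraticForm X A * star (u : E →L[ℂ] E) = quadraticForm X (O * A * Oᵀ) := by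
  induction hO using Submonoid.closure_induction with
  | mem G hG =>
    obtain ⟨a, _, b, _, hab, hr, c, s, hcs, rfl⟩ := hG
    exact exists_rotation_givens hg hX hab hr hcs
  | one => exact ⟨1, one_mem _, fun A => by simp⟩
  | mul O O' _ _ h h' =>
    obtain ⟨u, hu, hu'⟩ := h
    obtain ⟨v, hv, hv'⟩ := h'
    refine ⟨u * v, mul_mem hu hv, fun A => ?_⟩
    rw [show O * O' * A * (O * O')ᵀ = O * (O' * A * O'ᵀ) * Oᵀ by
      simp only [transpose_mul, Matrix.mul_assoc], ← hu', ← hv']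
    simp only [Submonoid.coe_mul, star_mul, mul_assoc]

end LineGraph

/-! ### Collapsing one module -/

section Collapse

open Matrix

variable {E : Type*} [NormedAddCommGroup E] [InnerProductSpace ℂ E] [CompleteSpace E]

theorem isSelfAdjoint_mul {u v : unitary (E →L[ℂ] E)} (hu : IsSelfAdjoint (u : E →L[ℂ] E))
    (hv : IsSelfAdjoint (v : E →L[ℂ] E)) (h : Commute (u : E →L[ℂ] E) v) :
    IsSelfAdjoint ((u * v : unitary (E →L[ℂ] E)) : E →L[ℂ] E) :=
  (hu.commute_iff hv).1 h

variable (E) in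
/-- The data of the collapse of one module: the symmetries of a first round, which precede the
rotation, and those of a second round, which follow it; the rotation for given weights and signs of
the first round; the weight of the remaining operator for given weights and signs. -/
structure CollapseData where
  syms₁ : List (unitary (E →L[ℂ] E))
  syms₂ : List (unitary (E →L[ℂ] E))
  rot : (unitary (E →L[ℂ] E) → ℝ) → (ℕ → ℤˣ) → unitary (E →L[ℂ] E)
  weight : (unitary (E →L[ℂ] E) → ℝ) → (ℕ → ℤˣ) → (ℕ → ℤˣ) → ℝ

/-- `Q` lies in the joint eigenspace of the operators in `L` for the signs `y`. -/
def IsJointEigen (L : List (unitary (E →L[ℂ] E))) (y : ℕ → ℤˣ) (Q : E →L[ℂ] E) : Prop :=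
  ∀ j (h : j < L.length), (L[j] : E →L[ℂ] E) * Q = (((y j : ℤˣ) : ℤ) : ℂ) • Q

/-- `d` collapses the operators of `M` to the single operator `v`. -/
structure CollapseData.IsValid (d : CollapseData E) (M : Finset (unitary (E →L[ℂ] E)))
    (v : unitary (E →L[ℂ] E)) : Prop where
  selfAdjoint₁ : ∀ s ∈ d.syms₁, IsSelfAdjoint (s : E →L[ℂ] E)
  even₁ : ∀ s ∈ d.syms₁, IsEvenProduct M s
  comm₁ : ∀ s ∈ d.syms₁, ∀ g ∈ M, Commute s g
  selfAdjoint₂ : ∀ s ∈ d.syms₂, IsSelfAdjoint (s : E →L[ℂ] E)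
  even₂ : ∀ s ∈ d.syms₂, IsEvenProduct M s
  comm₂ : ∀ s ∈ d.syms₂, ∀ s' ∈ d.syms₂, Commute s s'
  comm_left₂ : ∀ s ∈ d.syms₂, Commute s v
  rot_mem : ∀ w y, d.rot w y ∈ rotationGroup M
  collapse : ∀ w y₁ y₂ (Q : E →L[ℂ] E), IsJointEigen d.syms₁ y₁ Q → IsJointEigen d.syms₂ y₂ Q →
    (d.rot w y₁ : E →L[ℂ] E) * hamiltonian M w * star (d.rot w y₁ : E →L[ℂ] E) * Q =
      (d.weight w y₁ y₂ : ℂ) • ((v : E →L[ℂ] E) * Q)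

theorem exists_index {κ : Type*} {β : Type*} (l : List κ) (f : κ → β) :
    ∃ idx : κ → ℕ, ∀ k ∈ l, ∃ h : idx k < (l.map f).length, (l.map f)[idx k] = f k := by
  have h : ∀ k, ∃ j, k ∈ l → ∃ h : j < (l.map f).length, (l.map f)[j] = f k := fun k => by
    by_cases hk : k ∈ l
    · obtain ⟨j, hj, hj'⟩ := List.getElem_of_mem (List.mem_map_of_mem (f := f) hk)
      exact ⟨j, fun _ => ⟨hj, hj'⟩⟩
    · exact ⟨0, fun h => absurd h hk⟩
  choose idx hidx using h
  exact ⟨idx, hidx⟩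

omit [CompleteSpace E] in
/-- If the product of the involutions `g` and `h` acts as a sign, the two agree up to this sign. -/
theorem mul_eq_smul_of_mul_mul {g h Q : E →L[ℂ] E} (hg : g * g = 1) {a : ℤˣ}
    (H : g * h * Q = ((a : ℤ) : ℂ) • Q) : g * Q = ((a : ℤ) : ℂ) • (h * Q) := by
  have h1 : h * Q = ((a : ℤ) : ℂ) • (g * Q) := by
    rw [← mul_smul_comm, ← H, ← mul_assoc, ← mul_assoc, hg, one_mul]
  rw [h1, smul_smul, intCast_units_sq, one_smul]

theorem exists_collapse_singleton (v : unitary (E →L[ℂ] E)) :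
    ∃ d : CollapseData E, d.IsValid {v} v ∧ (∀ w y, d.rot w y = 1) ∧ d.syms₁ = [] ∧ d.syms₂ = [] := by
  refine ⟨⟨[], [], fun _ _ => 1, fun w _ _ => w v⟩, ⟨by simp, by simp, by simp, by simp, by simp,
    by simp, by simp, fun _ _ => one_mem _, fun w y₁ y₂ Q _ _ => ?_⟩, fun _ _ => rfl, rfl, rfl⟩
  simp [hamiltonian]

/-- Commuting operators agree up to signs in the eigenspaces of their products. -/
theorem exists_collapse_of_commute {M : Finset (unitary (E →L[ℂ] E))} {v : unitary (E →L[ℂ] E)}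
    (hv : v ∈ M) (hsa : ∀ g ∈ M, IsSelfAdjoint (g : E →L[ℂ] E))
    (hc : ∀ g ∈ M, ∀ h ∈ M, Commute g h) :
    ∃ d : CollapseData E, d.IsValid M v ∧ (∀ w y, d.rot w y = 1) := by
  obtain ⟨idx, hidx⟩ := exists_index M.toList (fun g => g * v)
  have hmem : ∀ {P : unitary (E →L[ℂ] E) → Prop}, (∀ g ∈ M, P (g * v)) →
      ∀ s ∈ M.toList.map (fun g => g * v), P s := by
    intro P hP s hs
    obtain ⟨g, hg, rfl⟩ := List.mem_map.1 hs
    exact hP g (Finset.mem_toList.1 hg)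
  refine ⟨⟨[], M.toList.map (fun g => g * v), fun _ _ => 1,
    fun w _ y₂ => ∑ g ∈ M, w g * ((y₂ (idx g) : ℤ) : ℝ)⟩, ⟨by simp, by simp, by simp, ?_, ?_, ?_, ?_,
      fun _ _ => one_mem _, fun w y₁ y₂ Q _ h => ?_⟩, fun _ _ => rfl⟩
  · exact hmem fun g hg => isSelfAdjoint_mul (hsa g hg) (hsa v hv) (coe_commute (hc g hg v hv))
  · exact hmem fun g hg => IsEvenProduct.mul_mem hg hv
  · exact hmem fun g hg => hmem fun g' hg' =>
      ((hc g hg g' hg').mul_right (hc g hg v hv)).mul_left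
        ((hc v hv g' hg').mul_right (Commute.refl v))
  · exact hmem fun g hg => (hc g hg v hv).mul_left (Commute.refl v)
  · simp only [OneMemClass.coe_one, one_mul, star_one, mul_one, hamiltonian, Finset.sum_mul,
      Complex.ofReal_sum, Finset.sum_smul]
    refine Finset.sum_congr rfl fun g hg => ?_
    obtain ⟨h1, h2⟩ := hidx g (Finset.mem_toList.2 hg)
    have h3 := h _ h1
    rw [h2] at h3
    rw [smul_mul_assoc, mul_eq_smul_of_mul_mul (mul_self_of_isSelfAdjoint (hsa g hg)) h3, smul_smul]
    congr 1
    push_cast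
    rfl

/-- Two anticommuting operators `h` and `v` span a plane, whose rotations are generated by
`I • (h * v)`; these remove the operators of `T` from the linear combination one by one. -/
theorem exists_rotate_anticommuting {M : Finset (unitary (E →L[ℂ] E))} {v : unitary (E →L[ℂ] E)}
    (hv : v ∈ M) (hsa : ∀ g ∈ M, IsSelfAdjoint (g : E →L[ℂ] E))
    (hc : ∀ g ∈ M, ∀ h ∈ M, g ≠ h → (g : E →L[ℂ] E) * h = -((h : E →L[ℂ] E) * g))
    {T : Finset (unitary (E →L[ℂ] E))} (hT : T ⊆ M) (hvT : v ∉ T)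
    (w : unitary (E →L[ℂ] E) → ℝ) (a : ℝ) :
    ∃ u ∈ rotationGroup M, ∃ b : ℝ,
      (u : E →L[ℂ] E) * (hamiltonian T w + (a : ℂ) • (v : E →L[ℂ] E)) * star (u : E →L[ℂ] E) =
        (b : ℂ) • (v : E →L[ℂ] E) := by
  classical
  induction T using Finset.induction_on generalizing a with
  | empty => exact ⟨1, one_mem _, a, by simp [hamiltonian]⟩
  | insert h T hhT ih =>
    have hhM : h ∈ M := hT (Finset.mem_insert_self _ _)
    have hhv : h ≠ v := fun h' => hvT (h' ▸ Finset.mem_insert_self _ _)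
    have hTM : T ⊆ M := (Finset.subset_insert _ _).trans hT
    have hvT' : v ∉ T := fun h' => hvT (Finset.mem_insert_of_mem h')
    have h1 := mul_self_of_isSelfAdjoint (hsa h hhM)
    have h2 := mul_self_of_isSelfAdjoint (hsa v hv)
    have h3 := hc h hhM v hv hhv
    -- the hermitian generator `I • (h * v)` rotates `h` and `v` into each other
    have hmem : Complex.I • ((h : E →L[ℂ] E) * v) ∈ unitary (E →L[ℂ] E) := by
      have := (h * v).2
      rw [Unitary.mem_iff] at this ⊢
      simp only [Submonoid.coe_mul] at this
      simp only [star_smul, smul_mul_smul_comm, this.1, this.2]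
      simp
    let ρ : unitary (E →L[ℂ] E) := ⟨_, hmem⟩
    have hρ : (ρ : E →L[ℂ] E) = Complex.I • ((h : E →L[ℂ] E) * v) := rfl
    have hρsa : IsSelfAdjoint (ρ : E →L[ℂ] E) := by
      rw [hρ, isSelfAdjoint_iff, star_smul, star_mul, (hsa h hhM).star_eq, (hsa v hv).star_eq, h3]
      simp
    have hρM : IsEvenProduct M ρ := by
      refine ⟨h * v, Subgroup.subset_closure ⟨h, hhM, v, hv, rfl⟩, Complex.I, ?_⟩
      rw [hρ]; rfl
    have hρh : (ρ : E →L[ℂ] E) * h = -(Complex.I • (v : E →L[ℂ] E)) := by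
      rw [hρ, smul_mul_assoc, h3, neg_mul, mul_assoc, h1, mul_one, smul_neg]
    have hhρ : (h : E →L[ℂ] E) * ρ = Complex.I • (v : E →L[ℂ] E) := by
      rw [hρ, mul_smul_comm, ← mul_assoc, h1, one_mul]
    have hρv : (ρ : E →L[ℂ] E) * v = Complex.I • (h : E →L[ℂ] E) := by
      rw [hρ, smul_mul_assoc, mul_assoc, h2, mul_one]
    have hvρ : (v : E →L[ℂ] E) * ρ = -(Complex.I • (h : E →L[ℂ] E)) := by
      rw [hρ, mul_smul_comm, h3, mul_neg, ← mul_assoc, h2, one_mul, smul_neg]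
    -- the cosine and sine that annihilate the coefficient of `h`
    obtain ⟨c, s, hcs, hs⟩ : ∃ c s : ℝ, c ^ 2 + s ^ 2 = 1 ∧ c * w h - s * a = 0 := by
      by_cases h0 : w h ^ 2 + a ^ 2 = 0
      · have h1 : w h = 0 := by nlinarith [sq_nonneg (w h), sq_nonneg a]
        exact ⟨1, 0, by norm_num, by rw [h1]; ring⟩
      · have h2 : 0 ≤ w h ^ 2 + a ^ 2 := by positivity
        have h3 := Real.sq_sqrt h2
        have h4 : Real.sqrt (w h ^ 2 + a ^ 2) ≠ 0 := fun h' => h0 (by rw [← h3, h']; ring)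
        refine ⟨a / Real.sqrt (w h ^ 2 + a ^ 2), w h / Real.sqrt (w h ^ 2 + a ^ 2), ?_, ?_⟩
        · rw [div_pow, div_pow, ← add_div, h3, add_comm, div_self h0]
        · field_simp
          ring
    obtain ⟨u₁, hu₁, hfix, hrot⟩ := exists_rotation hρsa hρM hcs
    obtain ⟨u₂, hu₂, b, hb⟩ := ih hTM hvT' (s * w h + c * a)
    refine ⟨u₂ * u₁, mul_mem hu₂ hu₁, b, ?_⟩
    rw [← hb]
    have h4 : (u₁ : E →L[ℂ] E) * hamiltonian T w * star (u₁ : E →L[ℂ] E) = hamiltonian T w := by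
      refine hfix _ (Commute.sum_right _ _ _ fun g hg => Commute.smul_right ?_ _)
      have hgM := hTM hg
      have h5 := hc g hgM h hhM fun h' => hhT (h' ▸ hg)
      have h6 := hc g hgM v hv fun h' => hvT' (h' ▸ hg)
      refine Commute.smul_left (Commute.symm ?_) _
      rw [Commute, SemiconjBy, ← mul_assoc, h5, neg_mul, mul_assoc, h6, mul_neg, neg_neg, mul_assoc]
    have h5 := hrot h (by rw [hhρ, hρh, neg_neg])
    have h6 := hrot v (by rw [hρv, hvρ])
    rw [hρh] at h5
    rw [hρv] at h6
    have hs' : (c : ℂ) * w h - s * a = 0 := by exact_mod_cast congrArg (fun z : ℝ => (z : ℂ)) hs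
    have h7 : (u₁ : E →L[ℂ] E) * (hamiltonian (insert h T) w + (a : ℂ) • (v : E →L[ℂ] E)) *
        star (u₁ : E →L[ℂ] E) = hamiltonian T w + ((s * w h + c * a : ℝ) : ℂ) • (v : E →L[ℂ] E) := by
      have h8 : hamiltonian (insert h T) w = (w h : ℂ) • (h : E →L[ℂ] E) + hamiltonian T w :=
        Finset.sum_insert hhT
      rw [h8, mul_add, add_mul, mul_add, add_mul, h4, mul_smul_comm, smul_mul_assoc, h5,
        mul_smul_comm, smul_mul_assoc, h6]
      have h9 : (w h : ℂ) • ((c : ℂ) • (h : E →L[ℂ] E) +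
            (s * Complex.I : ℂ) • -(Complex.I • (v : E →L[ℂ] E))) + hamiltonian T w +
          (a : ℂ) • ((c : ℂ) • (v : E →L[ℂ] E) + (s * Complex.I : ℂ) • Complex.I • (h : E →L[ℂ] E)) =
          (c * w h + (Complex.I * Complex.I) * (s * a) : ℂ) • (h : E →L[ℂ] E) + hamiltonian T w +
            (c * a - (Complex.I * Complex.I) * (s * w h) : ℂ) • (v : E →L[ℂ] E) := by module
      rw [h9, Complex.I_mul_I, neg_one_mul, ← sub_eq_add_neg, hs', zero_smul, zero_add]
      congr 2
      push_cast
      ring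
    rw [← h7]
    simp only [Submonoid.coe_mul, star_mul, mul_assoc]

/-- Anticommuting operators span a euclidean space, in which any vector may be rotated to any
axis. -/
theorem exists_collapse_of_anticommute {M : Finset (unitary (E →L[ℂ] E))}
    {v : unitary (E →L[ℂ] E)} (hv : v ∈ M) (hsa : ∀ g ∈ M, IsSelfAdjoint (g : E →L[ℂ] E))
    (hc : ∀ g ∈ M, ∀ h ∈ M, g ≠ h → (g : E →L[ℂ] E) * h = -((h : E →L[ℂ] E) * g)) :
    ∃ d : CollapseData E, d.IsValid M v ∧ d.syms₁ = [] ∧ d.syms₂ = [] := by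
  classical
  choose u hu b hb using fun w : unitary (E →L[ℂ] E) → ℝ =>
    exists_rotate_anticommuting hv hsa hc (M.erase_subset v) (M.notMem_erase v) w (w v)
  refine ⟨⟨[], [], fun w _ => u w, fun w _ _ => b w⟩, ⟨by simp, by simp, by simp, by simp, by simp,
    by simp, by simp, fun w _ => hu w, fun w y₁ y₂ Q _ _ => ?_⟩, rfl, rfl⟩
  have h : hamiltonian M w = hamiltonian (M.erase v) w + (w v : ℂ) • (v : E →L[ℂ] E) :=
    (Finset.sum_erase_add M _ hv).symm
  dsimp only
  rw [h, hb, smul_mul_assoc]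

/-- The free-fermion collapse. In the first round the operators are identified, up to signs, with
Majorana bilinears; the rotation brings their linear combination to normal form; in the second
round the commuting bilinears of the normal form are identified with `v`, up to signs. -/
theorem exists_collapse_of_edgeSystem {V : Type*} [Fintype V] [LinearOrder V]
    {M : Finset (unitary (E →L[ℂ] E))} {v : unitary (E →L[ℂ] E)} (hv : v ∈ M) {e : M → V × V}
    (hg : IsEdgeSystem (edgeOp M) e) : ∃ d : CollapseData E, d.IsValid M v := by
  classical
  obtain ⟨X, Y, hX⟩ := exists_majoranaSystem hg
  have hedge : ∀ i : M, OddLink (edgeOp M) e (e i).1 (e i).2 := fun i => ⟨_, IsEdgeProd.edge i⟩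
  have hXe : ∀ i : M, IsEdgeProd (edgeOp M) e (X (e i).1 (e i).2) (pairBoundary (e i).1 (e i).2) 1 :=
    fun i => hX.isEdgeProd _ _ (hedge i) (hg.ne i)
  obtain ⟨P, hvP, hP, hdisj, hnf⟩ := exists_normalForm (F := Finset.univ)
    (isOddRelation_oddLink (g := edgeOp M) (e := e)) (Finset.mem_univ _) (Finset.mem_univ _)
    (hg.ne ⟨v, hv⟩) (hedge ⟨v, hv⟩)
  have hXP : ∀ p ∈ P, IsEdgeProd (edgeOp M) e (X p.1 p.2) (pairBoundary p.1 p.2) 1 := fun p hp =>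
    hX.isEdgeProd _ _ (hP p hp).2.2.2 (hP p hp).2.2.1
  have hpar : ∀ p ∈ P, ∀ q ∈ P, pairBoundary p.1 p.2 ⬝ᵥ pairBoundary q.1 q.2 = 0 := by
    intro p hp q hq
    by_cases h : p = q
    · subst h
      exact pairBoundary_dotProduct_self (hP p hp).2.2.1
    · obtain ⟨h1, h2, h3, h4⟩ := hdisj p hp q hq h
      simp [pairBoundary_dotProduct, h1, h2, h3, h4]
  have hcomm : ∀ {p p' : E →L[ℂ] E} {δ δ' : V → ZMod 2} {ε ε' : ZMod 2},
      IsEdgeProd (edgeOp M) e p δ ε → IsEdgeProd (edgeOp M) e p' δ' ε' → δ ⬝ᵥ δ' = 0 →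
      Commute p p' := fun h h' h0 => by
    rw [Commute, SemiconjBy, h.comm hg h', h0, paritySign_zero, one_smul]
  -- symmetries of the first round
  have hs₁ : ∀ i : M, IsEdgeProd (edgeOp M) e (edgeOp M i * X (e i).1 (e i).2) 0 0 := fun i => by
    have := (IsEdgeProd.edge (g := edgeOp M) (e := e) i).mul (hXe i)
    rwa [pairBoundary_add_self, CharTwo.add_self_eq_zero] at this
  let t₁ : M → unitary (E →L[ℂ] E) := fun i =>
    ⟨edgeOp M i * X (e i).1 (e i).2, (hs₁ i).mem_unitary hg⟩
  have ht₁ : ∀ i (b : unitary (E →L[ℂ] E)), b ∈ M → Commute (t₁ i) b := fun i b hb =>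
    commute_of_coe (hcomm (hs₁ i) (IsEdgeProd.edge (⟨b, hb⟩ : M)) (zero_dotProduct _))
  -- symmetries of the second round
  have hv1 := IsEdgeProd.edge (g := edgeOp M) (e := e) ⟨v, hv⟩
  have hs₂ : ∀ p : P, IsEdgeProd (edgeOp M) e (X p.1.1 p.1.2 * (v : E →L[ℂ] E))
      (pairBoundary p.1.1 p.1.2 + pairBoundary (e ⟨v, hv⟩).1 (e ⟨v, hv⟩).2) 0 := fun p => by
    have := (hXP p p.2).mul hv1
    rwa [CharTwo.add_self_eq_zero] at this
  let t₂ : P → unitary (E →L[ℂ] E) := fun p =>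
    ⟨X p.1.1 p.1.2 * (v : E →L[ℂ] E), (hs₂ p).mem_unitary hg⟩
  have hXsq : ∀ p ∈ P, X p.1 p.2 * X p.1 p.2 = 1 := fun p hp => by
    have := Unitary.star_mul_self_of_mem ((hXP p hp).mem_unitary hg)
    rwa [hX.selfAdjoint] at this
  obtain ⟨idx₁, hidx₁⟩ := exists_index (Finset.univ : Finset M).toList t₁
  obtain ⟨idx₂, hidx₂⟩ := exists_index (Finset.univ : Finset P).toList t₂
  -- the rotation to the normal form
  -- the weight of the pair is halved, since each edge enters the form at both `(a, b)` and `(b, a)`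
  let A : (unitary (E →L[ℂ] E) → ℝ) → (ℕ → ℤˣ) → Matrix V V ℝ := fun w y =>
    ∑ i : M, (w i * ((y (idx₁ i) : ℤ) : ℝ) / 2) • pairMatrix (e i)
  have hrot : ∀ (w : unitary (E →L[ℂ] E) → ℝ) (y : ℕ → ℤˣ), ∃ u ∈ rotationGroup M, ∃ τ : V × V → ℝ,
      (u : E →L[ℂ] E) * quadraticForm X (A w y) * star (u : E →L[ℂ] E) =
        ∑ p : P, ((τ p * 2 : ℝ) : ℂ) • X p.1.1 p.1.2 := by
    intro w y
    obtain ⟨O, hO, τ, hτ⟩ := hnf (A w y) (isOddMatrix_sum isOddRelation_oddLink _ _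
      fun i _ => hedge i)
    obtain ⟨u, hu, hu'⟩ := exists_rotation_of_mem_givensGroup hg hX hO
    refine ⟨u, hu, τ, ?_⟩
    rw [hu', hτ, quadraticForm_sum, ← Finset.sum_coe_sort]
    refine Finset.sum_congr rfl fun p _ => ?_
    rw [quadraticForm_pairMatrix hX.antisymm, smul_smul]
    push_cast
    rfl
  choose u hu τ hτ using hrot
  have hut : ∀ w y i, Commute (u w y) (t₁ i) := fun w y i =>
    commute_of_mem_rotationGroup (fun s hs => commute_of_coe (commute_evenProduct
      (fun g hg' g' hg'' => coe_commute ((ht₁ i g hg').mul_right (ht₁ i g' hg''))) hs)) (hu w y)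
  have hmem₁ : ∀ {C : unitary (E →L[ℂ] E) → Prop}, (∀ i, C (t₁ i)) →
      ∀ s ∈ (Finset.univ : Finset M).toList.map t₁, C s := by
    intro C hC s hs
    obtain ⟨i, -, rfl⟩ := List.mem_map.1 hs
    exact hC i
  have hmem₂ : ∀ {C : unitary (E →L[ℂ] E) → Prop}, (∀ p, C (t₂ p)) →
      ∀ s ∈ (Finset.univ : Finset P).toList.map t₂, C s := by
    intro C hC s hs
    obtain ⟨p, -, rfl⟩ := List.mem_map.1 hs
    exact hC p
  refine ⟨⟨(Finset.univ : Finset M).toList.map t₁, (Finset.univ : Finset P).toList.map t₂, u,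
    fun w y₁ y₂ => ∑ p : P, τ w y₁ p * 2 * ((y₂ (idx₂ p) : ℤ) : ℝ)⟩,
    hmem₁ fun i => ?_, hmem₁ fun i => IsEdgeProd.isEvenProduct (hs₁ i), hmem₁ ht₁,
    hmem₂ fun p => ?_, hmem₂ fun p => IsEdgeProd.isEvenProduct (hs₂ p),
    hmem₂ fun p => hmem₂ fun q => commute_of_coe (hcomm (hs₂ p) (hs₂ q) ?_),
    hmem₂ fun p => commute_of_coe (hcomm (hs₂ p) hv1 ?_), hu, fun w y₁ y₂ Q h₁ h₂ => ?_⟩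
  · have h := hcomm (IsEdgeProd.edge (g := edgeOp M) (e := e) i) (hXe i)
      (pairBoundary_dotProduct_self (hg.ne i))
    rw [isSelfAdjoint_iff]
    show star (edgeOp M i * X (e i).1 (e i).2) = edgeOp M i * X (e i).1 (e i).2
    rw [star_mul, hX.selfAdjoint, hg.selfAdjoint, h.eq]
  · have h := hcomm (hXP p p.2) hv1 (hpar p p.2 _ hvP)
    rw [isSelfAdjoint_iff]
    show star (X p.1.1 p.1.2 * (v : E →L[ℂ] E)) = X p.1.1 p.1.2 * (v : E →L[ℂ] E)
    rw [star_mul, hX.selfAdjoint, show star (v : E →L[ℂ] E) = v from hg.selfAdjoint ⟨v, hv⟩]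
    exact h.eq.symm
  · rw [add_dotProduct, dotProduct_add, dotProduct_add, hpar p p.2 q q.2, hpar p p.2 _ hvP,
      hpar _ hvP q q.2, hpar _ hvP _ hvP]
    rfl
  · rw [add_dotProduct, hpar p p.2 _ hvP, hpar _ hvP _ hvP]
    rfl
  -- the symmetries of the first round commute with the rotation, so they act on `u⋆ Q` as on `Q`
  · have hQ : hamiltonian M w * (star (u w y₁ : E →L[ℂ] E) * Q) =
        quadraticForm X (A w y₁) * (star (u w y₁ : E →L[ℂ] E) * Q) := by
      rw [quadraticForm_sum, hamiltonian, ← Finset.sum_coe_sort, Finset.sum_mul, Finset.sum_mul]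
      refine Finset.sum_congr rfl fun i _ => ?_
      obtain ⟨h3, h4⟩ := hidx₁ i (Finset.mem_toList.2 (Finset.mem_univ i))
      have h5 := h₁ _ h3
      rw [h4] at h5
      have h6 : edgeOp M i * X (e i).1 (e i).2 * (star (u w y₁ : E →L[ℂ] E) * Q) =
          ((y₁ (idx₁ i) : ℤ) : ℂ) • (star (u w y₁ : E →L[ℂ] E) * Q) := by
        have h7 : Commute (star (u w y₁ : E →L[ℂ] E)) (t₁ i : E →L[ℂ] E) :=
          coe_commute (hut w y₁ i).inv_left
        rw [← mul_smul_comm, ← h5, ← mul_assoc, ← mul_assoc, h7.eq]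
      rw [smul_mul_assoc, mul_eq_smul_of_mul_mul (hg.mul_self i) h6,
        quadraticForm_pairMatrix hX.antisymm, smul_smul, smul_smul, smul_mul_assoc]
      congr 1
      push_cast
      ring
    dsimp only
    rw [mul_assoc, mul_assoc, hQ, ← mul_assoc, ← mul_assoc, hτ, Finset.sum_mul, Complex.ofReal_sum,
      Finset.sum_smul]
    refine Finset.sum_congr rfl fun p _ => ?_
    obtain ⟨h3, h4⟩ := hidx₂ p (Finset.mem_toList.2 (Finset.mem_univ p))
    have h5 := h₂ _ h3
    rw [h4] at h5
    rw [smul_mul_assoc, mul_eq_smul_of_mul_mul (hXsq p p.2) h5, smul_smul]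
    congr 1
    push_cast
    rfl

/-! ### Collapsible sets of the frustration graph -/

variable {A M : Finset (unitary (E →L[ℂ] E))}

/-- The operators in `A` are hermitian, and any two of them commute or anticommute. -/
structure IsFrustrated (A : Finset (unitary (E →L[ℂ] E))) : Prop where
  selfAdjoint : ∀ g ∈ A, IsSelfAdjoint (g : E →L[ℂ] E)
  anticomm : ∀ g ∈ A, ∀ h ∈ A, (frustrationGraph E).Adj g h →
    (g : E →L[ℂ] E) * h = -((h : E →L[ℂ] E) * g)
  comm : ∀ g ∈ A, ∀ h ∈ A, ¬ (frustrationGraph E).Adj g h → Commute g h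

theorem IsFrustrated.mono (hA : IsFrustrated A) (h : M ⊆ A) : IsFrustrated M :=
  ⟨fun g hg => hA.selfAdjoint g (h hg), fun g hg g' hg' => hA.anticomm g (h hg) g' (h hg'),
    fun g hg g' hg' => hA.comm g (h hg) g' (h hg')⟩

theorem isFrustrated_of_commutator {S : Subgroup (unitary (E →L[ℂ] E))}
    (hS : ∀ g ∈ S, ∀ h ∈ S, g * h * g⁻¹ * h⁻¹ = 1 ∨ g * h * g⁻¹ * h⁻¹ = -1)
    (hAS : ∀ g ∈ A, g ∈ S) (hA : ∀ g ∈ A, IsSelfAdjoint (g : E →L[ℂ] E)) : IsFrustrated A := by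
  refine ⟨hA, fun g _ h _ hgh => ?_, fun g hg h hh hgh => ?_⟩
  · have h1 : g * h = -1 * (h * g) := by
      rw [← hgh.2]
      group
    calc (g : E →L[ℂ] E) * h = -1 * ((h : E →L[ℂ] E) * g) := congrArg Subtype.val h1
      _ = _ := neg_one_mul _
  · rcases hS g (hAS g hg) h (hAS h hh) with h1 | h1
    · exact commutatorElement_eq_one_iff_commute.1 h1
    -- only possible for `E = 0`
    · have h2 : g = h := not_not.1 fun h2 => hgh ⟨h2, h1⟩
      rw [h2]

theorem Collapsible.subset {α : Type*} {G : SimpleGraph α} {A M : Finset α}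
    (h : Collapsible G A M) : M ⊆ A := by
  rcases h with h | h | h
  · exact h.1
  · exact h.1
  · exact h.1.1

theorem Collapsible.isModule {α : Type*} {G : SimpleGraph α} {A M : Finset α}
    (h : Collapsible G A M) : IsModule G A M := by
  rcases h with h | h | h
  · refine ⟨h.1, fun y hy _ ⟨x, hx, hxy⟩ x' hx' => (h.2 x hx x' hx' y hy).1 hxy⟩
  · refine ⟨h.1, fun y hy hyM ⟨x, hx, hxy⟩ x' hx' => ?_⟩
    rcases (h.2 x hx x' hx' y hy).1 (Or.inr hxy) with rfl | h
    · exact absurd hx' hyM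
    · exact h
  · exact h.1

theorem FalseSiblings.not_adj {α : Type*} {G : SimpleGraph α} {A M : Finset α}
    (h : FalseSiblings G A M) {x y : α} (hx : x ∈ M) (hy : y ∈ M) : ¬ G.Adj x y := fun hxy =>
  G.irrefl ((h.2 x hx y hy y (h.1 hy)).1 hxy)

theorem TrueSiblings.adj {α : Type*} {G : SimpleGraph α} {A M : Finset α}
    (h : TrueSiblings G A M) {x y : α} (hx : x ∈ M) (hy : y ∈ M) (hxy : x ≠ y) : G.Adj x y := by
  rcases (h.2 y hy x hx y (h.1 hy)).1 (Or.inl rfl) with h | h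
  · exact absurd h.symm hxy
  · exact h

/-- An operator outside a module commutes with all operators of the module or anticommutes with all
of them; an even number of signs cancels. -/
theorem IsModule.commute_evenProduct (hA : IsFrustrated A)
    (hM : IsModule (frustrationGraph E) A M) {b : unitary (E →L[ℂ] E)} (hb : b ∈ A) (hbM : b ∉ M)
    {s : unitary (E →L[ℂ] E)} (hs : IsEvenProduct M s) : Commute b s := by
  refine commute_of_coe (TwinCollapse.commute_evenProduct (fun g hg g' hg' => ?_) hs)
  by_cases h : ∃ x ∈ M, (frustrationGraph E).Adj x b
  · have h1 : ∀ x ∈ M, (b : E →L[ℂ] E) * x = -((x : E →L[ℂ] E) * b) := fun x hx =>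
      hA.anticomm b hb x (hM.1 hx) (hM.2 b hb hbM h x hx).symm
    rw [Commute, SemiconjBy, ← mul_assoc, h1 g hg, neg_mul, mul_assoc, h1 g' hg', mul_neg, neg_neg,
      mul_assoc]
  · have h1 : ∀ x ∈ M, Commute (b : E →L[ℂ] E) (x : E →L[ℂ] E) := fun x hx =>
      coe_commute (hA.comm b hb x (hM.1 hx) fun h' => h ⟨x, hx, h'.symm⟩)
    exact (h1 g hg).mul_right (h1 g' hg')

/-- The vertices of a line graph, seen as the edges of its root graph. -/
theorem exists_isEdgeSystem (hM : IsFrustrated M)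
    (h : IsLineGraph ((frustrationGraph E).induce (M : Set (unitary (E →L[ℂ] E))))) :
    ∃ (n : ℕ) (e : M → Fin n × Fin n), IsEdgeSystem (edgeOp M) e := by
  obtain ⟨n, R, ⟨φ⟩⟩ := h
  let e : M → Fin n × Fin n := fun i => Quot.out (φ ⟨i, Finset.mem_coe.2 i.2⟩ : Sym2 (Fin n))
  have he : ∀ i : M, s((e i).1, (e i).2) = (φ ⟨i, Finset.mem_coe.2 i.2⟩ : Sym2 (Fin n)) :=
    fun i => Quot.out_eq _
  have hne : ∀ i, (e i).1 ≠ (e i).2 := fun i => by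
    have h1 := (φ ⟨i, Finset.mem_coe.2 i.2⟩).2
    rw [← he] at h1
    exact R.ne_of_adj h1
  refine ⟨n, e, fun i => (hM.selfAdjoint i i.2).star_eq,
    fun i => mul_self_of_isSelfAdjoint (hM.selfAdjoint i i.2), hne, fun i j => ?_⟩
  by_cases hij : i = j
  · subst hij
    rw [pairBoundary_dotProduct_self (hne i), paritySign_zero, one_smul]
  have hφ : φ ⟨i, Finset.mem_coe.2 i.2⟩ ≠ φ ⟨j, Finset.mem_coe.2 j.2⟩ := fun h =>
    hij (Subtype.ext (congrArg (fun z => z.1) (φ.injective h)))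
  have hadj : (frustrationGraph E).Adj i j ↔
      ∃ z, z ∈ s((e i).1, (e i).2) ∧ z ∈ s((e j).1, (e j).2) := by
    have h1 : (frustrationGraph E).Adj i j ↔ R.lineGraph.Adj (φ ⟨i, Finset.mem_coe.2 i.2⟩)
        (φ ⟨j, Finset.mem_coe.2 j.2⟩) := φ.map_adj_iff.symm
    rw [h1, SimpleGraph.lineGraph_adj_iff_exists, he, he]
    exact and_iff_right hφ
  have hdiff : s((e i).1, (e i).2) ≠ s((e j).1, (e j).2) := by
    rw [he, he]
    exact fun h => hφ (Subtype.ext h)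
  rw [pairBoundary_dotProduct_of_ne (hne i) (hne j) hdiff]
  split_ifs with h
  · rw [paritySign_one, neg_smul, one_smul]
    exact hM.anticomm i i.2 j j.2 (hadj.2 h)
  · rw [paritySign_zero, one_smul]
    exact coe_commute (hM.comm i i.2 j j.2 fun h' => h (hadj.1 h'))

/-- Every collapsible set can be collapsed: false siblings without rotations, and true siblings
without projections. -/
theorem exists_collapse (hA : IsFrustrated A) (h : Collapsible (frustrationGraph E) A M)
    {v : unitary (E →L[ℂ] E)} (hv : v ∈ M) :
    ∃ d : CollapseData E, d.IsValid M v ∧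
      (FalseSiblings (frustrationGraph E) A M → ∀ w y, d.rot w y = 1) ∧
      (TrueSiblings (frustrationGraph E) A M → d.syms₁ = [] ∧ d.syms₂ = []) := by
  have hM := hA.mono h.subset
  by_cases h1 : ∀ x ∈ M, x = v
  · obtain rfl : M = {v} := Finset.eq_singleton_iff_unique_mem.2 ⟨hv, h1⟩
    obtain ⟨d, hd, hd', hd''⟩ := exists_collapse_singleton v
    exact ⟨d, hd, fun _ => hd', fun _ => hd''⟩
  -- otherwise the vertices cannot be false and true siblings at the same time
  push Not at h1
  obtain ⟨x, hx, hxv⟩ := h1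
  by_cases hF : FalseSiblings (frustrationGraph E) A M
  · obtain ⟨d, hd, hd'⟩ := exists_collapse_of_commute hv hM.selfAdjoint
      fun g hg g' hg' => hM.comm g hg g' hg' (hF.not_adj hg hg')
    exact ⟨d, hd, fun _ => hd', fun hT => absurd (hT.adj hx hv hxv) (hF.not_adj hx hv)⟩
  by_cases hT : TrueSiblings (frustrationGraph E) A M
  · obtain ⟨d, hd, hd'⟩ := exists_collapse_of_anticommute hv hM.selfAdjoint
      fun g hg g' hg' hgg' => hM.anticomm g hg g' hg' (hT.adj hg hg' hgg')
    exact ⟨d, hd, fun h' => absurd h' hF, fun _ => hd'⟩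
  · obtain ⟨n, e, he⟩ := exists_isEdgeSystem hM ((h.resolve_left hF).resolve_left hT).2
    obtain ⟨d, hd⟩ := exists_collapse_of_edgeSystem hv he
    exact ⟨d, hd, fun h' => absurd h' hF, fun h' => absurd h' hT⟩

end Collapse

/-! ### Recursive collapse -/

section Existence

variable {α : Type*} {G : SimpleGraph α}

theorem IsCollapseSequence.step_subset {V : Finset α} {c : ℕ} {A M : ℕ → Finset α} {v : ℕ → α}
    (h : IsCollapseSequence G V c A M v) {i : ℕ} (hi : i < c) : A (i + 1) ⊆ A i := by
  classical
  rw [h.step i hi]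
  have := (h.collapsible i hi).subset
  intro g hg
  rcases Finset.mem_insert.1 hg with rfl | hg
  · exact this (h.mem i hi)
  · exact (Finset.mem_sdiff.1 hg).1

theorem IsCollapseSequence.subset {V : Finset α} {c : ℕ} {A M : ℕ → Finset α} {v : ℕ → α}
    (h : IsCollapseSequence G V c A M v) {i j : ℕ} (hij : i ≤ j) (hj : j ≤ c) : A j ⊆ A i := by
  induction j, hij using Nat.le_induction with
  | base => exact subset_rfl
  | succ j _ ih => exact (h.step_subset hj).trans (ih (by omega))

/-- Each collapse of a set of more than one vertex makes the graph smaller. -/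
theorem exists_complete_collapse [Nonempty α] (G : SimpleGraph α) (V : Finset α) :
    ∃ (c : ℕ) (A M : ℕ → Finset α) (v : ℕ → α),
      IsCollapseSequence G V c A M v ∧ FullyCollapsed G (A c) := by
  classical
  induction hn : V.card using Nat.strong_induction_on generalizing V with
  | _ n ih =>
    by_cases hV : FullyCollapsed G V
    · exact ⟨0, fun _ => V, fun _ => ∅, fun _ => Classical.arbitrary α,
        ⟨rfl, by simp, by simp, by simp⟩, hV⟩
    · obtain ⟨M, hM, hcard⟩ : ∃ M, Collapsible G V M ∧ 1 < M.card := by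
        simpa [FullyCollapsed] using hV
      obtain ⟨v, hv⟩ : M.Nonempty := Finset.card_pos.1 (by omega)
      have hlt : (insert v (V \ M)).card < n := by
        have h1 := Finset.card_insert_le v (V \ M)
        have h2 := Finset.card_sdiff_add_card_eq_card hM.subset
        omega
      obtain ⟨c, A, M', v', h, hc⟩ := ih _ hlt _ rfl
      refine ⟨c + 1, fun i => Nat.casesOn i V A, fun i => Nat.casesOn i M M',
        fun i => Nat.casesOn i v v', ⟨rfl, ?_, ?_, ?_⟩, hc⟩
      · rintro (_ | i) hi
        · exact hM
        · exact h.collapsible i (by omega)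
      · rintro (_ | i) hi
        · exact hv
        · exact h.mem i (by omega)
      · rintro (_ | i) hi
        · exact h.start
        · exact h.step i (by omega)

end Existence

/-! ### Realisation of a collapse sequence by a scheme -/

section Assembly

variable {E : Type*} [NormedAddCommGroup E] [InnerProductSpace ℂ E] [CompleteSpace E]

/-- The symmetries of the round `k`, where the rounds `2 * i` and `2 * i + 1` belong to step `i`. -/
def roundSyms (d : ℕ → CollapseData E) (k : ℕ) : List (unitary (E →L[ℂ] E)) :=
  if k % 2 = 0 then (d (k / 2)).syms₁ else (d (k / 2)).syms₂

theorem roundSyms_even (d : ℕ → CollapseData E) (i : ℕ) : roundSyms d (2 * i) = (d i).syms₁ := by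
  rw [roundSyms, if_pos (by omega), show 2 * i / 2 = i by omega]

theorem roundSyms_odd (d : ℕ → CollapseData E) (i : ℕ) : roundSyms d (2 * i + 1) = (d i).syms₂ := by
  rw [roundSyms, if_neg (by omega), show (2 * i + 1) / 2 = i by omega]

/-- The sign `x k j`, extended by `1` to all natural numbers `k` and `j`. -/
def signAt {r : ℕ} {m : Fin r → ℕ} (x : (k : Fin r) → Fin (m k) → ℤˣ) (k j : ℕ) : ℤˣ :=
  if h : k < r then if h' : j < m ⟨k, h⟩ then x ⟨k, h⟩ ⟨j, h'⟩ else 1 else 1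

theorem signAt_congr {r : ℕ} {m : Fin r → ℕ} {x y : (k : Fin r) → Fin (m k) → ℤˣ} {k : ℕ}
    (h : ∀ l : Fin r, (l : ℕ) = k → x l = y l) : signAt x k = signAt y k := by
  funext j
  unfold signAt
  split_ifs with h1
  · rw [h ⟨k, h1⟩ rfl]
  · rfl
  · rfl

open Classical in
/-- The weights before step `i`, for the signs `σ`. -/
noncomputable def stageWeight (d : ℕ → CollapseData E) (v : ℕ → unitary (E →L[ℂ] E))
    (w₀ : unitary (E →L[ℂ] E) → ℝ) (σ : ℕ → ℕ → ℤˣ) : ℕ → unitary (E →L[ℂ] E) → ℝ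
  | 0 => w₀
  | i + 1 => Function.update (stageWeight d v w₀ σ i) (v i)
      ((d i).weight (stageWeight d v w₀ σ i) (σ (2 * i)) (σ (2 * i + 1)))

theorem stageWeight_congr (d : ℕ → CollapseData E) (v : ℕ → unitary (E →L[ℂ] E))
    (w₀ : unitary (E →L[ℂ] E) → ℝ) {σ σ' : ℕ → ℕ → ℤˣ} {i : ℕ} (h : ∀ k < 2 * i, σ k = σ' k) :
    stageWeight d v w₀ σ i = stageWeight d v w₀ σ' i := by
  induction i with
  | zero => rfl
  | succ i ih =>
    rw [stageWeight, stageWeight, ih fun k hk => h k (by omega), h (2 * i) (by omega),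
      h (2 * i + 1) (by omega)]

/-- The scheme that carries out the collapses `d 0`, ..., `d (c - 1)`. -/
noncomputable abbrev collapseScheme (d : ℕ → CollapseData E) (v : ℕ → unitary (E →L[ℂ] E))
    (w₀ : unitary (E →L[ℂ] E) → ℝ) (c : ℕ) : Scheme E (2 * c) where
  m k := (roundSyms d k).length
  sym k j := (roundSyms d k)[j]
  rot k x := if (k : ℕ) % 2 = 0 then
    (d (k / 2)).rot (stageWeight d v w₀ (signAt x) (k / 2)) (signAt x k) else 1

theorem hamiltonian_isSelfAdjoint {A : Finset (unitary (E →L[ℂ] E))}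
    (hA : ∀ g ∈ A, IsSelfAdjoint (g : E →L[ℂ] E)) (w : unitary (E →L[ℂ] E) → ℝ) :
    IsSelfAdjoint (hamiltonian A w) := by
  rw [isSelfAdjoint_iff, hamiltonian, star_sum]
  refine Finset.sum_congr rfl fun g hg => ?_
  rw [star_smul, (hA g hg).star_eq]
  simp

theorem commute_hamiltonian {A : Finset (unitary (E →L[ℂ] E))} {b : unitary (E →L[ℂ] E)}
    (h : ∀ g ∈ A, Commute b g) (w : unitary (E →L[ℂ] E) → ℝ) :
    Commute (b : E →L[ℂ] E) (hamiltonian A w) :=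
  Commute.sum_right _ _ _ fun g hg => (coe_commute (h g hg)).smul_right _

variable {V : Finset (unitary (E →L[ℂ] E))} {c : ℕ} {A M : ℕ → Finset (unitary (E →L[ℂ] E))}
  {v : ℕ → unitary (E →L[ℂ] E)} {d : ℕ → CollapseData E} {w₀ : unitary (E →L[ℂ] E) → ℝ}

/-- The steps of a collapse sequence of pairwise commuting or anticommuting hermitian operators,
together with valid data for each of them. -/
structure IsCollapse (V : Finset (unitary (E →L[ℂ] E))) (c : ℕ)
    (A M : ℕ → Finset (unitary (E →L[ℂ] E))) (v : ℕ → unitary (E →L[ℂ] E))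
    (d : ℕ → CollapseData E) : Prop where
  frustrated : IsFrustrated V
  sequence : IsCollapseSequence (frustrationGraph E) V c A M v
  isValid : ∀ i < c, (d i).IsValid (M i) (v i)

namespace IsCollapse

variable (h : IsCollapse V c A M v d)
include h

theorem frustrated_stage {i : ℕ} (hi : i ≤ c) : IsFrustrated (A i) :=
  h.frustrated.mono (h.sequence.start ▸ h.sequence.subset (Nat.zero_le i) hi)

theorem isModule {i : ℕ} (hi : i < c) : IsModule (frustrationGraph E) (A i) (M i) :=
  (h.sequence.collapsible i hi).isModule

theorem mem_stage_succ {i : ℕ} (hi : i < c) {g : unitary (E →L[ℂ] E)} :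
    g ∈ A (i + 1) ↔ g = v i ∨ (g ∈ A i ∧ g ∉ M i) := by
  rw [h.sequence.step i hi]
  simp

theorem evenProduct_comm_outside {i : ℕ} (hi : i < c) {s g : unitary (E →L[ℂ] E)}
    (hs : IsEvenProduct (M i) s) (hg : g ∈ A i) (hgM : g ∉ M i) : Commute s g :=
  ((h.isModule hi).commute_evenProduct (h.frustrated_stage hi.le) hg hgM hs).symm

theorem rotation_comm_outside {i : ℕ} (hi : i < c) {u g : unitary (E →L[ℂ] E)}
    (hu : u ∈ rotationGroup (M i)) (hg : g ∈ A i) (hgM : g ∉ M i) : Commute u g :=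
  commute_of_mem_rotationGroup (fun _ hs => (h.evenProduct_comm_outside hi hs hg hgM).symm) hu

theorem evenProduct_of_mem {k : ℕ} (hk : k < 2 * c) {s : unitary (E →L[ℂ] E)}
    (hs : s ∈ roundSyms d k) : IsEvenProduct (M (k / 2)) s := by
  have hv := h.isValid (k / 2) (by omega)
  rw [roundSyms] at hs
  split_ifs at hs
  · exact hv.even₁ s hs
  · exact hv.even₂ s hs

theorem selfAdjoint_of_mem {k : ℕ} (hk : k < 2 * c) {s : unitary (E →L[ℂ] E)}
    (hs : s ∈ roundSyms d k) : IsSelfAdjoint (s : E →L[ℂ] E) := by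
  have hv := h.isValid (k / 2) (by omega)
  rw [roundSyms] at hs
  split_ifs at hs
  · exact hv.selfAdjoint₁ s hs
  · exact hv.selfAdjoint₂ s hs

/-- The symmetries up to the round `2 * i` commute with all operators left before step `i`; those
of the round `2 * i + 1` do so only after the step. -/
theorem sym_comm_stage {k i : ℕ} (hki : k ≤ 2 * i) (hk : k < 2 * c) (hi : i ≤ c)
    {s g : unitary (E →L[ℂ] E)} (hs : s ∈ roundSyms d k) (hg : g ∈ A i) : Commute s g := by
  have hv := h.isValid (k / 2) (by omega)
  have hev := h.evenProduct_of_mem hk hs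
  by_cases hgM : g ∈ A (k / 2) ∧ g ∉ M (k / 2)
  · exact h.evenProduct_comm_outside (by omega) hev hgM.1 hgM.2
  rw [roundSyms] at hs
  split_ifs at hs with hpar
  · refine hv.comm₁ s hs g ?_
    by_contra hgM'
    exact hgM ⟨h.sequence.subset (by omega) hi hg, hgM'⟩
  · have h1 := h.sequence.subset (i := k / 2 + 1) (by omega) hi hg
    rw [h.mem_stage_succ (by omega), or_iff_left hgM] at h1
    rw [h1]
    exact hv.comm_left₂ s hs

theorem sym_comm_evenProduct {k i : ℕ} (hki : k ≤ 2 * i) (hi : i < c)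
    {s p : unitary (E →L[ℂ] E)} (hs : s ∈ roundSyms d k) (hp : IsEvenProduct (M i) p) :
    Commute s p :=
  have hM := (h.isModule hi).1
  commute_of_coe (commute_evenProduct (fun _ hg _ hg' => coe_commute
    ((h.sym_comm_stage hki (by omega) hi.le hs (hM hg)).mul_right
      (h.sym_comm_stage hki (by omega) hi.le hs (hM hg')))) hp)

theorem sym_comm_of_le {k l : ℕ} (hkl : k ≤ l) (hl : l < 2 * c) {s s' : unitary (E →L[ℂ] E)}
    (hs : s ∈ roundSyms d k) (hs' : s' ∈ roundSyms d l) : Commute s s' := by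
  by_cases hk : k ≤ 2 * (l / 2)
  · exact h.sym_comm_evenProduct hk (by omega) hs (h.evenProduct_of_mem hl hs')
  · obtain rfl : k = l := by omega
    have h1 : k = 2 * (k / 2) + 1 := by omega
    rw [h1, roundSyms_odd] at hs hs'
    exact (h.isValid (k / 2) (by omega)).comm₂ s hs s' hs'

theorem rot_mem (k : Fin (2 * c)) (x : (collapseScheme d v w₀ c).Param) :
    (collapseScheme d v w₀ c).rot k x ∈ rotationGroup (M (k / 2)) := by
  have hk := k.2
  show (if (k : ℕ) % 2 = 0 then _ else 1) ∈ _
  split_ifs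
  · exact (h.isValid (k / 2) (by omega)).rot_mem _ _
  · exact one_mem _

theorem isCoherent : (collapseScheme d v w₀ c).IsCoherent where
  sym_selfAdjoint k j := h.selfAdjoint_of_mem k.2 (List.getElem_mem _)
  sym_comm k j l j' := by
    rcases le_total (k : ℕ) l with hkl | hkl
    · exact h.sym_comm_of_le hkl l.2 (List.getElem_mem _) (List.getElem_mem _)
    · exact (h.sym_comm_of_le hkl k.2 (List.getElem_mem _) (List.getElem_mem _)).symm
  rot_congr k x y hxy := by
    have h1 : ∀ l ≤ (k : ℕ), signAt x l = signAt y l := fun l hl =>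
      signAt_congr fun l' hl' => hxy l' (Fin.le_def.2 (by omega))
    show (if (k : ℕ) % 2 = 0 then _ else 1) = (if (k : ℕ) % 2 = 0 then _ else 1)
    rw [h1 k le_rfl, stageWeight_congr d v w₀ (σ := signAt x) (σ' := signAt y)
      fun l hl => h1 l (by omega)]
  rot_comm_sym l k hlk x j := by
    have hk := k.2
    have hlk' : (l : ℕ) ≤ k := hlk
    by_cases hpar : (k : ℕ) % 2 = 0
    · exact commute_of_mem_rotationGroup (fun s hs => h.sym_comm_evenProduct (k := l) (by omega)
        (by omega) (List.getElem_mem _) hs) (h.rot_mem k x)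
    · have h1 : (collapseScheme d v w₀ c).rot k x = 1 := if_neg hpar
      rw [h1]
      exact Commute.one_left _

theorem isJointEigen {k n : ℕ} (hk : k < n) (hn : n ≤ 2 * c)
    (x : (collapseScheme d v w₀ c).Param) :
    IsJointEigen (roundSyms d k) (signAt x k) ((collapseScheme d v w₀ c).projBefore n x) := by
  intro j hj
  have h1 : signAt x k j = x ⟨k, by omega⟩ ⟨j, hj⟩ := by
    rw [signAt, dif_pos (by omega), dif_pos hj]
  rw [h1]
  exact h.isCoherent.sym_mul_projBefore hn x ⟨k, by omega⟩ hk ⟨j, hj⟩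

theorem rot_commute_projBefore {i : ℕ} (hi : i < c) {n : ℕ} (hn : n ≤ 2 * i + 1)
    (x : (collapseScheme d v w₀ c).Param) :
    Commute ((collapseScheme d v w₀ c).rot ⟨2 * i, by omega⟩ x : E →L[ℂ] E)
      ((collapseScheme d v w₀ c).projBefore n x) :=
  Scheme.IsCoherent.commute_projBefore (by omega) (fun l hl j =>
    coe_commute (h.isCoherent.rot_comm_sym l ⟨2 * i, by omega⟩ (Fin.le_def.2 (by simp; omega)) x j)) x

theorem stage_hamiltonian_commute {i : ℕ} (hi : i ≤ c) {n : ℕ} (hn : n ≤ 2 * i + 1) (hn' : n ≤ 2 * c)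
    (x : (collapseScheme d v w₀ c).Param) (w : unitary (E →L[ℂ] E) → ℝ) :
    Commute (hamiltonian (A i) w) ((collapseScheme d v w₀ c).projBefore n x) :=
  Scheme.IsCoherent.commute_projBefore hn' (fun l hl _ =>
    (commute_hamiltonian (fun _ hg => h.sym_comm_stage (k := l) (by omega) l.2 hi
      (List.getElem_mem _) hg) w).symm) x

/-- The situation between the two rounds of a step, if the stage before the step is known. -/
theorem half_stage {i : ℕ} (hi : i < c) {H K : E →L[ℂ] E} (x : (collapseScheme d v w₀ c).Param)
    (hK : ((collapseScheme d v w₀ c).rotBefore (2 * i) x : E →L[ℂ] E) * H *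
        star ((collapseScheme d v w₀ c).rotBefore (2 * i) x : E →L[ℂ] E) *
        (collapseScheme d v w₀ c).projBefore (2 * i) x =
      K * (collapseScheme d v w₀ c).projBefore (2 * i) x) :
    ((collapseScheme d v w₀ c).rotBefore (2 * i + 1) x : E →L[ℂ] E) * H *
        star ((collapseScheme d v w₀ c).rotBefore (2 * i + 1) x : E →L[ℂ] E) *
        (collapseScheme d v w₀ c).projBefore (2 * i + 1) x =
      ((collapseScheme d v w₀ c).rot ⟨2 * i, by omega⟩ x : E →L[ℂ] E) * K *
        star ((collapseScheme d v w₀ c).rot ⟨2 * i, by omega⟩ x : E →L[ℂ] E) *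
        (collapseScheme d v w₀ c).projBefore (2 * i + 1) x := by
  have hu := h.rot_commute_projBefore (w₀ := w₀) hi le_rfl x
  have hr := Scheme.rotBefore_succ (D := collapseScheme d v w₀ c) ⟨2 * i, by omega⟩ x
  have hp := Scheme.projBefore_succ (D := collapseScheme d v w₀ c) ⟨2 * i, by omega⟩ x
  dsimp only at hr hp
  have hu' : star ((collapseScheme d v w₀ c).rot ⟨2 * i, by omega⟩ x : E →L[ℂ] E) *
      (collapseScheme d v w₀ c).projBefore (2 * i + 1) x =
      (collapseScheme d v w₀ c).projBefore (2 * i + 1) x *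
        star ((collapseScheme d v w₀ c).rot ⟨2 * i, by omega⟩ x : E →L[ℂ] E) := by
    have h1 := congrArg star hu.eq
    rw [star_mul, star_mul,
      (h.isCoherent.projBefore_isStarProjection (by omega) x).isSelfAdjoint.star_eq] at h1
    exact h1.symm
  rw [hr, Submonoid.coe_mul, star_mul]
  set u : E →L[ℂ] E := ((collapseScheme d v w₀ c).rot ⟨2 * i, by omega⟩ x : E →L[ℂ] E)
  set R : E →L[ℂ] E := ((collapseScheme d v w₀ c).rotBefore (2 * i) x : E →L[ℂ] E)
  set Q := (collapseScheme d v w₀ c).projBefore (2 * i + 1) x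
  have hKQ : R * H * star R * Q = K * Q := by
    rw [hp, ← mul_assoc, hK, mul_assoc]
  calc u * R * H * (star R * star u) * Q = u * (R * H * star R * (star u * Q)) := by
        simp only [mul_assoc]
    _ = u * (R * H * star R * Q) * star u := by rw [hu']; simp only [mul_assoc]
    _ = u * K * (Q * star u) := by rw [hKQ]; simp only [mul_assoc]
    _ = u * K * star u * Q := by rw [← hu']; simp only [mul_assoc]

/-- The operators outside the module commute with the rotation and keep their weights; those of the
module are collapsed to one operator on the joint eigenspaces of the symmetries of both rounds. -/
theorem stage (x : (collapseScheme d v w₀ c).Param) {i : ℕ} (hi : i ≤ c) :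
    ((collapseScheme d v w₀ c).rotBefore (2 * i) x : E →L[ℂ] E) * hamiltonian V w₀ *
        star ((collapseScheme d v w₀ c).rotBefore (2 * i) x : E →L[ℂ] E) *
        (collapseScheme d v w₀ c).projBefore (2 * i) x =
      hamiltonian (A i) (stageWeight d v w₀ (signAt x) i) *
        (collapseScheme d v w₀ c).projBefore (2 * i) x := by
  classical
  induction i with
  | zero =>
    rw [Nat.mul_zero, Scheme.rotBefore_zero, Scheme.projBefore_zero, h.sequence.start]
    simp [stageWeight]
  | succ i ih =>
    have hi' : i < c := hi
    have h1 := h.half_stage hi' x (ih hi'.le)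
    have hr := Scheme.rotBefore_succ (D := collapseScheme d v w₀ c) ⟨2 * i + 1, by omega⟩ x
    have hp := Scheme.projBefore_succ (D := collapseScheme d v w₀ c) ⟨2 * i + 1, by omega⟩ x
    have hrot : (collapseScheme d v w₀ c).rot ⟨2 * i + 1, by omega⟩ x = 1 :=
      if_neg (show ¬ (2 * i + 1) % 2 = 0 by omega)
    have hrot' : (collapseScheme d v w₀ c).rot ⟨2 * i, by omega⟩ x =
        (d i).rot (stageWeight d v w₀ (signAt x) i) (signAt x (2 * i)) := by
      show (if (2 * i) % 2 = 0 then _ else 1) = _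
      rw [if_pos (by omega)]
      dsimp only
      rw [show 2 * i / 2 = i by omega]
    rw [hrot, one_mul] at hr
    dsimp only at hr hp
    have he₁ := h.isJointEigen (w₀ := w₀) (k := 2 * i) (n := 2 * i + 2) (by omega) (by omega) x
    have he₂ := h.isJointEigen (w₀ := w₀) (k := 2 * i + 1) (n := 2 * i + 2) (by omega) (by omega) x
    rw [roundSyms_even] at he₁
    rw [roundSyms_odd] at he₂
    have hcol := (h.isValid i hi').collapse (stageWeight d v w₀ (signAt x) i) _ _ _ he₁ he₂
    rw [hrot'] at h1
    have hout := commute_hamiltonian (A := A i \ M i) (fun g hg => h.rotation_comm_outside hi'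
      ((h.isValid i hi').rot_mem (stageWeight d v w₀ (signAt x) i) (signAt x (2 * i)))
      (Finset.mem_sdiff.1 hg).1 (Finset.mem_sdiff.1 hg).2) (stageWeight d v w₀ (signAt x) i)
    show ((collapseScheme d v w₀ c).rotBefore (2 * i + 1 + 1) x : E →L[ℂ] E) * hamiltonian V w₀ *
        star ((collapseScheme d v w₀ c).rotBefore (2 * i + 1 + 1) x : E →L[ℂ] E) *
        (collapseScheme d v w₀ c).projBefore (2 * i + 1 + 1) x = _ *
        (collapseScheme d v w₀ c).projBefore (2 * i + 1 + 1) x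
    rw [hr]
    set u := (d i).rot (stageWeight d v w₀ (signAt x) i) (signAt x (2 * i))
    set Q := (collapseScheme d v w₀ c).projBefore (2 * i + 1 + 1) x
    set W := stageWeight d v w₀ (signAt x) i with hW
    have h2 : ((collapseScheme d v w₀ c).rotBefore (2 * i + 1) x : E →L[ℂ] E) * hamiltonian V w₀ *
        star ((collapseScheme d v w₀ c).rotBefore (2 * i + 1) x : E →L[ℂ] E) * Q =
        (u : E →L[ℂ] E) * hamiltonian (A i) W * star (u : E →L[ℂ] E) * Q := by
      rw [hp, ← mul_assoc, h1, mul_assoc]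
    rw [h2]
    have huu : (u : E →L[ℂ] E) * star (u : E →L[ℂ] E) = 1 := by simp
    have h3 : hamiltonian (A i) W = hamiltonian (A i \ M i) W + hamiltonian (M i) W :=
      (Finset.sum_sdiff (h.isModule hi').1).symm
    have hvM := h.sequence.mem i hi'
    have h4 : hamiltonian (A (i + 1)) (stageWeight d v w₀ (signAt x) (i + 1)) =
        ((d i).weight W (signAt x (2 * i)) (signAt x (2 * i + 1)) : ℂ) • (v i : E →L[ℂ] E) +
          hamiltonian (A i \ M i) W := by
      have hB : A (i + 1) = insert (v i) (A i \ M i) := by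
        ext g
        rw [h.mem_stage_succ hi', Finset.mem_insert, Finset.mem_sdiff]
      rw [hB, hamiltonian, Finset.sum_insert
        (fun hv => (Finset.mem_sdiff.1 hv).2 hvM), stageWeight, Function.update_self]
      congr 1
      refine Finset.sum_congr rfl fun g hg => ?_
      rw [Function.update_of_ne (by rintro rfl; exact (Finset.mem_sdiff.1 hg).2 hvM)]
    rw [h3, h4, mul_add, add_mul, add_mul, add_mul, hout.eq, mul_assoc (hamiltonian (A i \ M i) W), huu,
      mul_one, hcol, smul_mul_assoc, add_comm]

end IsCollapse

end Assembly

section CarriesOut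

variable {E : Type*} [NormedAddCommGroup E] [InnerProductSpace ℂ E] [CompleteSpace E]
  {V : Finset (unitary (E →L[ℂ] E))} {c : ℕ} {A M : ℕ → Finset (unitary (E →L[ℂ] E))}
  {v : ℕ → unitary (E →L[ℂ] E)} {d : ℕ → CollapseData E} {w₀ : unitary (E →L[ℂ] E) → ℝ}

namespace IsCollapse

variable (h : IsCollapse V c A M v d)
include h

/-- In the rotated frame the Hamiltonian is that of a stage or, between the two rounds of a step,
its conjugate by the rotation of the step; both commute with the projectors. -/
theorem commute_rotProjBefore {k : ℕ} (hk : k ≤ 2 * c) (x : (collapseScheme d v w₀ c).Param) :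
    Commute (hamiltonian V w₀) ((collapseScheme d v w₀ c).rotProjBefore k x) := by
  have hsa : ∀ {i}, i ≤ c → ∀ w, IsSelfAdjoint (hamiltonian (A i) w) := fun hi w =>
    hamiltonian_isSelfAdjoint (h.frustrated_stage hi).selfAdjoint w
  have hH : IsSelfAdjoint (hamiltonian V w₀) :=
    hamiltonian_isSelfAdjoint h.frustrated.selfAdjoint w₀
  obtain ⟨i, rfl | rfl⟩ : ∃ i, k = 2 * i ∨ k = 2 * i + 1 := ⟨k / 2, by omega⟩
  · have hi : i ≤ c := by omega
    exact h.isCoherent.commute_rotProjBefore hk hH (hsa hi _)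
      (h.stage_hamiltonian_commute hi (by omega) hk x _) (h.stage x hi)
  · have hi : i < c := by omega
    have h1 := h.rot_commute_projBefore (w₀ := w₀) hi le_rfl x
    have h2 := h.stage_hamiltonian_commute (w₀ := w₀) hi.le le_rfl hk x
      (stageWeight d v w₀ (signAt x) i)
    have h3 := h1.star_star
    rw [(h.isCoherent.projBefore_isStarProjection hk x).isSelfAdjoint.star_eq] at h3
    exact h.isCoherent.commute_rotProjBefore hk hH (IsSelfAdjoint.conjugate (hsa hi.le _) _)
      ((h1.mul_left h2).mul_left h3) (h.half_stage hi x (h.stage x hi.le))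

theorem carriesOut
    (hfalse : ∀ i < c, FalseSiblings (frustrationGraph E) (A i) (M i) → ∀ w y, (d i).rot w y = 1)
    (htrue : ∀ i < c, TrueSiblings (frustrationGraph E) (A i) (M i) →
      (d i).syms₁ = [] ∧ (d i).syms₂ = []) :
    (collapseScheme d v w₀ c).CarriesOut (hamiltonian V w₀) c A M (fun i => 2 * i)
      (fun i x => stageWeight d v w₀ (signAt x) i) where
  t_mono i j hij := Nat.mul_le_mul_left 2 hij
  t_zero := rfl
  t_last := rfl
  sym_selfAdjoint := h.isCoherent.sym_selfAdjoint
  sym_mem i _ k h1 h2 j := by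
    obtain rfl : (k : ℕ) / 2 = i := by omega
    exact h.evenProduct_of_mem k.2 (List.getElem_mem _)
  sym_comm := h.isCoherent.sym_comm
  sym_comm_left i hi k hk j g hg :=
    h.sym_comm_stage (le_of_lt hk) k.2 hi (List.getElem_mem _) hg
  sym_comm_outside i hi k h1 h2 j g hg hgM := by
    obtain rfl : (k : ℕ) / 2 = i := by omega
    exact h.evenProduct_comm_outside hi (h.evenProduct_of_mem k.2 (List.getElem_mem _)) hg hgM
  rot_congr := h.isCoherent.rot_congr
  rot_mem i _ k h1 h2 x := by
    obtain rfl : (k : ℕ) / 2 = i := by omega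
    exact h.rot_mem k x
  rot_comm_outside i hi k h1 h2 x g hg hgM := by
    obtain rfl : (k : ℕ) / 2 = i := by omega
    exact h.rotation_comm_outside hi (h.rot_mem k x) hg hgM
  rot_comm_proj l k hlk x y := h.isCoherent.rot_comm_proj l k hlk x y
  false_siblings i hi hF k h1 h2 x := by
    obtain rfl : (k : ℕ) / 2 = i := by omega
    show (if (k : ℕ) % 2 = 0 then _ else 1) = _
    rw [hfalse _ hi hF, ite_self]
  true_siblings i hi hT k h1 h2 := by
    obtain rfl : (k : ℕ) / 2 = i := by omega
    show (roundSyms d k).length = 0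
    rw [roundSyms, (htrue _ hi hT).1, (htrue _ hi hT).2, ite_self, List.length_nil]
  proj_isStarProjection := h.isCoherent.proj_isStarProjection
  proj_orthogonal := h.isCoherent.proj_orthogonal
  proj_complete k := Scheme.IsCoherent.proj_complete k
  rotProj_isStarProjection := h.isCoherent.rotProj_isStarProjection
  rotProj_complete := h.isCoherent.rotProj_complete
  rotProj_comm := h.isCoherent.rotProj_comm
  comm _ hk x := h.commute_rotProjBefore hk x
  weight_congr i _ x y hxy g _ := by
    rw [stageWeight_congr d v w₀ (σ := signAt x) (σ' := signAt y)
      fun k hk => signAt_congr fun l hl => hxy l (by omega)]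
  stage i hi x := h.stage x hi

end IsCollapse

/-- Valid data exist for each step of a collapse sequence. -/
theorem exists_isCollapse (hV : IsFrustrated V)
    (h : IsCollapseSequence (frustrationGraph E) V c A M v) :
    ∃ d : ℕ → CollapseData E, IsCollapse V c A M v d ∧
      (∀ i < c, FalseSiblings (frustrationGraph E) (A i) (M i) → ∀ w y, (d i).rot w y = 1) ∧
      (∀ i < c, TrueSiblings (frustrationGraph E) (A i) (M i) →
        (d i).syms₁ = [] ∧ (d i).syms₂ = []) := by
  have key : ∀ i, ∃ d : CollapseData E, i < c → d.IsValid (M i) (v i) ∧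
      (FalseSiblings (frustrationGraph E) (A i) (M i) → ∀ w y, d.rot w y = 1) ∧
      (TrueSiblings (frustrationGraph E) (A i) (M i) → d.syms₁ = [] ∧ d.syms₂ = []) := fun i => by
    by_cases hi : i < c
    · obtain ⟨d, hd⟩ := exists_collapse (hV.mono (h.start ▸ h.subset (Nat.zero_le i) hi.le))
        (h.collapsible i hi) (h.mem i hi)
      exact ⟨d, fun _ => hd⟩
    · exact (exists_collapse_singleton (v i)).imp fun d _ hi' => absurd hi' hi
  choose d hd using key
  exact ⟨d, ⟨hV, h, fun i hi => (hd i hi).1⟩, fun i hi => (hd i hi).2.1, fun i hi => (hd i hi).2.2⟩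

end CarriesOut

end TwinCollapse

open TwinCollapse in
theorem mainTheorem3 {E : Type*} [NormedAddCommGroup E] [InnerProductSpace ℂ E]
    [FiniteDimensional ℂ E] [CompleteSpace E]
    (S : Subgroup (unitary (E →L[ℂ] E)))
    (hS : ∀ g ∈ S, ∀ h ∈ S, g * h * g⁻¹ * h⁻¹ = 1 ∨ g * h * g⁻¹ * h⁻¹ = -1)
    (hPauli : EquivPauliGroup S)
    (V : Finset (unitary (E →L[ℂ] E)))
    (hVS : ∀ g ∈ V, g ∈ S)
    (hV : ∀ g ∈ V, IsSelfAdjoint (g : E →L[ℂ] E))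
    (w₀ : unitary (E →L[ℂ] E) → ℝ) :
    -- all twins and line-graph modules can be collapsed recursively
    (∃ (c : ℕ) (A M : ℕ → Finset (unitary (E →L[ℂ] E))) (v : ℕ → unitary (E →L[ℂ] E)),
      IsCollapseSequence (frustrationGraph E) V c A M v ∧
        FullyCollapsed (frustrationGraph E) (A c)) ∧
    -- and every recursive collapse, complete or not, is realised by a block-diagonalisation
    (∀ (c : ℕ) (A M : ℕ → Finset (unitary (E →L[ℂ] E))) (v : ℕ → unitary (E →L[ℂ] E)),
      IsCollapseSequence (frustrationGraph E) V c A M v →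
      ∃ (r : ℕ) (D : Scheme E r) (t : ℕ → ℕ)
        (w : ℕ → D.Param → unitary (E →L[ℂ] E) → ℝ),
        D.CarriesOut (hamiltonian V w₀) c A M t w ∧
        -- the `P(x)` form a complete set of commuting orthogonal projectors
        (∀ x, IsStarProjection (D.blockProj x)) ∧
        (∀ x y, x ≠ y → D.blockProj x * D.blockProj y = 0) ∧
        (∑ x, D.blockProj x = 1) ∧
        -- they commute with `H`, which is block diagonal
        (∀ x, Commute (hamiltonian V w₀) (D.blockProj x)) ∧
        (hamiltonian V w₀ = ∑ x, D.blockProj x * hamiltonian V w₀ * D.blockProj x) ∧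
        -- on each block `H` is the rotated collapsed Hamiltonian, which commutes with `P(x)`
        (∀ x, Commute
          (star (D.blockRot x : E →L[ℂ] E) * hamiltonian (A c) (w c x) *
            (D.blockRot x : E →L[ℂ] E)) (D.blockProj x)) ∧
        (∀ x, hamiltonian V w₀ * D.blockProj x =
          star (D.blockRot x : E →L[ℂ] E) * hamiltonian (A c) (w c x) *
            (D.blockRot x : E →L[ℂ] E) * D.blockProj x)) := by
  have hfr := isFrustrated_of_commutator hS hVS hV
  have : Nonempty (unitary (E →L[ℂ] E)) := ⟨1⟩
  refine ⟨exists_complete_collapse _ V, fun c A M v hseq => ?_⟩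
  obtain ⟨d, hd, hfalse, htrue⟩ := exists_isCollapse hfr hseq
  have hD := hd.isCoherent (w₀ := w₀)
  have hP : ∀ x, IsStarProjection ((collapseScheme d v w₀ c).blockProj x) := fun x =>
    hD.rotProjBefore_isStarProjection le_rfl x
  have hcomm : ∀ x, Commute (hamiltonian V w₀) ((collapseScheme d v w₀ c).blockProj x) := fun x =>
    hd.commute_rotProjBefore le_rfl x
  refine ⟨2 * c, collapseScheme d v w₀ c, fun i => 2 * i,
    fun i x => stageWeight d v w₀ (signAt x) i, hd.carriesOut hfalse htrue, hP,
    fun x y hxy => hD.blockProj_orthogonal hxy, hD.sum_blockProj, hcomm, ?_, fun x => ?_,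
    fun x => ?_⟩
  · conv_lhs => rw [← mul_one (hamiltonian V w₀), ← hD.sum_blockProj, Finset.mul_sum]
    refine Finset.sum_congr rfl fun x _ => ?_
    rw [← (hcomm x).eq, mul_assoc, (hP x).isIdempotentElem.eq]
  · rw [Scheme.blockProj, hD.rotProjBefore_eq le_rfl]
    exact Scheme.IsCoherent.commute_conj
      (hd.stage_hamiltonian_commute le_rfl (by omega) le_rfl x _)
  · have h1 := hd.stage x le_rfl
    have h2 : star ((collapseScheme d v w₀ c).rotBefore (2 * c) x : E →L[ℂ] E) *
        ((collapseScheme d v w₀ c).rotBefore (2 * c) x : E →L[ℂ] E) = 1 := by simp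
    have h3 : ((collapseScheme d v w₀ c).rotBefore (2 * c) x : E →L[ℂ] E) *
        star ((collapseScheme d v w₀ c).rotBefore (2 * c) x : E →L[ℂ] E) = 1 := by simp
    rw [Scheme.blockProj, Scheme.blockRot, hD.rotProjBefore_eq le_rfl]
    set u : E →L[ℂ] E := ((collapseScheme d v w₀ c).rotBefore (2 * c) x : E →L[ℂ] E)
    set Q := (collapseScheme d v w₀ c).projBefore (2 * c) x
    set K := hamiltonian (A c) (stageWeight d v w₀ (signAt x) c)
    calc hamiltonian V w₀ * (star u * Q * u)
        = star u * u * hamiltonian V w₀ * (star u * Q * u) := by rw [h2, one_mul]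
      _ = star u * (u * hamiltonian V w₀ * star u * Q) * u := by simp only [mul_assoc]
      _ = star u * (K * Q) * u := by rw [h1]
      _ = star u * K * (u * star u) * Q * u := by rw [h3, mul_one]; simp only [mul_assoc]
      _ = star u * K * u * (star u * Q * u) := by simp only [mul_assoc]
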